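/- Consider the $(3,4)$-curve $y^3=(\mu_8+\mu_5x+\mu_2x^2)y+x^4+\mu_6x^2+\mu_9x+\mu_{12}$ with indeterminates $\mu=(\mu_2,\mu_5,\mu_6,\mu_8,\mu_9,\mu_{12})$, and let $\mathbb{Q}[\mu][[u_5,u_2,u_1]]$ be the ring of formal power series in $u_5,u_2,u_1$ over the polynomial ring $\mathbb{Q}[\mu]$. **Operators.** Put $(v_1,\dots,v_6)=(0,3,4,6,7,10)$, $(m_1,\dots,m_6)=(2,5,6,8,9,12)$ and $L_{v_i}=\sum_{j=1}^{6}V_{ij}\,\partial/\partial\mu_{m_j}$, where $V$ is the symmetric matrix with $V_{11}=2\mu_{2},\ V_{12}=5\mu_{5},\ V_{13}=6\mu_{6},\ V_{14}=8\mu_{8},\ V_{15}=9\mu_{9},\ V_{16}=12\mu_{12}$; $V_{22}=\tfrac{1}{6}\mu_{2}^{4}-4\mu_{2}\mu_{6}+8\mu_{8},\ V_{23}=-\tfrac{1}{2}\mu_{2}^{2}\mu_{5}+9\mu_{9},\ V_{24}=\tfrac{1}{12}\mu_{2}^{3}\mu_{5}-\tfrac{1}{2}\mu_{2}\mu_{9}-\tfrac{3}{2}\mu_{5}\mu_{6},\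 V_{25}=\tfrac{1}{6}\mu_{2}^{3}\mu_{6}-\tfrac{1}{3}\mu_{2}^{2}\mu_{8}-\tfrac{1}{6}\mu_{2}\mu_{5}^{2}-3\mu_{6}^{2}+12\mu_{12},\ V_{26}=\tfrac{1}{12}\mu_{2}^{3}\mu_{9}-\tfrac{1}{6}\mu_{2}\mu_{5}\mu_{8}-\tfrac{3}{2}\mu_{6}\mu_{9}$; $V_{33}=\tfrac{2}{3}\mu_{2}^{2}\mu_{6}+\tfrac{10}{3}\mu_{2}\mu_{8}+\tfrac{5}{3}\mu_{5}^{2},\ V_{34}=\tfrac{4}{3}\mu_{2}^{2}\mu_{8}-\tfrac{7}{12}\mu_{2}\mu_{5}^{2}+12\mu_{12},\ V_{35}=\tfrac{4}{3}\mu_{2}^{2}\mu_{9}-\tfrac{7}{6}\mu_{2}\mu_{5}\mu_{6}+\tfrac{13}{3}\mu_{5}\mu_{8},\ V_{36}=2\mu_{2}^{2}\mu_{12}-\tfrac{7}{12}\mu_{2}\mu_{5}\mu_{9}+\tfrac{8}{3}\mu_{8}^{2}$; $V_{44}=\tfrac{1}{24}\mu_{2}^{2}\mu_{5}^{2}+6\mu_{2}\mu_{12}-\tfrac{7}{2}\mu_{5}\mu_{9}+4\mu_{6}\mu_{8},\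 V_{45}=\tfrac{1}{12}\mu_{2}^{2}\mu_{5}\mu_{6}+\tfrac{7}{6}\mu_{2}\mu_{5}\mu_{8}-\tfrac{5}{12}\mu_{5}^{3}-\tfrac{3}{2}\mu_{6}\mu_{9},\ V_{46}=\tfrac{1}{24}\mu_{2}^{2}\mu_{5}\mu_{9}+\tfrac{4}{3}\mu_{2}\mu_{8}^{2}-\tfrac{5}{12}\mu_{5}^{2}\mu_{8}+6\mu_{6}\mu_{12}-\tfrac{9}{4}\mu_{9}^{2}$; $V_{55}=\tfrac{1}{6}\mu_{2}^{2}\mu_{6}^{2}+2\mu_{2}^{2}\mu_{12}+\tfrac{5}{3}\mu_{2}\mu_{5}\mu_{9}-\tfrac{8}{3}\mu_{2}\mu_{6}\mu_{8}-\tfrac{4}{3}\mu_{5}^{2}\mu_{6}+\tfrac{8}{3}\mu_{8}^{2},\ V_{56}=\tfrac{1}{12}\mu_{2}^{2}\mu_{6}\mu_{9}+3\mu_{2}\mu_{5}\mu_{12}-\tfrac{5}{6}\mu_{2}\mu_{8}\mu_{9}-\tfrac{5}{12}\mu_{5}^{2}\mu_{9}-\tfrac{1}{2}\mu_{5}\mu_{6}\mu_{8}$;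 $V_{66}=\tfrac{1}{24}\mu_{2}^{2}\mu_{9}^{2}+2\mu_{2}\mu_{8}\mu_{12}+\mu_{5}^{2}\mu_{12}-\tfrac{11}{6}\mu_{5}\mu_{8}\mu_{9}+\tfrac{4}{3}\mu_{6}\mu_{8}^{2}$; here $\det V$ is, up to a constant factor, the discriminant $\varDelta$ of the curve. For $j\in\{0,3,4,6,7,10\}$ put $$H_j=\sum_{a,b=1}^3\Big(\tfrac12(\alpha_j)_{ab}\frac{\partial^2}{\partial u_{(a)}\partial u_{(b)}}+(\beta_j)_{ab}\,u_{(a)}\frac{\partial}{\partial u_{(b)}}+\tfrac12(\gamma_j)_{ab}\,u_{(a)}u_{(b)}\Big)+\tfrac12\operatorname{Tr}\beta_j-\tfrac18\lambda_j ,$$ where $(u_{(1)},u_{(2)},u_{(3)})=(u_5,u_2,u_1)$, where $(\lambda_0,\lambda_3,\lambda_4,\lambda_6,\lambda_7,\lambda_{10})=(72,\;0,\;8\mu_2^2,\;12\mu_6,\;8\mu_2\mu_5,\;\mu_5^2+4\mu_2\mu_8)$ are the polynomials $L_j(\varDelta)/\varDelta$, and where $\alpha_0=0$, $\beta_0=\operatorname{diag}(5,2,1)$,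 $\gamma_0=0$; $\alpha_{3}=\begin{pmatrix}0 & 0 & 0\\ 0 & 0 & 1\\ 0 & 1 & 0\end{pmatrix},\quad \beta_{3}=\begin{pmatrix}0 & \tfrac{1}{12}\mu_{2}^{3}-\tfrac{3}{2}\mu_{6} & -\tfrac{1}{6}\mu_{2}\mu_{5}\\ 2 & 0 & -\tfrac{1}{3}\mu_{2}^{2}\\ 0 & -\tfrac{1}{2}\mu_{2} & 0\end{pmatrix}$, $\gamma_{3}$ symmetric with $(\gamma_{3})_{11}=5\mu_{5}\mu_{8}-\tfrac{1}{3}\mu_{2}^{2}\mu_{9}+\tfrac{1}{12}\mu_{2}^{4}\mu_{5}-\tfrac{5}{3}\mu_{2}\mu_{5}\mu_{6}$, $(\gamma_{3})_{12}=-\mu_{2}\mu_{8}$, $(\gamma_{3})_{13}=\mu_{9}$, $(\gamma_{3})_{22}=\tfrac{2}{3}\mu_{2}\mu_{5}$, $(\gamma_{3})_{23}=\tfrac{1}{6}\mu_{2}^{3}-\mu_{6}$, $(\gamma_{3})_{33}=\mu_{5}$; $\alpha_{4}=\begin{pmatrix}0 & 0 & 0\\ 0 & 1 & 0\\ 0 &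 0 & \tfrac{1}{3}\mu_{2}\end{pmatrix},\quad \beta_{4}=\begin{pmatrix}\tfrac{2}{3}\mu_{2}^{2} & -\tfrac{7}{12}\mu_{2}\mu_{5} & \tfrac{5}{3}\mu_{8}\\ 0 & 0 & \tfrac{2}{3}\mu_{5}\\ 1 & 0 & 0\end{pmatrix}$, $\gamma_{4}$ symmetric with $(\gamma_{4})_{11}=-\tfrac{7}{12}\mu_{2}^{2}\mu_{5}^{2}+9\mu_{2}\mu_{12}+\tfrac{5}{3}\mu_{5}\mu_{9}+\tfrac{11}{3}\mu_{6}\mu_{8}$, $(\gamma_{4})_{12}=\tfrac{2}{3}\mu_{2}\mu_{9}$, $(\gamma_{4})_{13}=-\tfrac{1}{3}\mu_{2}\mu_{8}$, $(\gamma_{4})_{22}=\tfrac{4}{3}\mu_{2}\mu_{6}+\tfrac{4}{3}\mu_{8}$, $(\gamma_{4})_{23}=-\tfrac{1}{2}\mu_{2}\mu_{5}$, $(\gamma_{4})_{33}=\mu_{6}$; $\alpha_{6}=\begin{pmatrix}0 & 0 & 1\\ 0 & 0 & 0\\ 1 & 0 & 0\end{pmatrix},\quad \beta_{6}=\begin{pmatrix}\mu_{6}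 & \tfrac{1}{24}\mu_{2}^{2}\mu_{5}-\tfrac{5}{4}\mu_{9} & \tfrac{1}{3}\mu_{2}\mu_{8}-\tfrac{5}{12}\mu_{5}^{2}\\ 0 & 0 & -\tfrac{1}{6}\mu_{2}\mu_{5}\\ 0 & -\tfrac{1}{4}\mu_{5} & 0\end{pmatrix}$, $\gamma_{6}$ symmetric with $(\gamma_{6})_{11}=\tfrac{1}{24}\mu_{2}^{3}\mu_{5}^{2}+4\mu_{2}^{2}\mu_{12}-\tfrac{29}{12}\mu_{2}\mu_{5}\mu_{9}+\tfrac{4}{3}\mu_{2}\mu_{6}\mu_{8}-\tfrac{5}{12}\mu_{5}^{2}\mu_{6}+6\mu_{8}^{2}$, $(\gamma_{6})_{12}=\tfrac{1}{2}\mu_{5}\mu_{8}$, $(\gamma_{6})_{13}=3\mu_{12}$, $(\gamma_{6})_{22}=\tfrac{8}{3}\mu_{2}\mu_{8}-\tfrac{1}{3}\mu_{5}^{2}$, $(\gamma_{6})_{23}=\tfrac{1}{12}\mu_{2}^{2}\mu_{5}-\tfrac{1}{2}\mu_{9}$, $(\gamma_{6})_{33}=2\mu_{8}$; $\alpha_{7}=\begin{pmatrix}0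 & 1 & 0\\ 1 & 0 & 0\\ 0 & 0 & \tfrac{1}{3}\mu_{5}\end{pmatrix},\quad \beta_{7}=\begin{pmatrix}\tfrac{2}{3}\mu_{2}\mu_{5} & \tfrac{1}{12}\mu_{2}^{2}\mu_{6}-\tfrac{7}{6}\mu_{2}\mu_{8}-\tfrac{5}{12}\mu_{5}^{2} & \tfrac{1}{3}\mu_{2}\mu_{9}-\tfrac{1}{2}\mu_{5}\mu_{6}\\ 0 & 0 & -\tfrac{1}{3}\mu_{2}\mu_{6}+\tfrac{2}{3}\mu_{8}\\ 0 & -\tfrac{1}{2}\mu_{6} & 0\end{pmatrix}$, $\gamma_{7}$ symmetric with $(\gamma_{7})_{11}=-\tfrac{5}{12}\mu_{2}\mu_{5}^{3}-\tfrac{1}{2}\mu_{5}\mu_{6}^{2}+5\mu_{5}\mu_{12}+\tfrac{14}{3}\mu_{8}\mu_{9}+\tfrac{1}{12}\mu_{2}^{3}\mu_{5}\mu_{6}-\tfrac{1}{6}\mu_{2}^{2}\mu_{5}\mu_{8}-\mu_{2}\mu_{6}\mu_{9}$, $(\gamma_{7})_{12}=2\mu_{2}\mu_{12}+\tfrac{2}{3}\mu_{5}\mu_{9}-\mu_{6}\mu_{8}$,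 $(\gamma_{7})_{13}=\tfrac{2}{3}\mu_{5}\mu_{8}$, $(\gamma_{7})_{22}=\tfrac{8}{3}\mu_{2}\mu_{9}-\tfrac{2}{3}\mu_{5}\mu_{6}$, $(\gamma_{7})_{23}=-\tfrac{1}{6}\mu_{5}^{2}+\tfrac{1}{6}\mu_{2}^{2}\mu_{6}-\tfrac{1}{3}\mu_{2}\mu_{8}$, $(\gamma_{7})_{33}=2\mu_{9}$; $\alpha_{10}=\begin{pmatrix}1 & 0 & 0\\ 0 & 0 & 0\\ 0 & 0 & \tfrac{1}{3}\mu_{8}\end{pmatrix},\quad \beta_{10}=\begin{pmatrix}-\tfrac{1}{3}\mu_{2}\mu_{8} & \tfrac{1}{24}\mu_{2}^{2}\mu_{9}-\tfrac{5}{12}\mu_{5}\mu_{8} & \mu_{2}\mu_{12}-\tfrac{5}{12}\mu_{5}\mu_{9}+\tfrac{1}{3}\mu_{6}\mu_{8}\\ 0 & 0 & -\tfrac{1}{6}\mu_{2}\mu_{9}\\ 0 & -\tfrac{1}{4}\mu_{9} & 0\end{pmatrix}$, $\gamma_{10}$ symmetric with $(\gamma_{10})_{11}=\tfrac{1}{24}\mu_{2}^{3}\mu_{5}\mu_{9}+\mu_{2}^{2}\mu_{8}^{2}-\tfrac{5}{12}\mu_{2}\mu_{5}^{2}\mu_{8}+3\mu_{2}\mu_{6}\mu_{12}-\tfrac{7}{6}\mu_{2}\mu_{9}^{2}-\tfrac{5}{12}\mu_{5}\mu_{6}\mu_{9}+\tfrac{1}{3}\mu_{6}^{2}\mu_{8}+9\mu_{8}\mu_{12}$,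 $(\gamma_{10})_{12}=2\mu_{5}\mu_{12}-\tfrac{5}{6}\mu_{8}\mu_{9}$, $(\gamma_{10})_{13}=\tfrac{2}{3}\mu_{8}^{2}$, $(\gamma_{10})_{22}=4\mu_{2}\mu_{12}-\tfrac{1}{3}\mu_{5}\mu_{9}$, $(\gamma_{10})_{23}=-\tfrac{1}{6}\mu_{5}\mu_{8}+\tfrac{1}{12}\mu_{2}^{2}\mu_{9}$, $(\gamma_{10})_{33}=3\mu_{12}$; **Hurwitz series.** For integers $\ell,m,n_2,n_5,n_6,n_8,n_9,n_{12}$ put $k=5-5\ell-2m+W$ with $W=2n_2+5n_5+6n_6+8n_8+9n_9+12n_{12}$ (the weight). A *coefficient family* is a family of rational numbers $b(\ell,m,n)$, $n=(n_2,\dots,n_{12})$, that vanishes whenever one of the eight indices or $k$ is negative. To it belongs the series $$\sigma_b=\sum b(\ell,m,n)\,\frac{\mu_2^{n_2}\mu_5^{n_5}\mu_6^{n_6}\mu_8^{n_8}\mu_9^{n_9}\mu_{12}^{n_{12}}\,u_5^{\ell}u_2^{m}u_1^{k}}{\ell!\,m!\,k!}.$$ **Recurrences.** For $j=3,4,6,7,10$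 and indices with $\ell,m,n_i\ge 0$, $k\ge j$, let $R_j$ at $(\ell,m,n)$ be the linear relation which says that the coefficient of $\mu^n u_5^{\ell}u_2^{m}u_1^{k-j}$ in $(L_j-H_j)\sigma_b$ is zero, multiplied by $\ell!\,m!\,(k-j)!$ times a nonzero constant, so that it reads $$\begin{aligned} R_3:&\quad 24\,b(\ell,m+1,n)+48m\,b(\ell+1,m-1,n)=r_3(\ell,m,n),\\ R_4:&\quad -12\,b(\ell,m+2,n)+24(4-k)\,b(\ell+1,m,n)=r_4(\ell,m,n),\\ R_6:&\quad b(\ell+1,m,n)=r_6(\ell,m,n),\qquad R_7:\ b(\ell+1,m+1,n)=r_7(\ell,m,n),\qquad R_{10}:\ b(\ell+2,m,n)=r_{10}(\ell,m,n), \end{aligned}$$ where the $r_j$ are explicit rational linear combinations of values of $b$ of weight smaller than $W$ (by at least $2,2,5,5,8$ for $j=3,4,6,7,10$), with coefficients that are polynomials of degree at most two in the indices; $r_3,r_4,r_6,r_7,r_{10}$ have $32,25,36,46,41$ terms. The terms of $r_3$ and $r_4$ of weight $W-2$ are $-12(3-k)\,b(\ell,m+1,n_2-1,\dots)$ and $4\,b(\ell,m,n_2-1,\dots)$;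 write $r_3'$, $r_4'$ for the sums of the other terms. Let $$\begin{aligned} S_{3,4}:&\quad (k-m+1)\,b(\ell,m,n)=s(\ell,m,n):=\tfrac{k}{24}\,r_3(\ell,m-1,n)+\tfrac{m-1}{12}\,r_4(\ell,m-2,n)\quad(m\ne0),\\ T_{3,4}:&\quad (k-m)\,b(\ell,m,n)=-\tfrac1{48}\big(r_3(\ell-1,m+1,n)+2r_4(\ell-1,m,n)\big)\quad(\ell\ne0), \end{aligned}$$ for $\ell,m,n_i,k\ge0$, where $k$ belongs to $(\ell,m,n)$. **Recursion scheme.** For $c\in\mathbb{Q}$ say that $b$ is *computed by the scheme from $c$* if every $b(\ell,m,n)$ is given by the first applicable line of $$b(\ell,m,n)=\begin{cases} 0&\min(k,\ell,m,n_2,\dots,n_{12})<0,\\ c&\ell=1,\ m=n_2=\dots=n_{12}=0,\\ r_{10}(\ell-2,m,n)&\ell>1,\\ r_7(\ell-1,m-1,n)&\ell>0,\ m>0,\\ r_6(\ell-1,m,n)&\ell>0,\ k>0,\\ s(\ell,m,n)/(k-m+1)&\ell=0,\ m\ne0,\ m\ne k+1,\\ t(n)&\ell=m=0,\\ -2(m-1)\,b(1,m-2,n)+\tfrac1{24}r_3(0,m-1,n)&\ell=0,\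 m=k+1, \end{cases}$$ where $t(n)=-6(k-3)\,b(1,0,n^+)-\tfrac32(k-3)\,b(0,2,n)-\tfrac18\big(r_3'(0,1,n^+)+2r_4'(0,0,n^+)\big)$, $n^+$ is $n$ with $n_2$ replaced by $n_2+1$, and $k$ belongs to $(0,0,n)$. **Theorem.** 1. The $\mathbb{Q}$-vector space of all $\varphi\in\mathbb{Q}[\mu][[u_5,u_2,u_1]]$ with $(L_j-H_j)\varphi=0$ for $j=0,3,4,6,7,10$ has dimension exactly one. 2. A series $\varphi$ satisfies $(L_0-H_0)\varphi=0$ if and only if $\varphi=\sigma_b$ for some coefficient family $b$. 3. For every coefficient family $b$ and $j=3,4,6,7,10$: $(L_j-H_j)\sigma_b=0$ if and only if $b$ satisfies $R_j$ at all indices with $\ell,m,n_i\ge0$, $k\ge j$. 4. Every coefficient family that satisfies $R_3$ and $R_4$ satisfies $S_{3,4}$ and $T_{3,4}$. 5. For every $c\in\mathbb{Q}$ there is exactly one family $b$ that is computed by the scheme from $c$. A series $\sigma_b$ lies in the solution space of part 1 if and only if $b$ is computed by the scheme from $b(1,0,\dots,0)$. Hence every coefficient of a solution is fixed by $b(1,0,\dots,0)$.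 -/

import Mathlib

namespace Curve34

noncomputable section

/-- The ring `ℚ[μ]`; the variables `0, …, 5` are `μ_2, μ_5, μ_6, μ_8, μ_9, μ_12`. -/
abbrev Poly : Type := MvPolynomial (Fin 6) ℚ

/-- The ring `ℚ[μ][[u_5, u_2, u_1]]`; the variables `0, 1, 2` are `u_5, u_2, u_1`. -/
abbrev Series : Type := MvPowerSeries (Fin 3) Poly

abbrev μ2 : Poly := MvPolynomial.X 0
abbrev μ5 : Poly := MvPolynomial.X 1
abbrev μ6 : Poly := MvPolynomial.X 2
abbrev μ8 : Poly := MvPolynomial.X 3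
abbrev μ9 : Poly := MvPolynomial.X 4
abbrev μ12 : Poly := MvPolynomial.X 5

/-- The symmetric matrix `V`; the columns belong to `∂/∂μ_2, ∂/∂μ_5, ∂/∂μ_6, ∂/∂μ_8, ∂/∂μ_9,
∂/∂μ_12` and the rows to `L_0, L_3, L_4, L_6, L_7, L_10`. -/
def matV : Matrix (Fin 6) (Fin 6) Poly :=
  !![2 * μ2, 5 * μ5, 6 * μ6, 8 * μ8, 9 * μ9, 12 * μ12;
     5 * μ5, (1/6 : ℚ) • (μ2^4) - 4 * μ2 * μ6 + 8 * μ8, -(1/2 : ℚ) • (μ2^2 * μ5) + 9 * μ9,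
         (1/12 : ℚ) • (μ2^3 * μ5) - (1/2 : ℚ) • (μ2 * μ9) - (3/2 : ℚ) • (μ5 * μ6),
         (1/6 : ℚ) • (μ2^3 * μ6) - (1/3 : ℚ) • (μ2^2 * μ8) - (1/6 : ℚ) • (μ2 * μ5^2) - 3 * μ6^2
         + 12 * μ12, (1/12 : ℚ) • (μ2^3 * μ9) - (1/6 : ℚ) • (μ2 * μ5 * μ8)
         - (3/2 : ℚ) • (μ6 * μ9);
     6 * μ6, -(1/2 : ℚ) • (μ2^2 * μ5) + 9 * μ9, (2/3 : ℚ) • (μ2^2 * μ6) + (10/3 : ℚ) • (μ2 * μ8)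
         + (5/3 : ℚ) • (μ5^2), (4/3 : ℚ) • (μ2^2 * μ8) - (7/12 : ℚ) • (μ2 * μ5^2) + 12 * μ12,
         (4/3 : ℚ) • (μ2^2 * μ9) - (7/6 : ℚ) • (μ2 * μ5 * μ6) + (13/3 : ℚ) • (μ5 * μ8),
         2 * μ2^2 * μ12 - (7/12 : ℚ) • (μ2 * μ5 * μ9) + (8/3 : ℚ) • (μ8^2);
     8 * μ8, (1/12 : ℚ) • (μ2^3 * μ5) - (1/2 : ℚ) • (μ2 * μ9) - (3/2 : ℚ) • (μ5 * μ6),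
         (4/3 : ℚ) • (μ2^2 * μ8) - (7/12 : ℚ) • (μ2 * μ5^2) + 12 * μ12,
         (1/24 : ℚ) • (μ2^2 * μ5^2) + 6 * μ2 * μ12 - (7/2 : ℚ) • (μ5 * μ9) + 4 * μ6 * μ8,
         (1/12 : ℚ) • (μ2^2 * μ5 * μ6) + (7/6 : ℚ) • (μ2 * μ5 * μ8) - (5/12 : ℚ) • (μ5^3)
         - (3/2 : ℚ) • (μ6 * μ9), (1/24 : ℚ) • (μ2^2 * μ5 * μ9) + (4/3 : ℚ) • (μ2 * μ8^2)
         - (5/12 : ℚ) • (μ5^2 * μ8) + 6 * μ6 * μ12 - (9/4 : ℚ) • (μ9^2);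
     9 * μ9, (1/6 : ℚ) • (μ2^3 * μ6) - (1/3 : ℚ) • (μ2^2 * μ8) - (1/6 : ℚ) • (μ2 * μ5^2)
         - 3 * μ6^2 + 12 * μ12, (4/3 : ℚ) • (μ2^2 * μ9) - (7/6 : ℚ) • (μ2 * μ5 * μ6)
         + (13/3 : ℚ) • (μ5 * μ8), (1/12 : ℚ) • (μ2^2 * μ5 * μ6) + (7/6 : ℚ) • (μ2 * μ5 * μ8)
         - (5/12 : ℚ) • (μ5^3) - (3/2 : ℚ) • (μ6 * μ9), (1/6 : ℚ) • (μ2^2 * μ6^2)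
         + 2 * μ2^2 * μ12 + (5/3 : ℚ) • (μ2 * μ5 * μ9) - (8/3 : ℚ) • (μ2 * μ6 * μ8)
         - (4/3 : ℚ) • (μ5^2 * μ6) + (8/3 : ℚ) • (μ8^2), (1/12 : ℚ) • (μ2^2 * μ6 * μ9)
         + 3 * μ2 * μ5 * μ12 - (5/6 : ℚ) • (μ2 * μ8 * μ9) - (5/12 : ℚ) • (μ5^2 * μ9)
         - (1/2 : ℚ) • (μ5 * μ6 * μ8);
     12 * μ12, (1/12 : ℚ) • (μ2^3 * μ9) - (1/6 : ℚ) • (μ2 * μ5 * μ8) - (3/2 : ℚ) • (μ6 * μ9),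
         2 * μ2^2 * μ12 - (7/12 : ℚ) • (μ2 * μ5 * μ9) + (8/3 : ℚ) • (μ8^2),
         (1/24 : ℚ) • (μ2^2 * μ5 * μ9) + (4/3 : ℚ) • (μ2 * μ8^2) - (5/12 : ℚ) • (μ5^2 * μ8)
         + 6 * μ6 * μ12 - (9/4 : ℚ) • (μ9^2), (1/12 : ℚ) • (μ2^2 * μ6 * μ9) + 3 * μ2 * μ5 * μ12
         - (5/6 : ℚ) • (μ2 * μ8 * μ9) - (5/12 : ℚ) • (μ5^2 * μ9) - (1/2 : ℚ) • (μ5 * μ6 * μ8),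
         (1/24 : ℚ) • (μ2^2 * μ9^2) + 2 * μ2 * μ8 * μ12 + μ5^2 * μ12
         - (11/6 : ℚ) • (μ5 * μ8 * μ9) + (4/3 : ℚ) • (μ6 * μ8^2)]

/-! The matrices `α_j, β_j, γ_j` of the operators `H_j`; rows and columns are indexed by
`u_5, u_2, u_1`. -/

def alpha0 : Matrix (Fin 3) (Fin 3) Poly :=
  !![0, 0, 0;
     0, 0, 0;
     0, 0, 0]

def alpha3 : Matrix (Fin 3) (Fin 3) Poly :=
  !![0, 0, 0;
     0, 0, 1;
     0, 1, 0]

def alpha4 : Matrix (Fin 3) (Fin 3) Poly :=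
  !![0, 0, 0;
     0, 1, 0;
     0, 0, (1/3 : ℚ) • (μ2)]

def alpha6 : Matrix (Fin 3) (Fin 3) Poly :=
  !![0, 0, 1;
     0, 0, 0;
     1, 0, 0]

def alpha7 : Matrix (Fin 3) (Fin 3) Poly :=
  !![0, 1, 0;
     1, 0, 0;
     0, 0, (1/3 : ℚ) • (μ5)]

def alpha10 : Matrix (Fin 3) (Fin 3) Poly :=
  !![1, 0, 0;
     0, 0, 0;
     0, 0, (1/3 : ℚ) • (μ8)]

def beta0 : Matrix (Fin 3) (Fin 3) Poly :=
  !![5, 0, 0;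
     0, 2, 0;
     0, 0, 1]

def beta3 : Matrix (Fin 3) (Fin 3) Poly :=
  !![0, (1/12 : ℚ) • (μ2^3) - (3/2 : ℚ) • (μ6), -(1/6 : ℚ) • (μ2 * μ5);
     2, 0, -(1/3 : ℚ) • (μ2^2);
     0, -(1/2 : ℚ) • (μ2), 0]

def beta4 : Matrix (Fin 3) (Fin 3) Poly :=
  !![(2/3 : ℚ) • (μ2^2), -(7/12 : ℚ) • (μ2 * μ5), (5/3 : ℚ) • (μ8);
     0, 0, (2/3 : ℚ) • (μ5);
     1, 0, 0]

def beta6 : Matrix (Fin 3) (Fin 3) Poly :=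
  !![μ6, (1/24 : ℚ) • (μ2^2 * μ5) - (5/4 : ℚ) • (μ9), (1/3 : ℚ) • (μ2 * μ8) - (5/12 : ℚ) • (μ5^2);
     0, 0, -(1/6 : ℚ) • (μ2 * μ5);
     0, -(1/4 : ℚ) • (μ5), 0]

def beta7 : Matrix (Fin 3) (Fin 3) Poly :=
  !![(2/3 : ℚ) • (μ2 * μ5), (1/12 : ℚ) • (μ2^2 * μ6) - (7/6 : ℚ) • (μ2 * μ8)
      - (5/12 : ℚ) • (μ5^2), (1/3 : ℚ) • (μ2 * μ9) - (1/2 : ℚ) • (μ5 * μ6);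
     0, 0, -(1/3 : ℚ) • (μ2 * μ6) + (2/3 : ℚ) • (μ8);
     0, -(1/2 : ℚ) • (μ6), 0]

def beta10 : Matrix (Fin 3) (Fin 3) Poly :=
  !![-(1/3 : ℚ) • (μ2 * μ8), (1/24 : ℚ) • (μ2^2 * μ9) - (5/12 : ℚ) • (μ5 * μ8), μ2 * μ12
      - (5/12 : ℚ) • (μ5 * μ9) + (1/3 : ℚ) • (μ6 * μ8);
     0, 0, -(1/6 : ℚ) • (μ2 * μ9);
     0, -(1/4 : ℚ) • (μ9), 0]

def gamma0 : Matrix (Fin 3) (Fin 3) Poly :=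
  !![0, 0, 0;
     0, 0, 0;
     0, 0, 0]

def gamma3 : Matrix (Fin 3) (Fin 3) Poly :=
  !![5 * μ5 * μ8 - (1/3 : ℚ) • (μ2^2 * μ9) + (1/12 : ℚ) • (μ2^4 * μ5)
      - (5/3 : ℚ) • (μ2 * μ5 * μ6), -μ2 * μ8, μ9;
     -μ2 * μ8, (2/3 : ℚ) • (μ2 * μ5), (1/6 : ℚ) • (μ2^3) - μ6;
     μ9, (1/6 : ℚ) • (μ2^3) - μ6, μ5]

def gamma4 : Matrix (Fin 3) (Fin 3) Poly :=
  !![-(7/12 : ℚ) • (μ2^2 * μ5^2) + 9 * μ2 * μ12 + (5/3 : ℚ) • (μ5 * μ9) + (11/3 : ℚ) • (μ6 * μ8),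
      (2/3 : ℚ) • (μ2 * μ9), -(1/3 : ℚ) • (μ2 * μ8);
     (2/3 : ℚ) • (μ2 * μ9), (4/3 : ℚ) • (μ2 * μ6) + (4/3 : ℚ) • (μ8), -(1/2 : ℚ) • (μ2 * μ5);
     -(1/3 : ℚ) • (μ2 * μ8), -(1/2 : ℚ) • (μ2 * μ5), μ6]

def gamma6 : Matrix (Fin 3) (Fin 3) Poly :=
  !![(1/24 : ℚ) • (μ2^3 * μ5^2) + 4 * μ2^2 * μ12 - (29/12 : ℚ) • (μ2 * μ5 * μ9)
      + (4/3 : ℚ) • (μ2 * μ6 * μ8) - (5/12 : ℚ) • (μ5^2 * μ6) + 6 * μ8^2, (1/2 : ℚ) • (μ5 * μ8),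
      3 * μ12;
     (1/2 : ℚ) • (μ5 * μ8), (8/3 : ℚ) • (μ2 * μ8) - (1/3 : ℚ) • (μ5^2), (1/12 : ℚ) • (μ2^2 * μ5)
         - (1/2 : ℚ) • (μ9);
     3 * μ12, (1/12 : ℚ) • (μ2^2 * μ5) - (1/2 : ℚ) • (μ9), 2 * μ8]

def gamma7 : Matrix (Fin 3) (Fin 3) Poly :=
  !![-(5/12 : ℚ) • (μ2 * μ5^3) - (1/2 : ℚ) • (μ5 * μ6^2) + 5 * μ5 * μ12 + (14/3 : ℚ) • (μ8 * μ9)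
      + (1/12 : ℚ) • (μ2^3 * μ5 * μ6) - (1/6 : ℚ) • (μ2^2 * μ5 * μ8) - μ2 * μ6 * μ9, 2 * μ2 * μ12
      + (2/3 : ℚ) • (μ5 * μ9) - μ6 * μ8, (2/3 : ℚ) • (μ5 * μ8);
     2 * μ2 * μ12 + (2/3 : ℚ) • (μ5 * μ9) - μ6 * μ8, (8/3 : ℚ) • (μ2 * μ9)
         - (2/3 : ℚ) • (μ5 * μ6), -(1/6 : ℚ) • (μ5^2) + (1/6 : ℚ) • (μ2^2 * μ6)
         - (1/3 : ℚ) • (μ2 * μ8);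
     (2/3 : ℚ) • (μ5 * μ8), -(1/6 : ℚ) • (μ5^2) + (1/6 : ℚ) • (μ2^2 * μ6)
         - (1/3 : ℚ) • (μ2 * μ8), 2 * μ9]

def gamma10 : Matrix (Fin 3) (Fin 3) Poly :=
  !![(1/24 : ℚ) • (μ2^3 * μ5 * μ9) + μ2^2 * μ8^2 - (5/12 : ℚ) • (μ2 * μ5^2 * μ8)
      + 3 * μ2 * μ6 * μ12 - (7/6 : ℚ) • (μ2 * μ9^2) - (5/12 : ℚ) • (μ5 * μ6 * μ9)
      + (1/3 : ℚ) • (μ6^2 * μ8) + 9 * μ8 * μ12, 2 * μ5 * μ12 - (5/6 : ℚ) • (μ8 * μ9),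
      (2/3 : ℚ) • (μ8^2);
     2 * μ5 * μ12 - (5/6 : ℚ) • (μ8 * μ9), 4 * μ2 * μ12 - (1/3 : ℚ) • (μ5 * μ9),
         -(1/6 : ℚ) • (μ5 * μ8) + (1/12 : ℚ) • (μ2^2 * μ9);
     (2/3 : ℚ) • (μ8^2), -(1/6 : ℚ) • (μ5 * μ8) + (1/12 : ℚ) • (μ2^2 * μ9), 3 * μ12]

/-! In the following families the index `0, …, 5` stands for the operators with subscript
`0, 3, 4, 6, 7, 10`. -/

def matAlpha : Fin 6 → Matrix (Fin 3) (Fin 3) Poly :=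
  ![alpha0, alpha3, alpha4, alpha6, alpha7, alpha10]

def matBeta : Fin 6 → Matrix (Fin 3) (Fin 3) Poly :=
  ![beta0, beta3, beta4, beta6, beta7, beta10]

def matGamma : Fin 6 → Matrix (Fin 3) (Fin 3) Poly :=
  ![gamma0, gamma3, gamma4, gamma6, gamma7, gamma10]

/-- The polynomials `L_j(Δ)/Δ`, where `Δ = det V` is the discriminant of the curve
(up to a constant factor). -/
def logDerivDisc : Fin 6 → Poly :=
  ![72, 0, 8 * μ2^2, 12 * μ6, 8 * μ2 * μ5, μ5^2 + 4 * μ2 * μ8]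

/-- Multiplication by an element of `ℚ[μ]`. -/
def mulPoly (p : Poly) : Module.End ℚ Series :=
  LinearMap.mulLeft ℚ (MvPowerSeries.C p : Series)

/-- Multiplication by the variable `u_i`. -/
def mulU (i : Fin 3) : Module.End ℚ Series :=
  LinearMap.mulLeft ℚ (MvPowerSeries.X i : Series)

/-- The partial derivative `∂/∂u_i`. -/
def dU (i : Fin 3) : Module.End ℚ Series :=
  ((MvPowerSeries.pderiv Poly i : Derivation Poly Series Series) :
    Series →ₗ[Poly] Series).restrictScalars ℚ

/-- The partial derivative `∂/∂μ_i`, acting on the coefficients in `ℚ[μ]`. -/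
def dMu (i : Fin 6) : Module.End ℚ Series where
  toFun φ := fun e => MvPolynomial.pderiv i (MvPowerSeries.coeff e φ)
  map_add' φ ψ := by funext e; exact map_add _ _ _
  map_smul' c φ := by funext e; exact (MvPolynomial.pderiv i).map_smul_of_tower c _

/-- The operators `L_0, L_3, L_4, L_6, L_7, L_10`. -/
def opL (j : Fin 6) : Module.End ℚ Series :=
  ∑ i, mulPoly (matV j i) * dMu i

/-- The operators `H_j = H^{L_j} - (1/8) L_j(log Δ)`, where
`H^{L_j} = ∑ (½ α_{ab} ∂_a ∂_b + β_{ab} u_a ∂_b + ½ γ_{ab} u_a u_b) + ½ Tr β`. -/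
def opH (j : Fin 6) : Module.End ℚ Series :=
  ∑ a, ∑ b, ((1/2 : ℚ) • (mulPoly (matAlpha j a b) * dU a * dU b)
      + mulPoly (matBeta j a b) * mulU a * dU b
      + (1/2 : ℚ) • (mulPoly (matGamma j a b) * mulU a * mulU b))
    + (1/2 : ℚ) • mulPoly (matBeta j).trace
    - (1/8 : ℚ) • mulPoly (logDerivDisc j)

/-- The operators `L_j - H_j`. -/
def heatOp (j : Fin 6) : Module.End ℚ Series := opL j - opH j

/-- The `ℚ`-vector space of all `φ ∈ ℚ[μ][[u_5, u_2, u_1]]` with `(L_j - H_j) φ = 0` for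
`j = 0, 3, 4, 6, 7, 10`. -/
def solutionSpace : Submodule ℚ Series := ⨅ j, LinearMap.ker (heatOp j)

/-- Families `b(ℓ, m, n_2, n_5, n_6, n_8, n_9, n_12)` of rational numbers. -/
abbrev HCoeff : Type := ℤ → ℤ → ℤ → ℤ → ℤ → ℤ → ℤ → ℤ → ℚ

/-- The exponent `k` of `u_1` that belongs to the indices. -/
def kOf (ℓ m n2 n5 n6 n8 n9 n12 : ℤ) : ℤ :=
  5 - 5*ℓ - 2*m + 2*n2 + 5*n5 + 6*n6 + 8*n8 + 9*n9 + 12*n12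

/-- All eight indices are nonnegative, and `k ≥ v`. -/
def InRange (v ℓ m n2 n5 n6 n8 n9 n12 : ℤ) : Prop :=
  0 ≤ ℓ ∧ 0 ≤ m ∧ 0 ≤ n2 ∧ 0 ≤ n5 ∧ 0 ≤ n6 ∧ 0 ≤ n8 ∧ 0 ≤ n9 ∧ 0 ≤ n12 ∧
    v ≤ kOf ℓ m n2 n5 n6 n8 n9 n12

instance (v ℓ m n2 n5 n6 n8 n9 n12 : ℤ) : Decidable (InRange v ℓ m n2 n5 n6 n8 n9 n12) := by
  unfold InRange; infer_instance

/-- `b` vanishes if one of the indices or `k` is negative. -/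
def Supported (b : HCoeff) : Prop :=
  ∀ ℓ m n2 n5 n6 n8 n9 n12, ¬ InRange 0 ℓ m n2 n5 n6 n8 n9 n12 →
    b ℓ m n2 n5 n6 n8 n9 n12 = 0

/-- The Hurwitz series
`∑ b(ℓ, m, n_2, …, n_12) μ_2^n_2 ⋯ μ_12^n_12 u_5^ℓ u_2^m u_1^k / (ℓ! m! k!)`
over nonnegative indices, with `k = 5 - 5ℓ - 2m + 2n_2 + 5n_5 + 6n_6 + 8n_8 + 9n_9 + 12n_12`.
For given exponents `(ℓ, m, k)` every admissible `n_i` is at most `k + 5ℓ + 2m`. -/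
def hurwitzSeries (b : HCoeff) : Series := fun e =>
  ∑ n ∈ (Fintype.piFinset fun _ : Fin 6 => Finset.range (e 2 + 5 * e 0 + 2 * e 1 + 1)) with
      (e 2 : ℤ) = kOf (e 0) (e 1) (n 0) (n 1) (n 2) (n 3) (n 4) (n 5),
    MvPolynomial.monomial (Finsupp.equivFunOnFinite.symm n)
      (b (e 0) (e 1) (n 0) (n 1) (n 2) (n 3) (n 4) (n 5) /
        ((e 0).factorial * (e 1).factorial * (e 2).factorial))

theorem coeff_hurwitzSeries (b : HCoeff) (e : Fin 3 →₀ ℕ) (n : Fin 6 →₀ ℕ) :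
    MvPolynomial.coeff n (MvPowerSeries.coeff e (hurwitzSeries b)) =
      if (e 2 : ℤ) = kOf (e 0) (e 1) (n 0) (n 1) (n 2) (n 3) (n 4) (n 5) then
        b (e 0) (e 1) (n 0) (n 1) (n 2) (n 3) (n 4) (n 5) /
          ((e 0).factorial * (e 1).factorial * (e 2).factorial)
      else 0 := by
  change MvPolynomial.coeff n (hurwitzSeries b e) = _
  have key : ∀ x : Fin 6 → ℕ, (Finsupp.equivFunOnFinite.symm x = n) ↔ x = ⇑n := fun x =>
    ⟨fun h => by rw [← h]; rfl, fun h => by rw [h]; ext i; rfl⟩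
  simp only [hurwitzSeries, MvPolynomial.coeff_sum, MvPolynomial.coeff_monomial, key]
  rw [Finset.sum_ite_eq']
  refine if_congr ?_ rfl rfl
  simp only [Finset.mem_filter, Fintype.mem_piFinset, Finset.mem_range, and_iff_right_iff_imp]
  intro h i
  simp only [kOf] at h
  fin_cases i <;> simp <;> omega

/-! The recurrence relations. All terms `b(…)` of weight
`W = 2n_2 + 5n_5 + 6n_6 + 8n_8 + 9n_9 + 12n_12` stand on the left. -/

/-- The terms of weight `≤ W - 3` on the right of `R_3`. -/
def low3 (b : HCoeff) (ℓ m n2 n5 n6 n8 n9 n12 : ℤ) : ℚ :=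
  let k := kOf ℓ m n2 n5 n6 n8 n9 n12;
    (120 * (n2+1) : ℤ) * b ℓ m (n2+1) (n5-1) n6 n8 n9 n12
    + (4 * (n5+1) : ℤ) * b ℓ m (n2-4) (n5+1) n6 n8 n9 n12
    - (96 * (n5+1) : ℤ) * b ℓ m (n2-1) (n5+1) (n6-1) n8 n9 n12
    + (192 * (n5+1) : ℤ) * b ℓ m n2 (n5+1) n6 (n8-1) n9 n12
    - (12 * (n6+1) : ℤ) * b ℓ m (n2-2) (n5-1) (n6+1) n8 n9 n12
    + (216 * (n6+1) : ℤ) * b ℓ m n2 n5 (n6+1) n8 (n9-1) n12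
    + (2 * (n8+1) : ℤ) * b ℓ m (n2-3) (n5-1) n6 (n8+1) n9 n12
    - (12 * (n8+1) : ℤ) * b ℓ m (n2-1) n5 n6 (n8+1) (n9-1) n12
    - (36 * (n8+1) : ℤ) * b ℓ m n2 (n5-1) (n6-1) (n8+1) n9 n12
    + (4 * (n9+1) : ℤ) * b ℓ m (n2-3) n5 (n6-1) n8 (n9+1) n12
    - (8 * (n9+1) : ℤ) * b ℓ m (n2-2) n5 n6 (n8-1) (n9+1) n12
    - (4 * (n9+1) : ℤ) * b ℓ m (n2-1) (n5-2) n6 n8 (n9+1) n12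
    - (72 * (n9+1) : ℤ) * b ℓ m n2 n5 (n6-2) n8 (n9+1) n12
    + (288 * (n9+1) : ℤ) * b ℓ m n2 n5 n6 n8 (n9+1) (n12-1)
    + (2 * (n12+1) : ℤ) * b ℓ m (n2-3) n5 n6 n8 (n9-1) (n12+1)
    - (4 * (n12+1) : ℤ) * b ℓ m (n2-1) (n5-1) n6 (n8-1) n9 (n12+1)
    - (36 * (n12+1) : ℤ) * b ℓ m n2 n5 (n6-1) n8 (n9-1) (n12+1)
    + (8 * m : ℤ) * b ℓ (m-1) (n2-2) n5 n6 n8 n9 n12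
    - (12 * (k-3) * (k-4) : ℤ) * b ℓ m n2 (n5-1) n6 n8 n9 n12
    - (2 * ℓ : ℤ) * b (ℓ-1) (m+1) (n2-3) n5 n6 n8 n9 n12
    + (36 * ℓ : ℤ) * b (ℓ-1) (m+1) n2 n5 (n6-1) n8 n9 n12
    - (4 * m * (k-3) : ℤ) * b ℓ (m-1) (n2-3) n5 n6 n8 n9 n12
    + (24 * m * (k-3) : ℤ) * b ℓ (m-1) n2 n5 (n6-1) n8 n9 n12
    + (4 * ℓ : ℤ) * b (ℓ-1) m (n2-1) (n5-1) n6 n8 n9 n12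
    - (8 * m * (m-1) : ℤ) * b ℓ (m-2) (n2-1) (n5-1) n6 n8 n9 n12
    - (24 * ℓ * (k-3) : ℤ) * b (ℓ-1) m n2 n5 n6 n8 (n9-1) n12
    + (24 * ℓ * m : ℤ) * b (ℓ-1) (m-1) (n2-1) n5 n6 (n8-1) n9 n12
    - (60 * ℓ * (ℓ-1) : ℤ) * b (ℓ-2) m n2 (n5-1) n6 (n8-1) n9 n12
    + (4 * ℓ * (ℓ-1) : ℤ) * b (ℓ-2) m (n2-2) n5 n6 n8 (n9-1) n12
    - (1 * ℓ * (ℓ-1) : ℤ) * b (ℓ-2) m (n2-4) (n5-1) n6 n8 n9 n12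
    + (20 * ℓ * (ℓ-1) : ℤ) * b (ℓ-2) m (n2-1) (n5-1) (n6-1) n8 n9 n12

/-- The terms of weight `≤ W - 4` on the right of `R_4`. -/
def low4 (b : HCoeff) (ℓ m n2 n5 n6 n8 n9 n12 : ℤ) : ℚ :=
  let k := kOf ℓ m n2 n5 n6 n8 n9 n12;
    -(144 * (n2+1) : ℤ) * b ℓ m (n2+1) n5 (n6-1) n8 n9 n12
    + (12 * n5 - 16 * n6 - 32 * n8 - 32 * n9 - 48 * n12 + 16 * ℓ
        - 16 : ℤ) * b ℓ m (n2-2) n5 n6 n8 n9 n12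
    - (216 * (n5+1) : ℤ) * b ℓ m n2 (n5+1) n6 n8 (n9-1) n12
    - (80 * (n6+1) : ℤ) * b ℓ m (n2-1) n5 (n6+1) (n8-1) n9 n12
    - (40 * (n6+1) : ℤ) * b ℓ m n2 (n5-2) (n6+1) n8 n9 n12
    + (14 * (n8+1) : ℤ) * b ℓ m (n2-1) (n5-2) n6 (n8+1) n9 n12
    - (288 * (n8+1) : ℤ) * b ℓ m n2 n5 n6 (n8+1) n9 (n12-1)
    + (28 * (n9+1) : ℤ) * b ℓ m (n2-1) (n5-1) (n6-1) n8 (n9+1) n12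
    - (104 * (n9+1) : ℤ) * b ℓ m n2 (n5-1) n6 (n8-1) (n9+1) n12
    + (14 * (n12+1) : ℤ) * b ℓ m (n2-1) (n5-1) n6 n8 (n9-1) (n12+1)
    - (64 * (n12+1) : ℤ) * b ℓ m n2 n5 n6 (n8-2) n9 (n12+1)
    + (16 * m : ℤ) * b ℓ (m-1) n2 (n5-1) n6 n8 n9 n12
    + (12 * (k-4) * (k-5) : ℤ) * b ℓ m n2 n5 (n6-1) n8 n9 n12
    - (14 * ℓ : ℤ) * b (ℓ-1) (m+1) (n2-1) (n5-1) n6 n8 n9 n12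
    - (12 * m * (k-4) : ℤ) * b ℓ (m-1) (n2-1) (n5-1) n6 n8 n9 n12
    + (40 * ℓ : ℤ) * b (ℓ-1) m n2 n5 n6 (n8-1) n9 n12
    + (16 * m * (m-1) : ℤ) * b ℓ (m-2) (n2-1) n5 (n6-1) n8 n9 n12
    + (16 * m * (m-1) : ℤ) * b ℓ (m-2) n2 n5 n6 (n8-1) n9 n12
    - (8 * ℓ * (k-4) : ℤ) * b (ℓ-1) m (n2-1) n5 n6 (n8-1) n9 n12
    + (16 * ℓ * m : ℤ) * b (ℓ-1) (m-1) (n2-1) n5 n6 n8 (n9-1) n12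
    - (7 * ℓ * (ℓ-1) : ℤ) * b (ℓ-2) m (n2-2) (n5-2) n6 n8 n9 n12
    + (108 * ℓ * (ℓ-1) : ℤ) * b (ℓ-2) m (n2-1) n5 n6 n8 n9 (n12-1)
    + (20 * ℓ * (ℓ-1) : ℤ) * b (ℓ-2) m n2 (n5-1) n6 n8 (n9-1) n12
    + (44 * ℓ * (ℓ-1) : ℤ) * b (ℓ-2) m n2 n5 (n6-1) (n8-1) n9 n12

/-- The right side of `R_6` (times 48). -/
def rhs6 (b : HCoeff) (ℓ m n2 n5 n6 n8 n9 n12 : ℤ) : ℚ :=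
  let k := kOf ℓ m n2 n5 n6 n8 n9 n12;
    (12 * (k-6) : ℤ) * b ℓ (m+1) n2 (n5-1) n6 n8 n9 n12
    + (384 * (n2+1) : ℤ) * b ℓ m (n2+1) n5 n6 (n8-1) n9 n12
    + (4 * n5 : ℤ) * b ℓ m (n2-3) n5 n6 n8 n9 n12
    - (24 * (n5+1) : ℤ) * b ℓ m (n2-1) (n5+1) n6 n8 (n9-1) n12
    + (-72 * n5 + 192 * n8 - 72 * n9 + 288 * n12 - 48 * ℓ + 48 : ℤ) * b ℓ m n2 n5 (n6-1) n8 n9 n12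
    + (64 * (n6+1) : ℤ) * b ℓ m (n2-2) n5 (n6+1) (n8-1) n9 n12
    - (28 * (n6+1) : ℤ) * b ℓ m (n2-1) (n5-2) (n6+1) n8 n9 n12
    + (576 * (n6+1) : ℤ) * b ℓ m n2 n5 (n6+1) n8 n9 (n12-1)
    + (2 * (n8+1) : ℤ) * b ℓ m (n2-2) (n5-2) n6 (n8+1) n9 n12
    + (288 * (n8+1) : ℤ) * b ℓ m (n2-1) n5 n6 (n8+1) n9 (n12-1)
    - (168 * (n8+1) : ℤ) * b ℓ m n2 (n5-1) n6 (n8+1) (n9-1) n12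
    + (4 * (n9+1) : ℤ) * b ℓ m (n2-2) (n5-1) (n6-1) n8 (n9+1) n12
    + (56 * (n9+1) : ℤ) * b ℓ m (n2-1) (n5-1) n6 (n8-1) (n9+1) n12
    - (20 * (n9+1) : ℤ) * b ℓ m n2 (n5-3) n6 n8 (n9+1) n12
    + (2 * (n12+1) : ℤ) * b ℓ m (n2-2) (n5-1) n6 n8 (n9-1) (n12+1)
    + (64 * (n12+1) : ℤ) * b ℓ m (n2-1) n5 n6 (n8-2) n9 (n12+1)
    - (20 * (n12+1) : ℤ) * b ℓ m n2 (n5-2) n6 (n8-1) n9 (n12+1)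
    - (108 * (n12+1) : ℤ) * b ℓ m n2 n5 n6 n8 (n9-2) (n12+1)
    + (8 * m : ℤ) * b ℓ (m-1) (n2-1) (n5-1) n6 n8 n9 n12
    - (48 * (k-6) * (k-7) : ℤ) * b ℓ m n2 n5 n6 (n8-1) n9 n12
    - (2 * ℓ : ℤ) * b (ℓ-1) (m+1) (n2-2) (n5-1) n6 n8 n9 n12
    + (60 * ℓ : ℤ) * b (ℓ-1) (m+1) n2 n5 n6 n8 (n9-1) n12
    - (4 * m * (k-6) : ℤ) * b ℓ (m-1) (n2-2) (n5-1) n6 n8 n9 n12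
    + (24 * m * (k-6) : ℤ) * b ℓ (m-1) n2 n5 n6 n8 (n9-1) n12
    - (16 * ℓ : ℤ) * b (ℓ-1) m (n2-1) n5 n6 (n8-1) n9 n12
    + (20 * ℓ : ℤ) * b (ℓ-1) m n2 (n5-2) n6 n8 n9 n12
    - (64 * m * (m-1) : ℤ) * b ℓ (m-2) (n2-1) n5 n6 (n8-1) n9 n12
    + (8 * m * (m-1) : ℤ) * b ℓ (m-2) n2 (n5-2) n6 n8 n9 n12
    - (144 * ℓ * (k-6) : ℤ) * b (ℓ-1) m n2 n5 n6 n8 n9 (n12-1)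
    - (24 * ℓ * m : ℤ) * b (ℓ-1) (m-1) n2 (n5-1) n6 (n8-1) n9 n12
    - (1 * ℓ * (ℓ-1) : ℤ) * b (ℓ-2) m (n2-3) (n5-2) n6 n8 n9 n12
    - (96 * ℓ * (ℓ-1) : ℤ) * b (ℓ-2) m (n2-2) n5 n6 n8 n9 (n12-1)
    + (58 * ℓ * (ℓ-1) : ℤ) * b (ℓ-2) m (n2-1) (n5-1) n6 n8 (n9-1) n12
    - (32 * ℓ * (ℓ-1) : ℤ) * b (ℓ-2) m (n2-1) n5 (n6-1) (n8-1) n9 n12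
    + (10 * ℓ * (ℓ-1) : ℤ) * b (ℓ-2) m n2 (n5-2) (n6-1) n8 n9 n12
    - (144 * ℓ * (ℓ-1) : ℤ) * b (ℓ-2) m n2 n5 n6 (n8-2) n9 n12

/-- The right side of `R_7` (times 48). -/
def rhs7 (b : HCoeff) (ℓ m n2 n5 n6 n8 n9 n12 : ℤ) : ℚ :=
  let k := kOf ℓ m n2 n5 n6 n8 n9 n12;
    -(8 : ℤ) * b ℓ m n2 (n5-1) n6 n8 n9 n12
    + (24 * (k-7) : ℤ) * b ℓ (m+1) n2 n5 (n6-1) n8 n9 n12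
    + (432 * (n2+1) : ℤ) * b ℓ m (n2+1) n5 n6 n8 (n9-1) n12
    + (8 * (n5+1) : ℤ) * b ℓ m (n2-3) (n5+1) (n6-1) n8 n9 n12
    - (16 * (n5+1) : ℤ) * b ℓ m (n2-2) (n5+1) n6 (n8-1) n9 n12
    + (-8 * (n5-1) - 56 * n6 + 56 * n8 + 80 * n9 + 144 * n12 - 32 * ℓ
        + 32 : ℤ) * b ℓ m (n2-1) (n5-1) n6 n8 n9 n12
    - (144 * (n5+1) : ℤ) * b ℓ m n2 (n5+1) (n6-2) n8 n9 n12
    + (576 * (n5+1) : ℤ) * b ℓ m n2 (n5+1) n6 n8 n9 (n12-1)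
    + (64 * (n6+1) : ℤ) * b ℓ m (n2-2) n5 (n6+1) n8 (n9-1) n12
    + (208 * (n6+1) : ℤ) * b ℓ m n2 (n5-1) (n6+1) (n8-1) n9 n12
    + (4 * (n8+1) : ℤ) * b ℓ m (n2-2) (n5-1) (n6-1) (n8+1) n9 n12
    - (20 * (n8+1) : ℤ) * b ℓ m n2 (n5-3) n6 (n8+1) n9 n12
    - (72 * (n8+1) : ℤ) * b ℓ m n2 n5 (n6-1) (n8+1) (n9-1) n12
    + (8 * (n9+1) : ℤ) * b ℓ m (n2-2) n5 (n6-2) n8 (n9+1) n12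
    + (96 * (n9+1) : ℤ) * b ℓ m (n2-2) n5 n6 n8 (n9+1) (n12-1)
    - (128 * (n9+1) : ℤ) * b ℓ m (n2-1) n5 (n6-1) (n8-1) (n9+1) n12
    - (64 * (n9+1) : ℤ) * b ℓ m n2 (n5-2) (n6-1) n8 (n9+1) n12
    + (128 * (n9+1) : ℤ) * b ℓ m n2 n5 n6 (n8-2) (n9+1) n12
    + (4 * (n12+1) : ℤ) * b ℓ m (n2-2) n5 (n6-1) n8 (n9-1) (n12+1)
    - (40 * (n12+1) : ℤ) * b ℓ m (n2-1) n5 n6 (n8-1) (n9-1) (n12+1)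
    - (20 * (n12+1) : ℤ) * b ℓ m n2 (n5-2) n6 n8 (n9-1) (n12+1)
    - (24 * (n12+1) : ℤ) * b ℓ m n2 (n5-1) (n6-1) (n8-1) n9 (n12+1)
    + (16 * m : ℤ) * b ℓ (m-1) (n2-1) n5 (n6-1) n8 n9 n12
    - (32 * m : ℤ) * b ℓ (m-1) n2 n5 n6 (n8-1) n9 n12
    - (48 * (k-7) * (k-8) : ℤ) * b ℓ m n2 n5 n6 n8 (n9-1) n12
    - (4 * ℓ : ℤ) * b (ℓ-1) (m+1) (n2-2) n5 (n6-1) n8 n9 n12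
    + (56 * ℓ : ℤ) * b (ℓ-1) (m+1) (n2-1) n5 n6 (n8-1) n9 n12
    + (20 * ℓ : ℤ) * b (ℓ-1) (m+1) n2 (n5-2) n6 n8 n9 n12
    + (8 * m * (k-7) : ℤ) * b ℓ (m-1) n2 (n5-2) n6 n8 n9 n12
    - (8 * m * (k-7) : ℤ) * b ℓ (m-1) (n2-2) n5 (n6-1) n8 n9 n12
    + (16 * m * (k-7) : ℤ) * b ℓ (m-1) (n2-1) n5 n6 (n8-1) n9 n12
    - (16 * ℓ : ℤ) * b (ℓ-1) m (n2-1) n5 n6 n8 (n9-1) n12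
    + (24 * ℓ : ℤ) * b (ℓ-1) m n2 (n5-1) (n6-1) n8 n9 n12
    - (64 * m * (m-1) : ℤ) * b ℓ (m-2) (n2-1) n5 n6 n8 (n9-1) n12
    + (16 * m * (m-1) : ℤ) * b ℓ (m-2) n2 (n5-1) (n6-1) n8 n9 n12
    - (32 * ℓ * (k-7) : ℤ) * b (ℓ-1) m n2 (n5-1) n6 (n8-1) n9 n12
    - (96 * ℓ * m : ℤ) * b (ℓ-1) (m-1) (n2-1) n5 n6 n8 n9 (n12-1)
    - (32 * ℓ * m : ℤ) * b (ℓ-1) (m-1) n2 (n5-1) n6 n8 (n9-1) n12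
    + (48 * ℓ * m : ℤ) * b (ℓ-1) (m-1) n2 n5 (n6-1) (n8-1) n9 n12
    + (10 * ℓ * (ℓ-1) : ℤ) * b (ℓ-2) m (n2-1) (n5-3) n6 n8 n9 n12
    + (12 * ℓ * (ℓ-1) : ℤ) * b (ℓ-2) m n2 (n5-1) (n6-2) n8 n9 n12
    - (120 * ℓ * (ℓ-1) : ℤ) * b (ℓ-2) m n2 (n5-1) n6 n8 n9 (n12-1)
    - (112 * ℓ * (ℓ-1) : ℤ) * b (ℓ-2) m n2 n5 n6 (n8-1) (n9-1) n12
    - (2 * ℓ * (ℓ-1) : ℤ) * b (ℓ-2) m (n2-3) (n5-1) (n6-1) n8 n9 n12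
    + (4 * ℓ * (ℓ-1) : ℤ) * b (ℓ-2) m (n2-2) (n5-1) n6 (n8-1) n9 n12
    + (24 * ℓ * (ℓ-1) : ℤ) * b (ℓ-2) m (n2-1) n5 (n6-1) n8 (n9-1) n12

/-- The right side of `R_10` (times 24). -/
def rhs10 (b : HCoeff) (ℓ m n2 n5 n6 n8 n9 n12 : ℤ) : ℚ :=
  let k := kOf ℓ m n2 n5 n6 n8 n9 n12;
    -(8 : ℤ) * b ℓ m n2 n5 n6 (n8-1) n9 n12
    + (12 * (k-10) : ℤ) * b ℓ (m+1) n2 n5 n6 n8 (n9-1) n12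
    + (576 * (n2+1) : ℤ) * b ℓ m (n2+1) n5 n6 n8 n9 (n12-1)
    + (4 * (n5+1) : ℤ) * b ℓ m (n2-3) (n5+1) n6 n8 (n9-1) n12
    + (-8 * n5 + 64 * (n8-1) - 40 * n9 + 96 * n12 + 16 * ℓ
        + 32 : ℤ) * b ℓ m (n2-1) n5 n6 (n8-1) n9 n12
    - (72 * (n5+1) : ℤ) * b ℓ m n2 (n5+1) (n6-1) n8 (n9-1) n12
    + (96 * (n6+1) : ℤ) * b ℓ m (n2-2) n5 (n6+1) n8 n9 (n12-1)
    - (28 * (n6+1) : ℤ) * b ℓ m (n2-1) (n5-1) (n6+1) n8 (n9-1) n12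
    + (128 * (n6+1) : ℤ) * b ℓ m n2 n5 (n6+1) (n8-2) n9 n12
    + (2 * (n8+1) : ℤ) * b ℓ m (n2-2) (n5-1) n6 (n8+1) (n9-1) n12
    + (-20 * n8 - 20 * n9 + 48 * n12 + 6 : ℤ) * b ℓ m n2 (n5-2) n6 n8 n9 n12
    + (288 * (n8+1) : ℤ) * b ℓ m n2 n5 (n6-1) (n8+1) n9 (n12-1)
    - (108 * (n8+1) : ℤ) * b ℓ m n2 n5 n6 (n8+1) (n9-2) n12
    + (4 * n9 : ℤ) * b ℓ m (n2-2) n5 (n6-1) n8 n9 n12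
    + (144 * (n9+1) : ℤ) * b ℓ m (n2-1) (n5-1) n6 n8 (n9+1) (n12-1)
    - (24 * (n9+1) : ℤ) * b ℓ m n2 (n5-1) (n6-1) (n8-1) (n9+1) n12
    + (2 * (n12+1) : ℤ) * b ℓ m (n2-2) n5 n6 n8 (n9-2) (n12+1)
    - (88 * (n12+1) : ℤ) * b ℓ m n2 (n5-1) n6 (n8-1) (n9-1) (n12+1)
    + (64 * (n12+1) : ℤ) * b ℓ m n2 n5 (n6-1) (n8-2) n9 (n12+1)
    + (8 * m : ℤ) * b ℓ (m-1) (n2-1) n5 n6 n8 (n9-1) n12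
    - (72 * (k-10) * (k-11) : ℤ) * b ℓ m n2 n5 n6 n8 n9 (n12-1)
    - (2 * ℓ : ℤ) * b (ℓ-1) (m+1) (n2-2) n5 n6 n8 (n9-1) n12
    + (20 * ℓ : ℤ) * b (ℓ-1) (m+1) n2 (n5-1) n6 (n8-1) n9 n12
    + (8 * m * (k-10) : ℤ) * b ℓ (m-1) n2 (n5-1) n6 (n8-1) n9 n12
    - (4 * m * (k-10) : ℤ) * b ℓ (m-1) (n2-2) n5 n6 n8 (n9-1) n12
    - (48 * ℓ : ℤ) * b (ℓ-1) m (n2-1) n5 n6 n8 n9 (n12-1)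
    + (20 * ℓ : ℤ) * b (ℓ-1) m n2 (n5-1) n6 n8 (n9-1) n12
    - (16 * ℓ : ℤ) * b (ℓ-1) m n2 n5 (n6-1) (n8-1) n9 n12
    - (96 * m * (m-1) : ℤ) * b ℓ (m-2) (n2-1) n5 n6 n8 n9 (n12-1)
    + (8 * m * (m-1) : ℤ) * b ℓ (m-2) n2 (n5-1) n6 n8 (n9-1) n12
    - (32 * ℓ * (k-10) : ℤ) * b (ℓ-1) m n2 n5 n6 (n8-2) n9 n12
    - (96 * ℓ * m : ℤ) * b (ℓ-1) (m-1) n2 (n5-1) n6 n8 n9 (n12-1)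
    + (40 * ℓ * m : ℤ) * b (ℓ-1) (m-1) n2 n5 n6 (n8-1) (n9-1) n12
    - (1 * ℓ * (ℓ-1) : ℤ) * b (ℓ-2) m (n2-3) (n5-1) n6 n8 (n9-1) n12
    - (24 * ℓ * (ℓ-1) : ℤ) * b (ℓ-2) m (n2-2) n5 n6 (n8-2) n9 n12
    + (10 * ℓ * (ℓ-1) : ℤ) * b (ℓ-2) m (n2-1) (n5-2) n6 (n8-1) n9 n12
    - (72 * ℓ * (ℓ-1) : ℤ) * b (ℓ-2) m (n2-1) n5 (n6-1) n8 n9 (n12-1)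
    + (28 * ℓ * (ℓ-1) : ℤ) * b (ℓ-2) m (n2-1) n5 n6 n8 (n9-2) n12
    + (10 * ℓ * (ℓ-1) : ℤ) * b (ℓ-2) m n2 (n5-1) (n6-1) n8 (n9-1) n12
    - (8 * ℓ * (ℓ-1) : ℤ) * b (ℓ-2) m n2 n5 (n6-2) (n8-1) n9 n12
    - (216 * ℓ * (ℓ-1) : ℤ) * b (ℓ-2) m n2 n5 n6 (n8-1) n9 (n12-1)

/-- The right side of `R_3`. -/
def rhs3 (b : HCoeff) (ℓ m n2 n5 n6 n8 n9 n12 : ℤ) : ℚ :=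
  (-12 * (3 - kOf ℓ m n2 n5 n6 n8 n9 n12) : ℤ) * b ℓ (m+1) (n2-1) n5 n6 n8 n9 n12
    + low3 b ℓ m n2 n5 n6 n8 n9 n12

/-- The right side of `R_4`. -/
def rhs4 (b : HCoeff) (ℓ m n2 n5 n6 n8 n9 n12 : ℤ) : ℚ :=
  4 * b ℓ m (n2-1) n5 n6 n8 n9 n12 + low4 b ℓ m n2 n5 n6 n8 n9 n12

def R3 (b : HCoeff) : Prop :=
  ∀ ℓ m n2 n5 n6 n8 n9 n12, InRange 3 ℓ m n2 n5 n6 n8 n9 n12 →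
    24 * b ℓ (m+1) n2 n5 n6 n8 n9 n12 + 48 * m * b (ℓ+1) (m-1) n2 n5 n6 n8 n9 n12
      = rhs3 b ℓ m n2 n5 n6 n8 n9 n12

def R4 (b : HCoeff) : Prop :=
  ∀ ℓ m n2 n5 n6 n8 n9 n12, InRange 4 ℓ m n2 n5 n6 n8 n9 n12 →
    -12 * b ℓ (m+2) n2 n5 n6 n8 n9 n12
        + 24 * (4 - kOf ℓ m n2 n5 n6 n8 n9 n12) * b (ℓ+1) m n2 n5 n6 n8 n9 n12
      = rhs4 b ℓ m n2 n5 n6 n8 n9 n12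

def R6 (b : HCoeff) : Prop :=
  ∀ ℓ m n2 n5 n6 n8 n9 n12, InRange 6 ℓ m n2 n5 n6 n8 n9 n12 →
    48 * b (ℓ+1) m n2 n5 n6 n8 n9 n12 = rhs6 b ℓ m n2 n5 n6 n8 n9 n12

def R7 (b : HCoeff) : Prop :=
  ∀ ℓ m n2 n5 n6 n8 n9 n12, InRange 7 ℓ m n2 n5 n6 n8 n9 n12 →
    48 * b (ℓ+1) (m+1) n2 n5 n6 n8 n9 n12 = rhs7 b ℓ m n2 n5 n6 n8 n9 n12

def R10 (b : HCoeff) : Prop :=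
  ∀ ℓ m n2 n5 n6 n8 n9 n12, InRange 10 ℓ m n2 n5 n6 n8 n9 n12 →
    24 * b (ℓ+2) m n2 n5 n6 n8 n9 n12 = rhs10 b ℓ m n2 n5 n6 n8 n9 n12

/-- The relation `(k - m + 1) b(ℓ, m, …) = lower weight terms` that eliminates
`b(ℓ+1, m-2, …)` from `R_3` and `R_4`. -/
def rhsS (b : HCoeff) (ℓ m n2 n5 n6 n8 n9 n12 : ℤ) : ℚ :=
  kOf ℓ m n2 n5 n6 n8 n9 n12 * rhs3 b ℓ (m-1) n2 n5 n6 n8 n9 n12 / 24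
    + (m - 1) * rhs4 b ℓ (m-2) n2 n5 n6 n8 n9 n12 / 12

def S34 (b : HCoeff) : Prop :=
  ∀ ℓ m n2 n5 n6 n8 n9 n12, InRange 0 ℓ m n2 n5 n6 n8 n9 n12 → m ≠ 0 →
    (kOf ℓ m n2 n5 n6 n8 n9 n12 - m + 1) * b ℓ m n2 n5 n6 n8 n9 n12
      = rhsS b ℓ m n2 n5 n6 n8 n9 n12

/-- The relation `(k - m) b(ℓ, m, …) = lower weight terms` that eliminates
`b(ℓ-1, m+2, …)` from `R_3` and `R_4`. -/
def rhsT (b : HCoeff) (ℓ m n2 n5 n6 n8 n9 n12 : ℤ) : ℚ :=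
  -(rhs3 b (ℓ-1) (m+1) n2 n5 n6 n8 n9 n12 + 2 * rhs4 b (ℓ-1) m n2 n5 n6 n8 n9 n12) / 48

def T34 (b : HCoeff) : Prop :=
  ∀ ℓ m n2 n5 n6 n8 n9 n12, InRange 0 ℓ m n2 n5 n6 n8 n9 n12 → ℓ ≠ 0 →
    (kOf ℓ m n2 n5 n6 n8 n9 n12 - m) * b ℓ m n2 n5 n6 n8 n9 n12
      = rhsT b ℓ m n2 n5 n6 n8 n9 n12

/-- The right side of `T_{3,4}^{(0)}`: the relation `T_{3,4}` with indices `1, 0, n_2 + 1, …`,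
solved for `b(0, 0, n_2, …)`; here `k` belongs to `(0, 0, n_2, …)`. -/
def rhsT0 (b : HCoeff) (n2 n5 n6 n8 n9 n12 : ℤ) : ℚ :=
  let k := kOf 0 0 n2 n5 n6 n8 n9 n12;
  -6 * (k - 3) * b 1 0 (n2+1) n5 n6 n8 n9 n12 - 3 / 2 * (k - 3) * b 0 2 n2 n5 n6 n8 n9 n12
    - (low3 b 0 1 (n2+1) n5 n6 n8 n9 n12 + 2 * low4 b 0 0 (n2+1) n5 n6 n8 n9 n12) / 8

/-- The recursion scheme, with `c` as the value at `(1, 0, …, 0)`. The cases are tried from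
top to bottom; the last one is `ℓ = 0`, `m = k + 1`. -/
def schemeRhs (c : ℚ) (b : HCoeff) (ℓ m n2 n5 n6 n8 n9 n12 : ℤ) : ℚ :=
  let k := kOf ℓ m n2 n5 n6 n8 n9 n12;
  if ¬ InRange 0 ℓ m n2 n5 n6 n8 n9 n12 then 0
  else if ℓ = 1 ∧ m = 0 ∧ n2 = 0 ∧ n5 = 0 ∧ n6 = 0 ∧ n8 = 0 ∧ n9 = 0 ∧ n12 = 0 then c
  else if 1 < ℓ then rhs10 b (ℓ-2) m n2 n5 n6 n8 n9 n12 / 24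
  else if 0 < ℓ ∧ 0 < m then rhs7 b (ℓ-1) (m-1) n2 n5 n6 n8 n9 n12 / 48
  else if 0 < ℓ ∧ 0 < k then rhs6 b (ℓ-1) m n2 n5 n6 n8 n9 n12 / 48
  else if m ≠ 0 ∧ m ≠ k + 1 then rhsS b ℓ m n2 n5 n6 n8 n9 n12 / (k - m + 1)
  else if m = 0 then rhsT0 b n2 n5 n6 n8 n9 n12
  else -2 * (m - 1) * b 1 (m-2) n2 n5 n6 n8 n9 n12 + rhs3 b 0 (m-1) n2 n5 n6 n8 n9 n12 / 24

/-- `b` is computed by the recursion scheme with starting value `c`. -/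
def Scheme (c : ℚ) (b : HCoeff) : Prop :=
  ∀ ℓ m n2 n5 n6 n8 n9 n12,
    b ℓ m n2 n5 n6 n8 n9 n12 = schemeRhs c b ℓ m n2 n5 n6 n8 n9 n12

end

end Curve34

/-!
Write `P_j = L_j - H_j`. A series is expanded in its Hurwitz coefficients `cf`, the coefficients of
`μ^n u_5^ℓ u_2^m u_1^k / (ℓ! m! k!)`, extended by zero to all integral exponents. The operator `P_0`
is diagonal in this expansion and its kernel consists of the homogeneous series `σ_b`
(`heatOp_zero_eq_zero_iff`); the other `P_j` turn into the recurrences `R_j`, and `S_{3,4}`,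
`T_{3,4}` are the two eliminations between `R_3` and `R_4`. Each line of the recursion scheme refers
to indices of smaller `rank`, so for every `c` there is exactly one family computed by the scheme
(`existsUnique_scheme`), and every solution is of this form (`scheme_of_recurrences`). Hence the
space of solutions has dimension at most one.

The substance is the converse: the family `b` computed by the scheme satisfies only one recurrence
per index by construction, and it has to be shown that all of them hold. The reason is that the
`P_j` are closed under commutators, `[P_i, P_j] = ∑ l, structureConst i j l • P_l`
(`heatOp_comm_of_lt`). Up to the term `λ_j / 8`, the operator `H_j` is a symmetrically ordered
quadratic expression in the generators `u_a`, `∂/∂u_a` of the Weyl algebra, and such expressions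
form a Lie algebra under the symplectic bracket of symmetric matrices (`quad_mul_sub_quad_mul`). The
commutator relations therefore reduce to identities between polynomials in the parameters.

The defects `d j = P_j σ_b` then satisfy `P_i (d j) - P_j (d i) = ∑ l, structureConst i j l • d l`,
while `d 0 = 0` and `d 5 = 0`, as the scheme contains all of `R_10`. With respect to the weight of
the parameters, the terms of lowest order of `P_3`, `P_4`, `P_6`, `P_7`, `P_10` include, up to the
sign, `∂²/∂u_2 ∂u_1`, `∂²/∂u_2² / 2`, `∂²/∂u_5 ∂u_1`, `∂²/∂u_5 ∂u_2`, `∂²/∂u_5² / 2`. If the defects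
vanish below some weight, the lowest part of the equations is a system of linear differential
equations with constant or linear coefficients (`DefectSystem.two`, `LeadingRelations`,
`LowRelations`). Together with the lines of the scheme (`Normalized`) and homogeneity it forces the
defects to vanish at the next weight as well (`VanishBelow.step`), with twelve exceptions of low
weight, in which the coefficients are computed (`Scheme.low_defects`).
-/

set_option linter.unusedSimpArgs false

namespace Curve34

open MvPolynomial (X)

/-! ### The vector fields -/

open MvPolynomial in
/-- The derivation of `ℚ[μ]` with `μ_{m_k} ↦ V_{jk}`. -/
noncomputable def derL (j : Fin 6) : Derivation ℚ Poly Poly := mkDerivation ℚ (matV j)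

theorem derL_μ (j i : Fin 6) : derL j (MvPolynomial.X i) = matV j i :=
  MvPolynomial.mkDerivation_X ℚ (matV j) i

theorem mulPoly_apply (p : Poly) (φ : Series) : mulPoly p φ = p • φ :=
  (MvPowerSeries.smul_eq_C_mul φ p).symm

theorem coeff_dMu (i : Fin 6) (φ : Series) (e : Fin 3 →₀ ℕ) :
    MvPowerSeries.coeff e (dMu i φ) = MvPolynomial.pderiv i (MvPowerSeries.coeff e φ) := rfl

/-- The operator `L_j` acts on a series coefficient by coefficient. -/
theorem coeff_opL (j : Fin 6) (φ : Series) (e : Fin 3 →₀ ℕ) :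
    MvPowerSeries.coeff e (opL j φ) = derL j (MvPowerSeries.coeff e φ) := by
  have sum_apply : ∀ (D : Fin 6 → Derivation ℚ Poly Poly) (p : Poly),
      (∑ i, D i) p = ∑ i, D i p := fun D p => by
    rw [← Derivation.coeFnAddMonoidHom_apply, map_sum, Finset.sum_apply]
    rfl
  simp only [opL, LinearMap.sum_apply, Module.End.mul_apply, mulPoly_apply, map_sum,
    MvPowerSeries.coeff_smul, coeff_dMu]
  have h : derL j = ∑ i, matV j i • MvPolynomial.pderiv i := by
    apply MvPolynomial.derivation_ext
    intro k
    rw [derL_μ, sum_apply]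
    simp [MvPolynomial.pderiv_X, Pi.single_apply]
  rw [h, sum_apply]
  rfl

/-! ### Quadratic expressions in the generators of a Weyl algebra -/

section Weyl

variable {A B ι : Type*} [CommRing A] [Ring B] [Algebra A B] [Fintype ι]

/-- The quadratic expression `∑ S_{ij} w_i w_j` in a family of elements of an algebra. -/
def quad (w : ι → B) (S : Matrix ι ι A) : B := ∑ i, ∑ j, S i j • (w i * w j)

theorem quad_add (w : ι → B) (S T : Matrix ι ι A) : quad w (S + T) = quad w S + quad w T := by
  simp [quad, add_smul, Finset.sum_add_distrib]

theorem quad_sub (w : ι → B) (S T : Matrix ι ι A) : quad w (S - T) = quad w S - quad w T := by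
  simp [quad, sub_smul, Finset.sum_sub_distrib]

theorem quad_smul (w : ι → B) (a : A) (S : Matrix ι ι A) : quad w (a • S) = a • quad w S := by
  simp [quad, Finset.smul_sum, mul_smul]

theorem quad_sum {κ : Type*} (s : Finset κ) (w : ι → B) (S : κ → Matrix ι ι A) :
    quad w (∑ k ∈ s, S k) = ∑ k ∈ s, quad w (S k) := by
  classical
  induction s using Finset.induction_on with
  | empty => simp [quad]
  | insert a s ha ih => rw [Finset.sum_insert ha, Finset.sum_insert ha, quad_add, ih]

variable {w : ι → B} {Ω : Matrix ι ι A}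

/-- A generator acts on quadratic expressions through its symplectic pairing with the symmetric
matrix. -/
theorem mul_quad (hw : ∀ i j, w i * w j = w j * w i + algebraMap A B (Ω i j))
    {S : Matrix ι ι A} (hS : S.IsSymm) (i : ι) :
    w i * quad w S = quad w S * w i + (2 : A) • ∑ l, (Ω * S) i l • w l := by
  have h1 : ∀ k l, w i * (w k * w l) = w k * w l * w i + Ω i k • w l + Ω i l • w k := by
    intro k l
    rw [← mul_assoc, hw i k, add_mul, mul_assoc, hw i l, mul_add, ← mul_assoc,
      ← Algebra.smul_def, ← Algebra.commutes, ← Algebra.smul_def]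
    abel
  have h2 : ∑ k, ∑ l, S k l • Ω i l • w k = ∑ l, (Ω * S) i l • w l := by
    refine Finset.sum_congr rfl fun k _ => ?_
    rw [Matrix.mul_apply, Finset.sum_smul]
    refine Finset.sum_congr rfl fun l _ => ?_
    rw [smul_smul, mul_comm, hS.apply]
  have h3 : ∑ k, ∑ l, S k l • Ω i k • w l = ∑ l, (Ω * S) i l • w l := by
    rw [Finset.sum_comm]
    refine Finset.sum_congr rfl fun k _ => ?_
    rw [Matrix.mul_apply, Finset.sum_smul]
    refine Finset.sum_congr rfl fun l _ => ?_
    rw [smul_smul, mul_comm]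
  rw [two_smul]
  nth_rw 1 [← h3]
  rw [← h2]
  simp only [quad, Finset.mul_sum, Finset.sum_mul, mul_smul_comm, smul_mul_assoc, h1, smul_add,
    Finset.sum_add_distrib]
  abel

/-- Quadratic expressions in elements with central commutators `[w_i, w_j] = Ω_{ij}` form a Lie
algebra, the bracket being the symplectic one on symmetric matrices. -/
theorem quad_mul_sub_quad_mul (hw : ∀ i j, w i * w j = w j * w i + algebraMap A B (Ω i j))
    {S T : Matrix ι ι A} (hT : T.IsSymm) (hΩ : Ω.transpose = -Ω) :
    quad w S * quad w T - quad w T * quad w S = (2 : A) • quad w (S * Ω * T - T * Ω * S) := by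
  have h1 : ∀ i j, w i * w j * quad w T = quad w T * (w i * w j)
      + ((2 : A) • ∑ l, (Ω * T) i l • (w l * w j) + (2 : A) • ∑ l, (Ω * T) j l • (w i * w l)) := by
    intro i j
    rw [mul_assoc, mul_quad hw hT, mul_add, ← mul_assoc, mul_quad hw hT, add_mul, mul_assoc]
    simp only [mul_smul_comm, smul_mul_assoc, Finset.mul_sum, Finset.sum_mul, add_assoc]
  have h2 : ∑ i, ∑ j, S i j • ∑ l, (Ω * T) j l • (w i * w l) = quad w (S * Ω * T) := by
    unfold quad
    refine Finset.sum_congr rfl fun i _ => ?_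
    simp only [Finset.smul_sum]
    rw [Finset.sum_comm]
    refine Finset.sum_congr rfl fun l _ => ?_
    rw [Matrix.mul_assoc, Matrix.mul_apply, Finset.sum_smul]
    simp only [smul_smul]
  have h3 : ∑ i, ∑ j, S i j • ∑ l, (Ω * T) i l • (w l * w j) = - quad w (T * Ω * S) := by
    have e : T * Ω * S = - ((Ω * T).transpose * S) := by
      rw [Matrix.transpose_mul, hT.eq, hΩ]; simp
    rw [e, show -((Ω * T).transpose * S) = (-1 : A) • ((Ω * T).transpose * S) by simp, quad_smul]
    simp only [neg_smul, one_smul, neg_neg]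
    unfold quad
    simp only [Finset.smul_sum]
    rw [Finset.sum_congr rfl fun i _ => Finset.sum_comm, Finset.sum_comm]
    refine Finset.sum_congr rfl fun l _ => ?_
    rw [Finset.sum_comm]
    refine Finset.sum_congr rfl fun j _ => ?_
    rw [Matrix.mul_apply, Finset.sum_smul]
    simp only [smul_smul, Matrix.transpose_apply, mul_comm]
  have h4 : quad w S * quad w T = quad w T * quad w S
      + ((2 : A) • (∑ i, ∑ j, S i j • ∑ l, (Ω * T) i l • (w l * w j))
        + (2 : A) • (∑ i, ∑ j, S i j • ∑ l, (Ω * T) j l • (w i * w l))) := by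
    conv_lhs => rw [quad]
    conv_rhs => enter [1, 2]; rw [quad]
    simp only [Finset.sum_mul, smul_mul_assoc, h1, Finset.mul_sum, mul_smul_comm, smul_add,
      Finset.sum_add_distrib, Finset.smul_sum, smul_comm (2 : A)]
  rw [h4, h2, h3, quad_sub]
  simp only [smul_sub, smul_neg]
  abel

end Weyl

/-! ### The operators as quadratic expressions -/

/-- Multiplication by `u_a`, as a `ℚ[μ]`-linear map. -/
noncomputable def uLin (a : Fin 3) : Module.End Poly Series :=
  LinearMap.mulLeft Poly (MvPowerSeries.X a)

/-- The partial derivative `∂/∂u_a`, as a `ℚ[μ]`-linear map. -/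
noncomputable def dLin (a : Fin 3) : Module.End Poly Series :=
  (MvPowerSeries.pderiv Poly a : Derivation Poly Series Series).toLinearMap

/-- The six generators `u_5, u_2, u_1, ∂/∂u_5, ∂/∂u_2, ∂/∂u_1` of the Weyl algebra. -/
noncomputable def weyl : Fin 3 ⊕ Fin 3 → Module.End Poly Series := Sum.elim uLin dLin

/-- The commutators of the generators: `[weyl i, weyl j] = sympl i j`. -/
noncomputable def sympl : Matrix (Fin 3 ⊕ Fin 3) (Fin 3 ⊕ Fin 3) Poly :=
  Matrix.fromBlocks 0 (-1) 1 0

theorem mulU_apply (a : Fin 3) (φ : Series) : mulU a φ = uLin a φ := rfl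

theorem dU_apply (a : Fin 3) (φ : Series) : dU a φ = dLin a φ := rfl

theorem dLin_comm (a b : Fin 3) : dLin a * dLin b = dLin b * dLin a := by
  ext φ n : 2
  simp only [dLin, Module.End.mul_apply, Derivation.coeFn_coe,
    MvPowerSeries.coeff_pderiv]
  rcases eq_or_ne a b with rfl | h
  · rfl
  · rw [add_right_comm]
    simp [h, h.symm]
    ring

theorem dLin_mul_uLin (a b : Fin 3) :
    dLin a * uLin b = uLin b * dLin a + algebraMap Poly _ (if a = b then 1 else 0) := by
  ext φ : 1
  simp only [dLin, uLin, Module.End.mul_apply, Derivation.coeFn_coe,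
    LinearMap.mulLeft_apply, LinearMap.add_apply, Derivation.leibniz, smul_eq_mul]
  rcases eq_or_ne a b with rfl | h
  · simp
  · simp [h, MvPowerSeries.pderiv_X_of_ne h.symm]

theorem weyl_comm (i j : Fin 3 ⊕ Fin 3) :
    weyl i * weyl j = weyl j * weyl i + algebraMap Poly _ (sympl i j) := by
  rcases i with a | a <;> rcases j with b | b
  · ext φ : 1
    simp [weyl, sympl, uLin, mul_left_comm]
  · simp only [weyl, sympl, Sum.elim_inl, Sum.elim_inr, Matrix.fromBlocks_apply₁₂, dLin_mul_uLin,
      Matrix.neg_apply, Matrix.one_apply, add_assoc, ← map_add]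
    simp [eq_comm]
  · simp only [weyl, sympl, Sum.elim_inl, Sum.elim_inr, Matrix.fromBlocks_apply₂₁, dLin_mul_uLin,
      Matrix.one_apply]
  · simp [weyl, sympl, dLin_comm a b]

theorem sympl_transpose : sympl.transpose = -sympl := by
  simp [sympl, Matrix.fromBlocks_transpose, Matrix.fromBlocks_neg]

/-- The vector fields `L_j` only involve the parameters, so they commute with `u_a` and `∂/∂u_a`. -/
theorem opL_weyl (j : Fin 6) (i : Fin 3 ⊕ Fin 3) (φ : Series) :
    opL j (weyl i φ) = weyl i (opL j φ) := by
  ext1 n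
  rw [coeff_opL]
  rcases i with a | a
  · simp only [weyl, Sum.elim_inl, uLin, LinearMap.mulLeft_apply, MvPowerSeries.X,
      MvPowerSeries.coeff_monomial_mul, coeff_opL]
    split_ifs <;> simp
  · simp only [weyl, Sum.elim_inr, dLin, Derivation.coeFn_coe,
      MvPowerSeries.coeff_pderiv, coeff_opL, Derivation.leibniz]
    simp [mul_comm]

theorem opL_smul (j : Fin 6) (p : Poly) (φ : Series) :
    opL j (p • φ) = p • opL j φ + derL j p • φ := by
  ext1 n
  simp only [coeff_opL, MvPowerSeries.coeff_smul, map_add, Derivation.leibniz, smul_eq_mul]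
  ring

theorem opL_quad (j : Fin 6) (S : Matrix (Fin 3 ⊕ Fin 3) (Fin 3 ⊕ Fin 3) Poly) (φ : Series) :
    opL j (quad weyl S φ) = quad weyl S (opL j φ) + quad weyl (S.map (derL j)) φ := by
  simp only [quad, LinearMap.sum_apply, LinearMap.smul_apply, map_sum, opL_smul,
    Module.End.mul_apply, opL_weyl, Finset.sum_add_distrib, Matrix.map_apply]

/-- The symmetric matrix, with respect to `weyl`, of the quadratic expression that equals
`2 H_j + λ_j / 4`. -/
noncomputable def matS (j : Fin 6) : Matrix (Fin 3 ⊕ Fin 3) (Fin 3 ⊕ Fin 3) Poly :=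
  Matrix.fromBlocks (matGamma j) (matBeta j) (matBeta j).transpose (matAlpha j)

theorem matGamma_isSymm (j : Fin 6) : (matGamma j).IsSymm := by
  ext a b
  fin_cases j <;> fin_cases a <;> fin_cases b <;> rfl

theorem matAlpha_isSymm (j : Fin 6) : (matAlpha j).IsSymm := by
  ext a b
  fin_cases j <;> fin_cases a <;> fin_cases b <;> rfl

theorem matS_isSymm (j : Fin 6) : (matS j).IsSymm :=
  (matGamma_isSymm j).fromBlocks rfl (matAlpha_isSymm j)

/-- The summand `Tr β_j / 2` of `H_j` is the one that the symmetric ordering of the products of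
`u_a` and `∂/∂u_b` produces. -/
theorem quad_matS_apply (j : Fin 6) (φ : Series) : (1 / 2 : ℚ) • quad weyl (matS j) φ
    = opH j φ + (1 / 8 : ℚ) • logDerivDisc j • φ := by
  have h : ∀ a b : Fin 3, dLin a (uLin b φ) = uLin b (dLin a φ) + (if a = b then 1 else 0 : Poly) •
      φ := by
    intro a b
    have := congrArg (fun T => T φ) (dLin_mul_uLin a b)
    rw [Algebra.algebraMap_eq_smul_one] at this
    exact this
  simp only [quad, Fintype.sum_sum_type, matS, Matrix.fromBlocks_apply₁₁,
    Matrix.fromBlocks_apply₁₂, Matrix.fromBlocks_apply₂₁, Matrix.fromBlocks_apply₂₂, weyl,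
    Sum.elim_inl, Sum.elim_inr, LinearMap.add_apply, LinearMap.sum_apply, LinearMap.smul_apply,
    Module.End.mul_apply, opH, LinearMap.sub_apply, mulPoly_apply, mulU_apply, dU_apply,
    Matrix.transpose_apply, h, smul_add, Finset.sum_add_distrib, Matrix.trace, Matrix.diag_apply]
  have e1 : ∑ a, ∑ b, matBeta j b a • uLin b (dLin a φ)
      = ∑ a, ∑ b, matBeta j a b • uLin a (dLin b φ) := Finset.sum_comm
  have e2 : ∑ a, ∑ b, matBeta j b a • (if a = b then 1 else 0 : Poly) • φ
      = (∑ a, matBeta j a a) • φ := by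
    simp [Finset.sum_smul]
  rw [e1, e2]
  simp only [← Finset.smul_sum]
  generalize ∑ a, ∑ b, matBeta j a b • uLin a (dLin b φ) = x
  generalize (∑ a, matBeta j a a) • φ = y
  generalize logDerivDisc j • φ = z
  module

/-- `L_j - H_j` in the symmetric ordering, in which commutators are read off from matrices. -/
theorem heatOp_apply (j : Fin 6) (φ : Series) : heatOp j φ = opL j φ
    - (1 / 2 : ℚ) • quad weyl (matS j) φ + (1 / 8 : ℚ) • logDerivDisc j • φ := by
  rw [quad_matS_apply, heatOp, LinearMap.sub_apply]
  abel

/-! ### The structure equations -/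

theorem quad_weyl_comm (i j : Fin 6) (φ : Series) :
    quad weyl (matS i) (quad weyl (matS j) φ) = quad weyl (matS j) (quad weyl (matS i) φ)
      + (2 : Poly) • quad weyl (matS i * sympl * matS j - matS j * sympl * matS i) φ := by
  have h := congrArg (fun T => T φ)
    (quad_mul_sub_quad_mul weyl_comm (S := matS i) (matS_isSymm j) sympl_transpose)
  simp only [LinearMap.sub_apply, Module.End.mul_apply, LinearMap.smul_apply] at h
  rw [← h]
  abel

/-- The operators `L_i - H_i` span a Lie algebra over `ℚ[μ]` as soon as the vector fields `L_i`, the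
quadratic forms of the `H_i`, and the functions `L_i(Δ)/Δ` satisfy the same structure equations. -/
theorem heatOp_comm {i j : Fin 6} {c : Fin 6 → Poly}
    (hX : ∀ k, derL i (matV j k) - derL j (matV i k) = ∑ l, c l * matV l k)
    (hS : (matS j).map (derL i) - (matS i).map (derL j)
      - (matS i * sympl * matS j - matS j * sympl * matS i) = ∑ l, c l • matS l)
    (hl : derL i (logDerivDisc j) - derL j (logDerivDisc i) = ∑ l, c l * logDerivDisc l)
    (φ : Series) :
    heatOp i (heatOp j φ) - heatOp j (heatOp i φ) = ∑ l, c l • heatOp l φ := by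
  have h1 : opL i (opL j φ) - opL j (opL i φ) = ∑ l, c l • opL l φ := by
    have hD : ⁅derL i, derL j⁆ = ∑ l, c l • derL l := by
      apply MvPolynomial.derivation_ext
      intro k
      rw [Derivation.commutator_apply, derL_μ, derL_μ, hX, ← Derivation.coeFnAddMonoidHom_apply,
        map_sum, Finset.sum_apply]
      simp [derL_μ]
    ext1 e
    simp only [map_sub, map_sum, coeff_opL, MvPowerSeries.coeff_smul]
    rw [← Derivation.commutator_apply, hD, ← Derivation.coeFnAddMonoidHom_apply,
        map_sum, Finset.sum_apply]
    simp
  have h2 : quad weyl ((matS j).map (derL i)) φ = quad weyl ((matS i).map (derL j)) φ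
      + quad weyl (matS i * sympl * matS j - matS j * sympl * matS i) φ
      + ∑ l, c l • quad weyl (matS l) φ := by
    have h := congrArg (fun S => quad weyl S φ) hS
    simp only [quad_sub, quad_sum, quad_smul, LinearMap.sub_apply, LinearMap.sum_apply,
      LinearMap.smul_apply] at h
    rw [← h, quad_sub]
    simp only [LinearMap.sub_apply]
    abel
  have h3 : derL i (logDerivDisc j) • φ = derL j (logDerivDisc i) • φ
      + ∑ l, c l • logDerivDisc l • φ := by
    rw [sub_eq_iff_eq_add'.1 hl, add_smul, Finset.sum_smul]
    simp only [mul_smul]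
  have h4 : ∑ l, c l • heatOp l φ = ∑ l, c l • opL l φ
      - (1 / 2 : ℚ) • ∑ l, c l • quad weyl (matS l) φ
      + (1 / 8 : ℚ) • ∑ l, c l • logDerivDisc l • φ := by
    simp only [heatOp_apply, smul_add, smul_sub, Finset.sum_add_distrib, Finset.sum_sub_distrib,
      Finset.smul_sum, smul_comm (1 / 2 : ℚ), smul_comm (1 / 8 : ℚ)]
  rw [h4, ← h1]
  simp only [heatOp_apply, map_add, map_sub, map_smul, opL_quad, opL_smul, quad_weyl_comm i j,
    h2, h3, smul_add, smul_sub, smul_comm (logDerivDisc i) (logDerivDisc j)]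
  match_scalars <;> algebra

/-- The structure equations of the quadratic forms, written out in blocks, in terms of `α_j`, `β_j`,
`γ_j`. -/
theorem matS_structure {i j : Fin 6} {c : Fin 6 → Poly}
    (hα : ∀ a b, derL i (matAlpha j a b) - derL j (matAlpha i a b)
      - (matAlpha i * matBeta j + (matBeta j).transpose * matAlpha i
        - matAlpha j * matBeta i - (matBeta i).transpose * matAlpha j) a b
      = ∑ l, c l * matAlpha l a b)
    (hβ : ∀ a b, derL i (matBeta j a b) - derL j (matBeta i a b)
      - (matBeta i * matBeta j - matGamma i * matAlpha j
        - matBeta j * matBeta i + matGamma j * matAlpha i) a b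
      = ∑ l, c l * matBeta l a b)
    (hγ : ∀ a b, derL i (matGamma j a b) - derL j (matGamma i a b)
      - (matBeta i * matGamma j + matGamma j * (matBeta i).transpose
        - matBeta j * matGamma i - matGamma i * (matBeta j).transpose) a b
      = ∑ l, c l * matGamma l a b) :
    (matS j).map (derL i) - (matS i).map (derL j)
      - (matS i * sympl * matS j - matS j * sympl * matS i) = ∑ l, c l • matS l := by
  have e : ∀ i j, matS i * sympl * matS j = Matrix.fromBlocks
      (matBeta i * matGamma j - matGamma i * (matBeta j).transpose)
      (matBeta i * matBeta j - matGamma i * matAlpha j)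
      (matAlpha i * matGamma j - (matBeta i).transpose * (matBeta j).transpose)
      (matAlpha i * matBeta j - (matBeta i).transpose * matAlpha j) := by
    intro i j
    -- In block form `sympl` exchanges the two block rows of the right factor, up to a sign.
    simp [matS, sympl, Matrix.fromBlocks_multiply, sub_eq_add_neg]
  rw [e, e]
  refine Matrix.ext fun p q => ?_
  rcases p with a | a <;> rcases q with b | b
  · have h := hγ a b
    simp only [Matrix.sub_apply, Matrix.add_apply, Matrix.sum_apply, Matrix.smul_apply, matS,
      Matrix.map_apply, Matrix.fromBlocks_apply₁₁, smul_eq_mul] at h ⊢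
    rw [← h]
    ring
  · have h := hβ a b
    simp only [Matrix.sub_apply, Matrix.add_apply, Matrix.sum_apply, Matrix.smul_apply, matS,
      Matrix.map_apply, Matrix.fromBlocks_apply₁₂, smul_eq_mul] at h ⊢
    rw [← h]
    ring
  · have h := hβ b a
    have t1 : (matAlpha i * matGamma j) a b = (matGamma j * matAlpha i) b a := by
      rw [← Matrix.transpose_apply (matGamma j * matAlpha i), Matrix.transpose_mul,
        matAlpha_isSymm, matGamma_isSymm]
    have t2 : (matAlpha j * matGamma i) a b = (matGamma i * matAlpha j) b a := by
      rw [← Matrix.transpose_apply (matGamma i * matAlpha j), Matrix.transpose_mul,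
        matAlpha_isSymm, matGamma_isSymm]
    simp only [← Matrix.transpose_mul]
    simp only [Matrix.sub_apply, Matrix.add_apply, Matrix.sum_apply, Matrix.smul_apply, matS,
      Matrix.map_apply, Matrix.fromBlocks_apply₂₁, smul_eq_mul, Matrix.transpose_apply,
      t1, t2] at h ⊢
    rw [← h]
    ring
  · have h := hα a b
    simp only [Matrix.sub_apply, Matrix.add_apply, Matrix.sum_apply, Matrix.smul_apply, matS,
      Matrix.map_apply, Matrix.fromBlocks_apply₂₂, smul_eq_mul] at h ⊢
    rw [← h]
    ring

/-! ### Verification of the structure equations -/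

/-- The value of a polynomial at a point of parameter space. -/
noncomputable def ev (x : Fin 6 → ℚ) (p : Poly) : ℚ := MvPolynomial.eval x p

/-- The derivative of a polynomial along the vector field `L_j`, at a point of parameter space. -/
noncomputable def evL (j : Fin 6) (x : Fin 6 → ℚ) (p : Poly) : ℚ := MvPolynomial.eval x (derL j p)

section Evaluation

variable (j : Fin 6) (x : Fin 6 → ℚ) (p q : Poly) (a : ℚ) (n : ℕ)

theorem ev_add : ev x (p + q) = ev x p + ev x q := map_add _ _ _
theorem ev_sub : ev x (p - q) = ev x p - ev x q := map_sub _ _ _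
theorem ev_neg : ev x (-p) = -ev x p := map_neg _ _
theorem ev_mul : ev x (p * q) = ev x p * ev x q := map_mul _ _ _
theorem ev_pow : ev x (p ^ n) = ev x p ^ n := map_pow _ _ _
theorem ev_smul : ev x (a • p) = a * ev x p := MvPolynomial.smul_eval _ _ _
theorem ev_zero : ev x 0 = 0 := map_zero _
theorem ev_one : ev x 1 = 1 := map_one _
theorem ev_ofNat [n.AtLeastTwo] : ev x (ofNat(n) : Poly) = ofNat(n) := map_ofNat _ _
theorem ev_X (i : Fin 6) : ev x (MvPolynomial.X i) = x i := MvPolynomial.eval_X _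
theorem ev_derL : ev x (derL j p) = evL j x p := rfl

theorem evL_add : evL j x (p + q) = evL j x p + evL j x q := by simp [evL]
theorem evL_sub : evL j x (p - q) = evL j x p - evL j x q := by simp [evL]
theorem evL_neg : evL j x (-p) = -evL j x p := by simp [evL]
theorem evL_mul : evL j x (p * q) = ev x p * evL j x q + ev x q * evL j x p := by
  simp [evL, ev, Derivation.leibniz]
theorem evL_pow : evL j x (p ^ n) = n * ev x p ^ (n - 1) * evL j x p := by
  simp [evL, ev, Derivation.leibniz_pow, mul_assoc]
theorem evL_smul : evL j x (a • p) = a * evL j x p := by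
  rw [evL, (derL j).map_smul_of_tower a p, MvPolynomial.smul_eval, evL]
theorem evL_zero : evL j x 0 = 0 := by simp [evL]
theorem evL_one : evL j x 1 = 0 := by simp [evL]
theorem evL_ofNat [n.AtLeastTwo] : evL j x (ofNat(n) : Poly) = 0 := by
  rw [evL, show (ofNat(n) : Poly) = ((n : ℕ) : Poly) from rfl, Derivation.map_natCast, map_zero]
theorem evL_X (i : Fin 6) : evL j x (MvPolynomial.X i) = ev x (matV j i) := by
  rw [evL, derL_μ, ev]

variable {p q}

theorem eq_of_ev (h : ∀ x, ev x p = ev x q) : p = q := MvPolynomial.funext h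

end Evaluation

/-- The coefficients in `[P_i, P_j] = ∑ l, structureConst i j l • P_l`, where `P_0, …, P_5` are the
operators `L - H` with subscripts `0, 3, 4, 6, 7, 10`. Only the entries with `0 < i < j` are used;
the others are set to zero. -/
noncomputable def structureConst : Fin 6 → Fin 6 → Fin 6 → Poly :=
  ![0,
    ![0, 0,
      ![μ2 * μ5, -(1/2 : ℚ) • (μ2^2), 0, 0, 1, 0],
      ![(3/2 : ℚ) • (μ9) - (1/12 : ℚ) • (μ2^2 * μ5), -(3/2 : ℚ) • (μ6) + (1/12 : ℚ) • (μ2^3),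
        (1/2 : ℚ) • (μ5), 0, -(1/2 : ℚ) • (μ2), 0],
      ![(1/2 : ℚ) • (μ5^2) + (2/3 : ℚ) • (μ2 * μ8) - (1/6 : ℚ) • (μ2^2 * μ6),
        -(1/3 : ℚ) • (μ2 * μ5), -2 * μ6 + (1/6 : ℚ) • (μ2^3), -(1/3 : ℚ) • (μ2^2), 0, 4],
      ![(1/2 : ℚ) • (μ5 * μ8) - (1/12 : ℚ) • (μ2^2 * μ9), -(1/6 : ℚ) • (μ2 * μ8),
        (1/2 : ℚ) • (μ9), -(1/6 : ℚ) • (μ2 * μ5), -(3/2 : ℚ) • (μ6) + (1/12 : ℚ) • (μ2^3), 0]],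
    ![0, 0, 0,
      ![(1/4 : ℚ) • (μ5^2) - (4/3 : ℚ) • (μ2 * μ8), -(1/3 : ℚ) • (μ2 * μ5), 0,
        (2/3 : ℚ) • (μ2^2), 0, 2],
      ![(1/2 : ℚ) • (μ5 * μ6) - μ2 * μ9, μ8 + (1/2 : ℚ) • (μ2 * μ6), -(7/6 : ℚ) • (μ2 * μ5), μ5,
        (2/3 : ℚ) • (μ2^2), 0],
      ![(1/4 : ℚ) • (μ5 * μ9) - 2 * μ2 * μ12, (1/4 : ℚ) • (μ2 * μ9), 0, 2 * μ8,
        -(7/12 : ℚ) • (μ2 * μ5), (4/3 : ℚ) • (μ2^2)]],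
    ![0, 0, 0, 0,
      ![(1/6 : ℚ) • (μ5 * μ8),
        -(1/12 : ℚ) • (μ5^2) + (3/2 : ℚ) • (μ2 * μ8) - (1/12 : ℚ) • (μ2^2 * μ6),
        -(5/2 : ℚ) • (μ9) + (1/12 : ℚ) • (μ2^2 * μ5), -(5/6 : ℚ) • (μ2 * μ5), (3/2 : ℚ) • (μ6), 0],
      ![0, (1/3 : ℚ) • (μ5 * μ8) - (1/24 : ℚ) • (μ2^2 * μ9), 0,
        -(5/12 : ℚ) • (μ5^2) + (2/3 : ℚ) • (μ2 * μ8), -μ9 + (1/24 : ℚ) • (μ2^2 * μ5), 2 * μ6]],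
    ![0, 0, 0, 0, 0,
      ![(1/2 : ℚ) • (μ8 * μ9) - μ5 * μ12,
        -(1/2 : ℚ) • (μ6 * μ8) + (1/2 : ℚ) • (μ5 * μ9) - μ2 * μ12,
        (5/6 : ℚ) • (μ5 * μ8) - (1/12 : ℚ) • (μ2^2 * μ9),
        -(1/2 : ℚ) • (μ5 * μ6) + (1/2 : ℚ) • (μ2 * μ9),
        -(5/12 : ℚ) • (μ5^2) - (5/6 : ℚ) • (μ2 * μ8) + (1/12 : ℚ) • (μ2^2 * μ6),
        (4/3 : ℚ) • (μ2 * μ5)]],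
    0]

set_option maxHeartbeats 20000000 in
/-- The operators `L_j - H_j` close under commutators. By `heatOp_comm` and `matS_structure` this is
a list of identities between polynomials in the parameters, which are verified at all points. -/
theorem heatOp_comm_of_lt {i j : Fin 6} (hi : 0 < i) (hij : i < j) (φ : Series) :
    heatOp i (heatOp j φ) - heatOp j (heatOp i φ) = ∑ l, structureConst i j l • heatOp l φ := by
  refine heatOp_comm ?_ (matS_structure ?_ ?_ ?_) ?_ φ
  all_goals
    fin_cases i <;> fin_cases j <;> first | (exfalso; revert hi hij; decide) | skip
  all_goals
    clear hi hij
    simp only [Fin.isValue, Fin.reduceFinMk, Fin.zero_eta, Fin.mk_one, structureConst,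
      Fin.forall_fin_succ, Fin.sum_univ_six, Fin.sum_univ_three, Matrix.of_apply,
      Matrix.cons_val, Matrix.cons_val_zero, Matrix.cons_val_succ, IsEmpty.forall_iff, and_true,
      Matrix.sub_apply, Matrix.add_apply, Matrix.transpose_apply, Matrix.mul_apply,
      matV, logDerivDisc, matAlpha, matBeta, matGamma, alpha0, alpha3, alpha4, alpha6, alpha7,
      alpha10, beta0, beta3, beta4, beta6, beta7, beta10,
      gamma0, gamma3, gamma4, gamma6, gamma7, gamma10]
    repeat' apply And.intro
    all_goals
      apply eq_of_ev
      intro x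
      simp only [ev_derL, ev_add, ev_sub, ev_neg, ev_mul, ev_pow, ev_smul, ev_zero, ev_one,
        ev_ofNat, ev_X, evL_add, evL_sub, evL_neg, evL_mul, evL_pow, evL_smul, evL_zero, evL_one,
        evL_ofNat, evL_X, matV, Matrix.of_apply, Matrix.cons_val]
      ring

/-! ### Hurwitz coefficients -/

/-- The coefficient of `μ^n u^e / e!` in a series. -/
noncomputable def coeffNat (φ : Series) (e : Fin 3 →₀ ℕ) (n : Fin 6 →₀ ℕ) : ℚ :=
  (∏ i, (e i).factorial : ℕ) * MvPolynomial.coeff n (MvPowerSeries.coeff e φ)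

/-- The finitely supported function of the nonnegative parts of integers. -/
noncomputable def natPart {ι : Type*} [Finite ι] (z : ι → ℤ) : ι →₀ ℕ :=
  Finsupp.equivFunOnFinite.symm fun i => (z i).toNat

open Classical in
/-- The Hurwitz coefficients of a series, extended by zero to all integral exponents. -/
noncomputable def coeffInt (φ : Series) (z : Fin 3 → ℤ) (w : Fin 6 → ℤ) : ℚ :=
  if 0 ≤ z ∧ 0 ≤ w then coeffNat φ (natPart z) (natPart w) else 0

section CoeffNat

variable (φ : Series) (e : Fin 3 →₀ ℕ) (n : Fin 6 →₀ ℕ)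

theorem factorial_prod_add_single (a : Fin 3) :
    ∏ i, ((e + Finsupp.single a 1 : Fin 3 →₀ ℕ) i).factorial = (e a + 1) * ∏ i, (e i).factorial :=
      by
  rw [← Finset.mul_prod_erase _ _ (Finset.mem_univ a),
    ← Finset.mul_prod_erase _ (fun i => (e i).factorial) (Finset.mem_univ a),
    Finset.prod_congr (g := fun i => (e i).factorial) rfl]
  · simp [Nat.factorial_succ, mul_assoc]
  · intro i hi
    simp [Finset.ne_of_mem_erase hi]

theorem coeffNat_dU (a : Fin 3) :
    coeffNat (dU a φ) e n = coeffNat φ (e + Finsupp.single a 1) n := by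
  have h : MvPowerSeries.coeff e (dU a φ)
      = MvPowerSeries.coeff (e + Finsupp.single a 1) φ * (e a + 1) :=
    MvPowerSeries.coeff_pderiv φ e
  rw [coeffNat, coeffNat, factorial_prod_add_single, h,
    show ((e a : Poly) + 1) = MvPolynomial.C ((e a : ℚ) + 1) by simp, mul_comm (MvPowerSeries.coeff
      _ _),
    MvPolynomial.coeff_C_mul]
  push_cast
  ring

theorem coeffNat_mulU (a : Fin 3) :
    coeffNat (mulU a φ) (e + Finsupp.single a 1) n = (e a + 1) * coeffNat φ e n := by
  have h : MvPowerSeries.coeff (e + Finsupp.single a 1) (mulU a φ) = MvPowerSeries.coeff e φ := by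
    rw [add_comm]
    exact (MvPowerSeries.coeff_add_monomial_mul _ _ _ _).trans (one_mul _)
  rw [coeffNat, coeffNat, factorial_prod_add_single, h]
  push_cast
  ring

theorem coeffNat_mulU_of_eq_zero {a : Fin 3} (h : e a = 0) : coeffNat (mulU a φ) e n = 0 := by
  have h : MvPowerSeries.coeff e (mulU a φ) = 0 := by
    refine (MvPowerSeries.coeff_monomial_mul _ _ _ _).trans (if_neg fun h' => ?_)
    have := h' a
    simp [h] at this
  rw [coeffNat, h]
  simp

theorem coeffNat_X (i : Fin 6) :
    coeffNat ((X i : Poly) • φ) e (n + Finsupp.single i 1) = coeffNat φ e n := by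
  rw [coeffNat, coeffNat, MvPowerSeries.coeff_smul, add_comm n, MvPolynomial.coeff_X_mul]

theorem coeffNat_X_of_eq_zero {i : Fin 6} (h : n i = 0) :
    coeffNat ((X i : Poly) • φ) e n = 0 := by
  rw [coeffNat, MvPowerSeries.coeff_smul, MvPolynomial.coeff_X_mul', if_neg (by simpa using h),
    mul_zero]

theorem coeffNat_dMu (i : Fin 6) :
    coeffNat (dMu i φ) e n = (n i + 1) * coeffNat φ e (n + Finsupp.single i 1) := by
  rw [coeffNat, coeffNat, coeff_dMu, MvPolynomial.coeff_pderiv]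
  ring

end CoeffNat

theorem natPart_apply {ι : Type*} [Finite ι] (z : ι → ℤ) (i : ι) : natPart z i = (z i).toNat := rfl

theorem natPart_add_single {ι : Type*} [Finite ι] [DecidableEq ι] {z : ι → ℤ} {a : ι}
    (h : 0 ≤ z a) :
    natPart (z + Pi.single a 1) = natPart z + Finsupp.single a 1 := by
  ext i
  rcases eq_or_ne i a with rfl | hi
  · simp only [natPart_apply, Pi.add_apply, Pi.single_eq_same, Finsupp.add_apply,
      Finsupp.single_eq_same]
    omega
  · simp [natPart_apply, hi]

theorem zero_le_add_single_iff {ι : Type*} [DecidableEq ι] {z : ι → ℤ} {a : ι} (h : 0 ≤ z a) :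
    0 ≤ z + Pi.single a 1 ↔ 0 ≤ z := by
  constructor <;> intro H i
  · rcases eq_or_ne i a with rfl | hi
    · exact h
    · simpa [hi] using H i
  · rcases eq_or_ne i a with rfl | hi
    · simp only [Pi.zero_apply, Pi.add_apply, Pi.single_eq_same]
      omega
    · simpa [hi] using H i

section CoeffInt

variable (φ : Series) {z : Fin 3 → ℤ} {w : Fin 6 → ℤ}

theorem coeffInt_of_neg {i : Fin 3} (h : z i < 0) : coeffInt φ z w = 0 :=
  if_neg fun H => absurd (H.1 i) (not_le.2 h)

theorem coeffInt_of_neg' {i : Fin 6} (h : w i < 0) : coeffInt φ z w = 0 :=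
  if_neg fun H => absurd (H.2 i) (not_le.2 h)

theorem coeffInt_dU {a : Fin 3} (h : 0 ≤ z a) :
    coeffInt (dU a φ) z w = coeffInt φ (z + Pi.single a 1) w := by
  classical
  unfold coeffInt
  exact if_congr (and_congr_left' (zero_le_add_single_iff h).symm)
    (by rw [coeffNat_dU, natPart_add_single h]) rfl

theorem coeffInt_mulU (a : Fin 3) :
    coeffInt (mulU a φ) z w = z a * coeffInt φ (z - Pi.single a 1) w := by
  rcases lt_trichotomy (z a) 0 with h | h | h
  · rw [coeffInt_of_neg _ h, coeffInt_of_neg φ (i := a), mul_zero]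
    simp only [Pi.sub_apply, Pi.single_eq_same]
    omega
  · rw [h, Int.cast_zero, zero_mul, coeffInt, coeffNat_mulU_of_eq_zero, ite_self]
    rw [natPart_apply, h, Int.toNat_zero]
  · obtain ⟨y, rfl⟩ : ∃ y : Fin 3 → ℤ, z = y + Pi.single a 1 := ⟨z - Pi.single a 1, by simp⟩
    have h' : 0 ≤ y a := by
      simp only [Pi.add_apply, Pi.single_eq_same] at h
      omega
    classical
    unfold coeffInt
    rw [add_sub_cancel_right, mul_ite, mul_zero]
    refine if_congr (and_congr_left' (zero_le_add_single_iff h')) ?_ rfl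
    rw [natPart_add_single h', coeffNat_mulU, natPart_apply, Pi.add_apply, Pi.single_eq_same,
      ← Int.cast_natCast, Int.toNat_of_nonneg h']
    push_cast
    ring

theorem coeffInt_X (i : Fin 6) :
    coeffInt ((X i : Poly) • φ) z w = coeffInt φ z (w - Pi.single i 1) := by
  rcases lt_trichotomy (w i) 0 with h | h | h
  · rw [coeffInt_of_neg' _ h, coeffInt_of_neg' φ (i := i)]
    simp only [Pi.sub_apply, Pi.single_eq_same]
    omega
  · rw [coeffInt_of_neg' φ (i := i) (w := w - Pi.single i 1) (by simp [h]), coeffInt,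
      coeffNat_X_of_eq_zero, ite_self]
    rw [natPart_apply, h, Int.toNat_zero]
  · obtain ⟨y, rfl⟩ : ∃ y : Fin 6 → ℤ, w = y + Pi.single i 1 := ⟨w - Pi.single i 1, by simp⟩
    have h' : 0 ≤ y i := by
      simp only [Pi.add_apply, Pi.single_eq_same] at h
      omega
    classical
    unfold coeffInt
    rw [add_sub_cancel_right]
    exact if_congr (and_congr_right' (zero_le_add_single_iff h'))
      (by rw [natPart_add_single h', coeffNat_X]) rfl

theorem coeffInt_dMu (i : Fin 6) :
    coeffInt (dMu i φ) z w = (w i + 1) * coeffInt φ z (w + Pi.single i 1) := by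
  rcases lt_or_ge (w i) 0 with h | h
  · rw [coeffInt_of_neg' _ h]
    rcases eq_or_ne (w i) (-1) with h1 | h1
    · simp [h1]
    · rw [coeffInt_of_neg' φ (i := i), mul_zero]
      simp only [Pi.add_apply, Pi.single_eq_same]
      omega
  · classical
    unfold coeffInt
    rw [mul_ite, mul_zero]
    refine if_congr (and_congr_right' (zero_le_add_single_iff h).symm) ?_ rfl
    rw [natPart_add_single h, coeffNat_dMu, natPart_apply, ← Int.cast_natCast,
      Int.toNat_of_nonneg h]

theorem coeffInt_dU_dU (hz : 0 ≤ z) (a b : Fin 3) :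
    coeffInt (dU a (dU b φ)) z w = coeffInt φ (z + Pi.single a 1 + Pi.single b 1) w := by
  rw [coeffInt_dU _ (hz a), coeffInt_dU _ ((zero_le_add_single_iff (hz a)).2 hz b)]

theorem coeffInt_mulU_dU (hz : 0 ≤ z) (a b : Fin 3) : coeffInt (mulU a (dU b φ)) z w
    = z a * coeffInt φ (z - Pi.single a 1 + Pi.single b 1) w := by
  rw [coeffInt_mulU]
  rcases eq_or_ne (z a) 0 with h | h
  · simp [h]
  · rw [coeffInt_dU]
    have ha := hz a
    have hb := hz b
    rcases eq_or_ne a b with rfl | hab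
    · simp only [Pi.zero_apply, Pi.sub_apply, Pi.single_eq_same] at ha ⊢
      omega
    · simpa [hab.symm] using hb

theorem coeffInt_mulU_mulU (a b : Fin 3) : coeffInt (mulU a (mulU b φ)) z w
    = z a * ((z - Pi.single a 1 : Fin 3 → ℤ) b : ℤ) * coeffInt φ (z - Pi.single a 1 - Pi.single b 1)
      w := by
  rw [coeffInt_mulU, coeffInt_mulU, mul_assoc]

theorem coeffInt_add (φ ψ : Series) : coeffInt (φ + ψ) z w = coeffInt φ z w + coeffInt ψ z w := by
  simp only [coeffInt, coeffNat, map_add, MvPolynomial.coeff_add]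
  split_ifs <;> ring

theorem coeffInt_rat_smul (q : ℚ) : coeffInt (q • φ) z w = q * coeffInt φ z w := by
  have h : MvPowerSeries.coeff (natPart z) (q • φ) = q • MvPowerSeries.coeff (natPart z) φ := rfl
  simp only [coeffInt, coeffNat, h, MvPolynomial.coeff_smul, smul_eq_mul]
  split_ifs <;> ring

end CoeffInt

/-- The coefficient of `μ_2^n2 ⋯ μ_12^n12 u_5^ℓ u_2^m u_1^k / (ℓ! m! k!)` in a series; it is zero if
an exponent is negative. -/
noncomputable def cf (φ : Series) (ℓ m k n2 n5 n6 n8 n9 n12 : ℤ) : ℚ :=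
  coeffInt φ ![ℓ, m, k] ![n2, n5, n6, n8, n9, n12]

section Cf

variable (φ ψ : Series) (ℓ m k n2 n5 n6 n8 n9 n12 : ℤ)

theorem cf_add : cf (φ + ψ) ℓ m k n2 n5 n6 n8 n9 n12
    = cf φ ℓ m k n2 n5 n6 n8 n9 n12 + cf ψ ℓ m k n2 n5 n6 n8 n9 n12 := coeffInt_add _ _

theorem cf_rat_smul (q : ℚ) : cf (q • φ) ℓ m k n2 n5 n6 n8 n9 n12
    = q * cf φ ℓ m k n2 n5 n6 n8 n9 n12 := coeffInt_rat_smul _ _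

theorem cf_zero : cf 0 ℓ m k n2 n5 n6 n8 n9 n12 = 0 := by
  simpa using cf_rat_smul 0 ℓ m k n2 n5 n6 n8 n9 n12 0

theorem cf_neg : cf (-φ) ℓ m k n2 n5 n6 n8 n9 n12 = -cf φ ℓ m k n2 n5 n6 n8 n9 n12 := by
  simpa using cf_rat_smul φ ℓ m k n2 n5 n6 n8 n9 n12 (-1)

theorem cf_sub : cf (φ - ψ) ℓ m k n2 n5 n6 n8 n9 n12
    = cf φ ℓ m k n2 n5 n6 n8 n9 n12 - cf ψ ℓ m k n2 n5 n6 n8 n9 n12 := by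
  rw [sub_eq_add_neg, cf_add, cf_neg, sub_eq_add_neg]

theorem cf_ofNat_smul (n : ℕ) [n.AtLeastTwo] : cf ((ofNat(n) : Poly) • φ) ℓ m k n2 n5 n6 n8 n9 n12
    = (ofNat(n) : ℚ) * cf φ ℓ m k n2 n5 n6 n8 n9 n12 := by
  rw [← cf_rat_smul, show (ofNat(n) : Poly) • φ = (ofNat(n) : ℚ) • φ by
    rw [ofNat_smul_eq_nsmul, ← Nat.cast_smul_eq_nsmul ℚ]; rfl]

theorem vec_add_single (a b c : ℤ) : ![a, b, c] + Pi.single 0 1 = ![a + 1, b, c] ∧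
    ![a, b, c] + Pi.single 1 1 = ![a, b + 1, c] ∧ ![a, b, c] + Pi.single 2 1 = ![a, b, c + 1] := by
  refine ⟨?_, ?_, ?_⟩ <;> ext i <;> fin_cases i <;> simp

theorem vec_sub_single (a b c : ℤ) : ![a, b, c] - Pi.single 0 1 = ![a - 1, b, c] ∧
    ![a, b, c] - Pi.single 1 1 = ![a, b - 1, c] ∧ ![a, b, c] - Pi.single 2 1 = ![a, b, c - 1] := by
  refine ⟨?_, ?_, ?_⟩ <;> ext i <;> fin_cases i <;> simp

theorem cf_X :
    cf ((X 0 : Poly) • φ) ℓ m k n2 n5 n6 n8 n9 n12 = cf φ ℓ m k (n2 - 1) n5 n6 n8 n9 n12 ∧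
    cf ((X 1 : Poly) • φ) ℓ m k n2 n5 n6 n8 n9 n12 = cf φ ℓ m k n2 (n5 - 1) n6 n8 n9 n12 ∧
    cf ((X 2 : Poly) • φ) ℓ m k n2 n5 n6 n8 n9 n12 = cf φ ℓ m k n2 n5 (n6 - 1) n8 n9 n12 ∧
    cf ((X 3 : Poly) • φ) ℓ m k n2 n5 n6 n8 n9 n12 = cf φ ℓ m k n2 n5 n6 (n8 - 1) n9 n12 ∧
    cf ((X 4 : Poly) • φ) ℓ m k n2 n5 n6 n8 n9 n12 = cf φ ℓ m k n2 n5 n6 n8 (n9 - 1) n12 ∧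
    cf ((X 5 : Poly) • φ) ℓ m k n2 n5 n6 n8 n9 n12 = cf φ ℓ m k n2 n5 n6 n8 n9 (n12 - 1) := by
  refine ⟨?_, ?_, ?_, ?_, ?_, ?_⟩ <;> rw [cf, coeffInt_X] <;> congr 1 <;> ext i <;> fin_cases i <;>
      simp

theorem cf_X_pow (j : ℕ) :
    cf ((X 0 ^ j : Poly) • φ) ℓ m k n2 n5 n6 n8 n9 n12 = cf φ ℓ m k (n2 - j) n5 n6 n8 n9 n12 ∧
    cf ((X 1 ^ j : Poly) • φ) ℓ m k n2 n5 n6 n8 n9 n12 = cf φ ℓ m k n2 (n5 - j) n6 n8 n9 n12 ∧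
    cf ((X 2 ^ j : Poly) • φ) ℓ m k n2 n5 n6 n8 n9 n12 = cf φ ℓ m k n2 n5 (n6 - j) n8 n9 n12 ∧
    cf ((X 3 ^ j : Poly) • φ) ℓ m k n2 n5 n6 n8 n9 n12 = cf φ ℓ m k n2 n5 n6 (n8 - j) n9 n12 ∧
    cf ((X 4 ^ j : Poly) • φ) ℓ m k n2 n5 n6 n8 n9 n12 = cf φ ℓ m k n2 n5 n6 n8 (n9 - j) n12 ∧
    cf ((X 5 ^ j : Poly) • φ) ℓ m k n2 n5 n6 n8 n9 n12 = cf φ ℓ m k n2 n5 n6 n8 n9 (n12 - j) := by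
  induction j generalizing n2 n5 n6 n8 n9 n12 with
  | zero => simp
  | succ j ih =>
    simp only [pow_succ', mul_smul, cf_X, ih, Nat.cast_add, Nat.cast_one, sub_sub, add_comm,
      and_self]

theorem cf_dMu :
    cf (dMu 0 φ) ℓ m k n2 n5 n6 n8 n9 n12 = (n2 + 1) * cf φ ℓ m k (n2 + 1) n5 n6 n8 n9 n12 ∧
    cf (dMu 1 φ) ℓ m k n2 n5 n6 n8 n9 n12 = (n5 + 1) * cf φ ℓ m k n2 (n5 + 1) n6 n8 n9 n12 ∧
    cf (dMu 2 φ) ℓ m k n2 n5 n6 n8 n9 n12 = (n6 + 1) * cf φ ℓ m k n2 n5 (n6 + 1) n8 n9 n12 ∧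
    cf (dMu 3 φ) ℓ m k n2 n5 n6 n8 n9 n12 = (n8 + 1) * cf φ ℓ m k n2 n5 n6 (n8 + 1) n9 n12 ∧
    cf (dMu 4 φ) ℓ m k n2 n5 n6 n8 n9 n12 = (n9 + 1) * cf φ ℓ m k n2 n5 n6 n8 (n9 + 1) n12 ∧
    cf (dMu 5 φ) ℓ m k n2 n5 n6 n8 n9 n12 = (n12 + 1) * cf φ ℓ m k n2 n5 n6 n8 n9 (n12 + 1) := by
  refine ⟨?_, ?_, ?_, ?_, ?_, ?_⟩ <;> rw [cf, coeffInt_dMu] <;> congr 2 <;> ext i <;> fin_cases i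
      <;>
    simp

variable {ℓ m k}

theorem vec_nonneg (hℓ : 0 ≤ ℓ) (hm : 0 ≤ m) (hk : 0 ≤ k) : 0 ≤ ![ℓ, m, k] := by
  intro i
  fin_cases i <;> simpa

theorem cf_dU_dU (hℓ : 0 ≤ ℓ) (hm : 0 ≤ m) (hk : 0 ≤ k) :
    cf (dU 0 (dU 0 φ)) ℓ m k n2 n5 n6 n8 n9 n12 = cf φ (ℓ + 2) m k n2 n5 n6 n8 n9 n12 ∧
    cf (dU 0 (dU 1 φ)) ℓ m k n2 n5 n6 n8 n9 n12 = cf φ (ℓ + 1) (m + 1) k n2 n5 n6 n8 n9 n12 ∧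
    cf (dU 0 (dU 2 φ)) ℓ m k n2 n5 n6 n8 n9 n12 = cf φ (ℓ + 1) m (k + 1) n2 n5 n6 n8 n9 n12 ∧
    cf (dU 1 (dU 0 φ)) ℓ m k n2 n5 n6 n8 n9 n12 = cf φ (ℓ + 1) (m + 1) k n2 n5 n6 n8 n9 n12 ∧
    cf (dU 1 (dU 1 φ)) ℓ m k n2 n5 n6 n8 n9 n12 = cf φ ℓ (m + 2) k n2 n5 n6 n8 n9 n12 ∧
    cf (dU 1 (dU 2 φ)) ℓ m k n2 n5 n6 n8 n9 n12 = cf φ ℓ (m + 1) (k + 1) n2 n5 n6 n8 n9 n12 ∧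
    cf (dU 2 (dU 0 φ)) ℓ m k n2 n5 n6 n8 n9 n12 = cf φ (ℓ + 1) m (k + 1) n2 n5 n6 n8 n9 n12 ∧
    cf (dU 2 (dU 1 φ)) ℓ m k n2 n5 n6 n8 n9 n12 = cf φ ℓ (m + 1) (k + 1) n2 n5 n6 n8 n9 n12 ∧
    cf (dU 2 (dU 2 φ)) ℓ m k n2 n5 n6 n8 n9 n12 = cf φ ℓ m (k + 2) n2 n5 n6 n8 n9 n12 := by
  refine ⟨?_, ?_, ?_, ?_, ?_, ?_, ?_, ?_, ?_⟩ <;> rw [cf, coeffInt_dU_dU _ (vec_nonneg hℓ hm hk)]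
      <;>
    simp only [vec_add_single, cf, add_assoc, one_add_one_eq_two]

theorem cf_mulU_dU (hℓ : 0 ≤ ℓ) (hm : 0 ≤ m) (hk : 0 ≤ k) :
    cf (mulU 0 (dU 0 φ)) ℓ m k n2 n5 n6 n8 n9 n12 = ℓ * cf φ ℓ m k n2 n5 n6 n8 n9 n12 ∧
    cf (mulU 0 (dU 1 φ)) ℓ m k n2 n5 n6 n8 n9 n12 = ℓ * cf φ (ℓ - 1) (m + 1) k n2 n5 n6 n8 n9 n12 ∧
    cf (mulU 0 (dU 2 φ)) ℓ m k n2 n5 n6 n8 n9 n12 = ℓ * cf φ (ℓ - 1) m (k + 1) n2 n5 n6 n8 n9 n12 ∧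
    cf (mulU 1 (dU 0 φ)) ℓ m k n2 n5 n6 n8 n9 n12 = m * cf φ (ℓ + 1) (m - 1) k n2 n5 n6 n8 n9 n12 ∧
    cf (mulU 1 (dU 1 φ)) ℓ m k n2 n5 n6 n8 n9 n12 = m * cf φ ℓ m k n2 n5 n6 n8 n9 n12 ∧
    cf (mulU 1 (dU 2 φ)) ℓ m k n2 n5 n6 n8 n9 n12 = m * cf φ ℓ (m - 1) (k + 1) n2 n5 n6 n8 n9 n12 ∧
    cf (mulU 2 (dU 0 φ)) ℓ m k n2 n5 n6 n8 n9 n12 = k * cf φ (ℓ + 1) m (k - 1) n2 n5 n6 n8 n9 n12 ∧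
    cf (mulU 2 (dU 1 φ)) ℓ m k n2 n5 n6 n8 n9 n12 = k * cf φ ℓ (m + 1) (k - 1) n2 n5 n6 n8 n9 n12 ∧
    cf (mulU 2 (dU 2 φ)) ℓ m k n2 n5 n6 n8 n9 n12 = k * cf φ ℓ m k n2 n5 n6 n8 n9 n12 := by
  refine ⟨?_, ?_, ?_, ?_, ?_, ?_, ?_, ?_, ?_⟩ <;> rw [cf, coeffInt_mulU_dU _ (vec_nonneg hℓ hm hk)]
      <;>
    simp only [vec_add_single, vec_sub_single, cf, sub_add_cancel] <;> rfl

theorem cf_mulU_mulU :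
    cf (mulU 0 (mulU 0 φ)) ℓ m k n2 n5 n6 n8 n9 n12
      = ℓ * (ℓ - 1) * cf φ (ℓ - 2) m k n2 n5 n6 n8 n9 n12 ∧
    cf (mulU 0 (mulU 1 φ)) ℓ m k n2 n5 n6 n8 n9 n12
      = ℓ * m * cf φ (ℓ - 1) (m - 1) k n2 n5 n6 n8 n9 n12 ∧
    cf (mulU 0 (mulU 2 φ)) ℓ m k n2 n5 n6 n8 n9 n12
      = ℓ * k * cf φ (ℓ - 1) m (k - 1) n2 n5 n6 n8 n9 n12 ∧
    cf (mulU 1 (mulU 0 φ)) ℓ m k n2 n5 n6 n8 n9 n12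
      = m * ℓ * cf φ (ℓ - 1) (m - 1) k n2 n5 n6 n8 n9 n12 ∧
    cf (mulU 1 (mulU 1 φ)) ℓ m k n2 n5 n6 n8 n9 n12
      = m * (m - 1) * cf φ ℓ (m - 2) k n2 n5 n6 n8 n9 n12 ∧
    cf (mulU 1 (mulU 2 φ)) ℓ m k n2 n5 n6 n8 n9 n12
      = m * k * cf φ ℓ (m - 1) (k - 1) n2 n5 n6 n8 n9 n12 ∧
    cf (mulU 2 (mulU 0 φ)) ℓ m k n2 n5 n6 n8 n9 n12
      = k * ℓ * cf φ (ℓ - 1) m (k - 1) n2 n5 n6 n8 n9 n12 ∧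
    cf (mulU 2 (mulU 1 φ)) ℓ m k n2 n5 n6 n8 n9 n12
      = k * m * cf φ ℓ (m - 1) (k - 1) n2 n5 n6 n8 n9 n12 ∧
    cf (mulU 2 (mulU 2 φ)) ℓ m k n2 n5 n6 n8 n9 n12
      = k * (k - 1) * cf φ ℓ m (k - 2) n2 n5 n6 n8 n9 n12 := by
  refine ⟨?_, ?_, ?_, ?_, ?_, ?_, ?_, ?_, ?_⟩ <;> rw [cf, coeffInt_mulU_mulU] <;>
    simp only [vec_sub_single, cf, sub_sub, one_add_one_eq_two] <;> simp

end Cf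

/-! ### The operators on Hurwitz coefficients -/

section

variable (φ : Series) {ℓ m k : ℤ} (n2 n5 n6 n8 n9 n12 : ℤ)

/-- `L_0 - H_0` measures the defect from homogeneity: it is diagonal on monomials. -/
theorem cf_heatOp_zero (hℓ : 0 ≤ ℓ) (hm : 0 ≤ m) (hk : 0 ≤ k) :
    cf (heatOp 0 φ) ℓ m k n2 n5 n6 n8 n9 n12
      = (kOf ℓ m n2 n5 n6 n8 n9 n12 - k : ℤ) * cf φ ℓ m k n2 n5 n6 n8 n9 n12 := by
  simp only [heatOp, opL, opH, matV, matAlpha, matBeta, matGamma, logDerivDisc, alpha0, beta0,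
    gamma0, Fin.sum_univ_six, Fin.sum_univ_three, Matrix.trace_fin_three, Matrix.of_apply,
    Matrix.cons_val, Fin.isValue, map_zero, zero_mul, smul_zero, add_zero, zero_add, map_one,
    one_mul, LinearMap.sub_apply, LinearMap.add_apply, LinearMap.smul_apply, Module.End.mul_apply,
    mulPoly_apply, zero_smul, one_smul, add_smul, sub_smul, neg_smul, neg_mul, mul_smul, smul_assoc,
    cf_add, cf_sub, cf_neg, cf_rat_smul, cf_ofNat_smul, cf_zero, cf_X, cf_X_pow,
    cf_dMu, cf_dU_dU φ _ _ _ _ _ _ hℓ hm hk,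
    cf_mulU_dU φ _ _ _ _ _ _ hℓ hm hk, cf_mulU_mulU, Nat.cast_ofNat, sub_add_cancel, kOf]
  push_cast
  ring_nf

/-- In this and the following formulas, the factor on the left clears the denominators. -/
theorem cf_heatOp_3 (hℓ : 0 ≤ ℓ) (hm : 0 ≤ m) (hk : 0 ≤ k) :
    24 * cf (heatOp 1 φ) ℓ m k n2 n5 n6 n8 n9 n12 =
    - (24 : ℤ) * cf φ ℓ (m+1) (k+1) n2 n5 n6 n8 n9 n12
    - (48 * m : ℤ) * cf φ (ℓ+1) (m-1) k n2 n5 n6 n8 n9 n12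
    + (12 * k : ℤ) * cf φ ℓ (m+1) (k-1) (n2-1) n5 n6 n8 n9 n12
    + (120 * (n2+1) : ℤ) * cf φ ℓ m k (n2+1) (n5-1) n6 n8 n9 n12
    + (4 * (n5+1) : ℤ) * cf φ ℓ m k (n2-4) (n5+1) n6 n8 n9 n12
    - (96 * (n5+1) : ℤ) * cf φ ℓ m k (n2-1) (n5+1) (n6-1) n8 n9 n12
    + (192 * (n5+1) : ℤ) * cf φ ℓ m k n2 (n5+1) n6 (n8-1) n9 n12
    - (12 * (n6+1) : ℤ) * cf φ ℓ m k (n2-2) (n5-1) (n6+1) n8 n9 n12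
    + (216 * (n6+1) : ℤ) * cf φ ℓ m k n2 n5 (n6+1) n8 (n9-1) n12
    + (2 * (n8+1) : ℤ) * cf φ ℓ m k (n2-3) (n5-1) n6 (n8+1) n9 n12
    - (12 * (n8+1) : ℤ) * cf φ ℓ m k (n2-1) n5 n6 (n8+1) (n9-1) n12
    - (36 * (n8+1) : ℤ) * cf φ ℓ m k n2 (n5-1) (n6-1) (n8+1) n9 n12
    + (4 * (n9+1) : ℤ) * cf φ ℓ m k (n2-3) n5 (n6-1) n8 (n9+1) n12
    - (8 * (n9+1) : ℤ) * cf φ ℓ m k (n2-2) n5 n6 (n8-1) (n9+1) n12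
    - (4 * (n9+1) : ℤ) * cf φ ℓ m k (n2-1) (n5-2) n6 n8 (n9+1) n12
    - (72 * (n9+1) : ℤ) * cf φ ℓ m k n2 n5 (n6-2) n8 (n9+1) n12
    + (288 * (n9+1) : ℤ) * cf φ ℓ m k n2 n5 n6 n8 (n9+1) (n12-1)
    + (2 * (n12+1) : ℤ) * cf φ ℓ m k (n2-3) n5 n6 n8 (n9-1) (n12+1)
    - (4 * (n12+1) : ℤ) * cf φ ℓ m k (n2-1) (n5-1) n6 (n8-1) n9 (n12+1)
    - (36 * (n12+1) : ℤ) * cf φ ℓ m k n2 n5 (n6-1) n8 (n9-1) (n12+1)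
    + (8 * m : ℤ) * cf φ ℓ (m-1) (k+1) (n2-2) n5 n6 n8 n9 n12
    - (12 * k * (k-1) : ℤ) * cf φ ℓ m (k-2) n2 (n5-1) n6 n8 n9 n12
    - (2 * ℓ : ℤ) * cf φ (ℓ-1) (m+1) k (n2-3) n5 n6 n8 n9 n12
    + (36 * ℓ : ℤ) * cf φ (ℓ-1) (m+1) k n2 n5 (n6-1) n8 n9 n12
    - (4 * m * k : ℤ) * cf φ ℓ (m-1) (k-1) (n2-3) n5 n6 n8 n9 n12
    + (24 * m * k : ℤ) * cf φ ℓ (m-1) (k-1) n2 n5 (n6-1) n8 n9 n12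
    + (4 * ℓ : ℤ) * cf φ (ℓ-1) m (k+1) (n2-1) (n5-1) n6 n8 n9 n12
    - (8 * m * (m-1) : ℤ) * cf φ ℓ (m-2) k (n2-1) (n5-1) n6 n8 n9 n12
    - (24 * ℓ * k : ℤ) * cf φ (ℓ-1) m (k-1) n2 n5 n6 n8 (n9-1) n12
    + (24 * ℓ * m : ℤ) * cf φ (ℓ-1) (m-1) k (n2-1) n5 n6 (n8-1) n9 n12
    - (60 * ℓ * (ℓ-1) : ℤ) * cf φ (ℓ-2) m k n2 (n5-1) n6 (n8-1) n9 n12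
    + (4 * ℓ * (ℓ-1) : ℤ) * cf φ (ℓ-2) m k (n2-2) n5 n6 n8 (n9-1) n12
    - (1 * ℓ * (ℓ-1) : ℤ) * cf φ (ℓ-2) m k (n2-4) (n5-1) n6 n8 n9 n12
    + (20 * ℓ * (ℓ-1) : ℤ) * cf φ (ℓ-2) m k (n2-1) (n5-1) (n6-1) n8 n9 n12 := by
  simp only [heatOp, opL, opH, matV, matAlpha, matBeta, matGamma, logDerivDisc, alpha3, beta3,
    gamma3, Fin.sum_univ_six, Fin.sum_univ_three, Matrix.trace_fin_three, Matrix.of_apply,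
    Matrix.cons_val, Fin.isValue, map_zero, zero_mul, smul_zero, add_zero, zero_add, map_one,
    one_mul, LinearMap.sub_apply, LinearMap.add_apply, LinearMap.smul_apply, Module.End.mul_apply,
    mulPoly_apply, zero_smul, one_smul, add_smul, sub_smul, neg_smul, neg_mul, mul_smul, smul_assoc,
    cf_add, cf_sub, cf_neg, cf_rat_smul, cf_ofNat_smul, cf_zero, cf_X, cf_X_pow,
    cf_dMu, cf_dU_dU φ _ _ _ _ _ _ hℓ hm hk,
    cf_mulU_dU φ _ _ _ _ _ _ hℓ hm hk, cf_mulU_mulU, Nat.cast_ofNat, sub_add_cancel, kOf]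
  push_cast
  ring_nf

theorem cf_heatOp_4 (hℓ : 0 ≤ ℓ) (hm : 0 ≤ m) (hk : 0 ≤ k) :
    24 * cf (heatOp 2 φ) ℓ m k n2 n5 n6 n8 n9 n12 =
    - (12 : ℤ) * cf φ ℓ (m+2) k n2 n5 n6 n8 n9 n12
    - (24 * k : ℤ) * cf φ (ℓ+1) m (k-1) n2 n5 n6 n8 n9 n12
    - (4 : ℤ) * cf φ ℓ m (k+2) (n2-1) n5 n6 n8 n9 n12
    + (144 * (n2+1) : ℤ) * cf φ ℓ m k (n2+1) n5 (n6-1) n8 n9 n12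
    - (12 * n5 - 16 * n6 - 32 * n8 - 32 * n9 - 48 * n12 + 16 * ℓ - 16 : ℤ)
      * cf φ ℓ m k (n2-2) n5 n6 n8 n9 n12
    + (216 * (n5+1) : ℤ) * cf φ ℓ m k n2 (n5+1) n6 n8 (n9-1) n12
    + (80 * (n6+1) : ℤ) * cf φ ℓ m k (n2-1) n5 (n6+1) (n8-1) n9 n12
    + (40 * (n6+1) : ℤ) * cf φ ℓ m k n2 (n5-2) (n6+1) n8 n9 n12
    - (14 * (n8+1) : ℤ) * cf φ ℓ m k (n2-1) (n5-2) n6 (n8+1) n9 n12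
    + (288 * (n8+1) : ℤ) * cf φ ℓ m k n2 n5 n6 (n8+1) n9 (n12-1)
    - (28 * (n9+1) : ℤ) * cf φ ℓ m k (n2-1) (n5-1) (n6-1) n8 (n9+1) n12
    + (104 * (n9+1) : ℤ) * cf φ ℓ m k n2 (n5-1) n6 (n8-1) (n9+1) n12
    - (14 * (n12+1) : ℤ) * cf φ ℓ m k (n2-1) (n5-1) n6 n8 (n9-1) (n12+1)
    + (64 * (n12+1) : ℤ) * cf φ ℓ m k n2 n5 n6 (n8-2) n9 (n12+1)
    - (16 * m : ℤ) * cf φ ℓ (m-1) (k+1) n2 (n5-1) n6 n8 n9 n12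
    - (12 * k * (k-1) : ℤ) * cf φ ℓ m (k-2) n2 n5 (n6-1) n8 n9 n12
    + (14 * ℓ : ℤ) * cf φ (ℓ-1) (m+1) k (n2-1) (n5-1) n6 n8 n9 n12
    + (12 * m * k : ℤ) * cf φ ℓ (m-1) (k-1) (n2-1) (n5-1) n6 n8 n9 n12
    - (40 * ℓ : ℤ) * cf φ (ℓ-1) m (k+1) n2 n5 n6 (n8-1) n9 n12
    - (16 * m * (m-1) : ℤ) * cf φ ℓ (m-2) k (n2-1) n5 (n6-1) n8 n9 n12
    - (16 * m * (m-1) : ℤ) * cf φ ℓ (m-2) k n2 n5 n6 (n8-1) n9 n12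
    + (8 * ℓ * k : ℤ) * cf φ (ℓ-1) m (k-1) (n2-1) n5 n6 (n8-1) n9 n12
    - (16 * ℓ * m : ℤ) * cf φ (ℓ-1) (m-1) k (n2-1) n5 n6 n8 (n9-1) n12
    + (7 * ℓ * (ℓ-1) : ℤ) * cf φ (ℓ-2) m k (n2-2) (n5-2) n6 n8 n9 n12
    - (108 * ℓ * (ℓ-1) : ℤ) * cf φ (ℓ-2) m k (n2-1) n5 n6 n8 n9 (n12-1)
    - (20 * ℓ * (ℓ-1) : ℤ) * cf φ (ℓ-2) m k n2 (n5-1) n6 n8 (n9-1) n12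
    - (44 * ℓ * (ℓ-1) : ℤ) * cf φ (ℓ-2) m k n2 n5 (n6-1) (n8-1) n9 n12 := by
  simp only [heatOp, opL, opH, matV, matAlpha, matBeta, matGamma, logDerivDisc, alpha4, beta4,
    gamma4, Fin.sum_univ_six, Fin.sum_univ_three, Matrix.trace_fin_three, Matrix.of_apply,
    Matrix.cons_val, Fin.isValue, map_zero, zero_mul, smul_zero, add_zero, zero_add, map_one,
    one_mul, LinearMap.sub_apply, LinearMap.add_apply, LinearMap.smul_apply, Module.End.mul_apply,
    mulPoly_apply, zero_smul, one_smul, add_smul, sub_smul, neg_smul, neg_mul, mul_smul, smul_assoc,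
    cf_add, cf_sub, cf_neg, cf_rat_smul, cf_ofNat_smul, cf_zero, cf_X, cf_X_pow,
    cf_dMu, cf_dU_dU φ _ _ _ _ _ _ hℓ hm hk,
    cf_mulU_dU φ _ _ _ _ _ _ hℓ hm hk, cf_mulU_mulU, Nat.cast_ofNat, sub_add_cancel, kOf]
  push_cast
  ring_nf

theorem cf_heatOp_6 (hℓ : 0 ≤ ℓ) (hm : 0 ≤ m) (hk : 0 ≤ k) :
    48 * cf (heatOp 3 φ) ℓ m k n2 n5 n6 n8 n9 n12 =
    - (48 : ℤ) * cf φ (ℓ+1) m (k+1) n2 n5 n6 n8 n9 n12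
    + (12 * k : ℤ) * cf φ ℓ (m+1) (k-1) n2 (n5-1) n6 n8 n9 n12
    + (384 * (n2+1) : ℤ) * cf φ ℓ m k (n2+1) n5 n6 (n8-1) n9 n12
    + (4 * n5 : ℤ) * cf φ ℓ m k (n2-3) n5 n6 n8 n9 n12
    - (24 * (n5+1) : ℤ) * cf φ ℓ m k (n2-1) (n5+1) n6 n8 (n9-1) n12
    + (-72 * n5 + 192 * n8 - 72 * n9 + 288 * n12 - 48 * ℓ + 48 : ℤ)
      * cf φ ℓ m k n2 n5 (n6-1) n8 n9 n12
    + (64 * (n6+1) : ℤ) * cf φ ℓ m k (n2-2) n5 (n6+1) (n8-1) n9 n12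
    - (28 * (n6+1) : ℤ) * cf φ ℓ m k (n2-1) (n5-2) (n6+1) n8 n9 n12
    + (576 * (n6+1) : ℤ) * cf φ ℓ m k n2 n5 (n6+1) n8 n9 (n12-1)
    + (2 * (n8+1) : ℤ) * cf φ ℓ m k (n2-2) (n5-2) n6 (n8+1) n9 n12
    + (288 * (n8+1) : ℤ) * cf φ ℓ m k (n2-1) n5 n6 (n8+1) n9 (n12-1)
    - (168 * (n8+1) : ℤ) * cf φ ℓ m k n2 (n5-1) n6 (n8+1) (n9-1) n12
    + (4 * (n9+1) : ℤ) * cf φ ℓ m k (n2-2) (n5-1) (n6-1) n8 (n9+1) n12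
    + (56 * (n9+1) : ℤ) * cf φ ℓ m k (n2-1) (n5-1) n6 (n8-1) (n9+1) n12
    - (20 * (n9+1) : ℤ) * cf φ ℓ m k n2 (n5-3) n6 n8 (n9+1) n12
    + (2 * (n12+1) : ℤ) * cf φ ℓ m k (n2-2) (n5-1) n6 n8 (n9-1) (n12+1)
    + (64 * (n12+1) : ℤ) * cf φ ℓ m k (n2-1) n5 n6 (n8-2) n9 (n12+1)
    - (20 * (n12+1) : ℤ) * cf φ ℓ m k n2 (n5-2) n6 (n8-1) n9 (n12+1)
    - (108 * (n12+1) : ℤ) * cf φ ℓ m k n2 n5 n6 n8 (n9-2) (n12+1)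
    + (8 * m : ℤ) * cf φ ℓ (m-1) (k+1) (n2-1) (n5-1) n6 n8 n9 n12
    - (48 * k * (k-1) : ℤ) * cf φ ℓ m (k-2) n2 n5 n6 (n8-1) n9 n12
    - (2 * ℓ : ℤ) * cf φ (ℓ-1) (m+1) k (n2-2) (n5-1) n6 n8 n9 n12
    + (60 * ℓ : ℤ) * cf φ (ℓ-1) (m+1) k n2 n5 n6 n8 (n9-1) n12
    - (4 * m * k : ℤ) * cf φ ℓ (m-1) (k-1) (n2-2) (n5-1) n6 n8 n9 n12
    + (24 * m * k : ℤ) * cf φ ℓ (m-1) (k-1) n2 n5 n6 n8 (n9-1) n12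
    - (16 * ℓ : ℤ) * cf φ (ℓ-1) m (k+1) (n2-1) n5 n6 (n8-1) n9 n12
    + (20 * ℓ : ℤ) * cf φ (ℓ-1) m (k+1) n2 (n5-2) n6 n8 n9 n12
    - (64 * m * (m-1) : ℤ) * cf φ ℓ (m-2) k (n2-1) n5 n6 (n8-1) n9 n12
    + (8 * m * (m-1) : ℤ) * cf φ ℓ (m-2) k n2 (n5-2) n6 n8 n9 n12
    - (144 * ℓ * k : ℤ) * cf φ (ℓ-1) m (k-1) n2 n5 n6 n8 n9 (n12-1)
    - (24 * ℓ * m : ℤ) * cf φ (ℓ-1) (m-1) k n2 (n5-1) n6 (n8-1) n9 n12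
    - (1 * ℓ * (ℓ-1) : ℤ) * cf φ (ℓ-2) m k (n2-3) (n5-2) n6 n8 n9 n12
    - (96 * ℓ * (ℓ-1) : ℤ) * cf φ (ℓ-2) m k (n2-2) n5 n6 n8 n9 (n12-1)
    + (58 * ℓ * (ℓ-1) : ℤ) * cf φ (ℓ-2) m k (n2-1) (n5-1) n6 n8 (n9-1) n12
    - (32 * ℓ * (ℓ-1) : ℤ) * cf φ (ℓ-2) m k (n2-1) n5 (n6-1) (n8-1) n9 n12
    + (10 * ℓ * (ℓ-1) : ℤ) * cf φ (ℓ-2) m k n2 (n5-2) (n6-1) n8 n9 n12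
    - (144 * ℓ * (ℓ-1) : ℤ) * cf φ (ℓ-2) m k n2 n5 n6 (n8-2) n9 n12 := by
  simp only [heatOp, opL, opH, matV, matAlpha, matBeta, matGamma, logDerivDisc, alpha6, beta6,
    gamma6, Fin.sum_univ_six, Fin.sum_univ_three, Matrix.trace_fin_three, Matrix.of_apply,
    Matrix.cons_val, Fin.isValue, map_zero, zero_mul, smul_zero, add_zero, zero_add, map_one,
    one_mul, LinearMap.sub_apply, LinearMap.add_apply, LinearMap.smul_apply, Module.End.mul_apply,
    mulPoly_apply, zero_smul, one_smul, add_smul, sub_smul, neg_smul, neg_mul, mul_smul, smul_assoc,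
    cf_add, cf_sub, cf_neg, cf_rat_smul, cf_ofNat_smul, cf_zero, cf_X, cf_X_pow,
    cf_dMu, cf_dU_dU φ _ _ _ _ _ _ hℓ hm hk,
    cf_mulU_dU φ _ _ _ _ _ _ hℓ hm hk, cf_mulU_mulU, Nat.cast_ofNat, sub_add_cancel, kOf]
  push_cast
  ring_nf

theorem cf_heatOp_7 (hℓ : 0 ≤ ℓ) (hm : 0 ≤ m) (hk : 0 ≤ k) :
    48 * cf (heatOp 4 φ) ℓ m k n2 n5 n6 n8 n9 n12 =
    - (48 : ℤ) * cf φ (ℓ+1) (m+1) k n2 n5 n6 n8 n9 n12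
    - (8 : ℤ) * cf φ ℓ m (k+2) n2 (n5-1) n6 n8 n9 n12
    + (24 * k : ℤ) * cf φ ℓ (m+1) (k-1) n2 n5 (n6-1) n8 n9 n12
    + (432 * (n2+1) : ℤ) * cf φ ℓ m k (n2+1) n5 n6 n8 (n9-1) n12
    + (8 * (n5+1) : ℤ) * cf φ ℓ m k (n2-3) (n5+1) (n6-1) n8 n9 n12
    - (16 * (n5+1) : ℤ) * cf φ ℓ m k (n2-2) (n5+1) n6 (n8-1) n9 n12
    + (-8 * (n5-1) - 56 * n6 + 56 * n8 + 80 * n9 + 144 * n12 - 32 * ℓ + 32 : ℤ)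
      * cf φ ℓ m k (n2-1) (n5-1) n6 n8 n9 n12
    - (144 * (n5+1) : ℤ) * cf φ ℓ m k n2 (n5+1) (n6-2) n8 n9 n12
    + (576 * (n5+1) : ℤ) * cf φ ℓ m k n2 (n5+1) n6 n8 n9 (n12-1)
    + (64 * (n6+1) : ℤ) * cf φ ℓ m k (n2-2) n5 (n6+1) n8 (n9-1) n12
    + (208 * (n6+1) : ℤ) * cf φ ℓ m k n2 (n5-1) (n6+1) (n8-1) n9 n12
    + (4 * (n8+1) : ℤ) * cf φ ℓ m k (n2-2) (n5-1) (n6-1) (n8+1) n9 n12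
    - (20 * (n8+1) : ℤ) * cf φ ℓ m k n2 (n5-3) n6 (n8+1) n9 n12
    - (72 * (n8+1) : ℤ) * cf φ ℓ m k n2 n5 (n6-1) (n8+1) (n9-1) n12
    + (8 * (n9+1) : ℤ) * cf φ ℓ m k (n2-2) n5 (n6-2) n8 (n9+1) n12
    + (96 * (n9+1) : ℤ) * cf φ ℓ m k (n2-2) n5 n6 n8 (n9+1) (n12-1)
    - (128 * (n9+1) : ℤ) * cf φ ℓ m k (n2-1) n5 (n6-1) (n8-1) (n9+1) n12
    - (64 * (n9+1) : ℤ) * cf φ ℓ m k n2 (n5-2) (n6-1) n8 (n9+1) n12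
    + (128 * (n9+1) : ℤ) * cf φ ℓ m k n2 n5 n6 (n8-2) (n9+1) n12
    + (4 * (n12+1) : ℤ) * cf φ ℓ m k (n2-2) n5 (n6-1) n8 (n9-1) (n12+1)
    - (40 * (n12+1) : ℤ) * cf φ ℓ m k (n2-1) n5 n6 (n8-1) (n9-1) (n12+1)
    - (20 * (n12+1) : ℤ) * cf φ ℓ m k n2 (n5-2) n6 n8 (n9-1) (n12+1)
    - (24 * (n12+1) : ℤ) * cf φ ℓ m k n2 (n5-1) (n6-1) (n8-1) n9 (n12+1)
    + (16 * m : ℤ) * cf φ ℓ (m-1) (k+1) (n2-1) n5 (n6-1) n8 n9 n12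
    - (32 * m : ℤ) * cf φ ℓ (m-1) (k+1) n2 n5 n6 (n8-1) n9 n12
    - (48 * k * (k-1) : ℤ) * cf φ ℓ m (k-2) n2 n5 n6 n8 (n9-1) n12
    - (4 * ℓ : ℤ) * cf φ (ℓ-1) (m+1) k (n2-2) n5 (n6-1) n8 n9 n12
    + (56 * ℓ : ℤ) * cf φ (ℓ-1) (m+1) k (n2-1) n5 n6 (n8-1) n9 n12
    + (20 * ℓ : ℤ) * cf φ (ℓ-1) (m+1) k n2 (n5-2) n6 n8 n9 n12
    + (8 * m * k : ℤ) * cf φ ℓ (m-1) (k-1) n2 (n5-2) n6 n8 n9 n12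
    - (8 * m * k : ℤ) * cf φ ℓ (m-1) (k-1) (n2-2) n5 (n6-1) n8 n9 n12
    + (16 * m * k : ℤ) * cf φ ℓ (m-1) (k-1) (n2-1) n5 n6 (n8-1) n9 n12
    - (16 * ℓ : ℤ) * cf φ (ℓ-1) m (k+1) (n2-1) n5 n6 n8 (n9-1) n12
    + (24 * ℓ : ℤ) * cf φ (ℓ-1) m (k+1) n2 (n5-1) (n6-1) n8 n9 n12
    - (64 * m * (m-1) : ℤ) * cf φ ℓ (m-2) k (n2-1) n5 n6 n8 (n9-1) n12
    + (16 * m * (m-1) : ℤ) * cf φ ℓ (m-2) k n2 (n5-1) (n6-1) n8 n9 n12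
    - (32 * ℓ * k : ℤ) * cf φ (ℓ-1) m (k-1) n2 (n5-1) n6 (n8-1) n9 n12
    - (96 * ℓ * m : ℤ) * cf φ (ℓ-1) (m-1) k (n2-1) n5 n6 n8 n9 (n12-1)
    - (32 * ℓ * m : ℤ) * cf φ (ℓ-1) (m-1) k n2 (n5-1) n6 n8 (n9-1) n12
    + (48 * ℓ * m : ℤ) * cf φ (ℓ-1) (m-1) k n2 n5 (n6-1) (n8-1) n9 n12
    + (10 * ℓ * (ℓ-1) : ℤ) * cf φ (ℓ-2) m k (n2-1) (n5-3) n6 n8 n9 n12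
    + (12 * ℓ * (ℓ-1) : ℤ) * cf φ (ℓ-2) m k n2 (n5-1) (n6-2) n8 n9 n12
    - (120 * ℓ * (ℓ-1) : ℤ) * cf φ (ℓ-2) m k n2 (n5-1) n6 n8 n9 (n12-1)
    - (112 * ℓ * (ℓ-1) : ℤ) * cf φ (ℓ-2) m k n2 n5 n6 (n8-1) (n9-1) n12
    - (2 * ℓ * (ℓ-1) : ℤ) * cf φ (ℓ-2) m k (n2-3) (n5-1) (n6-1) n8 n9 n12
    + (4 * ℓ * (ℓ-1) : ℤ) * cf φ (ℓ-2) m k (n2-2) (n5-1) n6 (n8-1) n9 n12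
    + (24 * ℓ * (ℓ-1) : ℤ) * cf φ (ℓ-2) m k (n2-1) n5 (n6-1) n8 (n9-1) n12 := by
  simp only [heatOp, opL, opH, matV, matAlpha, matBeta, matGamma, logDerivDisc, alpha7, beta7,
    gamma7, Fin.sum_univ_six, Fin.sum_univ_three, Matrix.trace_fin_three, Matrix.of_apply,
    Matrix.cons_val, Fin.isValue, map_zero, zero_mul, smul_zero, add_zero, zero_add, map_one,
    one_mul, LinearMap.sub_apply, LinearMap.add_apply, LinearMap.smul_apply, Module.End.mul_apply,
    mulPoly_apply, zero_smul, one_smul, add_smul, sub_smul, neg_smul, neg_mul, mul_smul, smul_assoc,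
    cf_add, cf_sub, cf_neg, cf_rat_smul, cf_ofNat_smul, cf_zero, cf_X, cf_X_pow,
    cf_dMu, cf_dU_dU φ _ _ _ _ _ _ hℓ hm hk,
    cf_mulU_dU φ _ _ _ _ _ _ hℓ hm hk, cf_mulU_mulU, Nat.cast_ofNat, sub_add_cancel, kOf]
  push_cast
  ring_nf

theorem cf_heatOp_10 (hℓ : 0 ≤ ℓ) (hm : 0 ≤ m) (hk : 0 ≤ k) :
    48 * cf (heatOp 5 φ) ℓ m k n2 n5 n6 n8 n9 n12 =
    - (24 : ℤ) * cf φ (ℓ+2) m k n2 n5 n6 n8 n9 n12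
    - (8 : ℤ) * cf φ ℓ m (k+2) n2 n5 n6 (n8-1) n9 n12
    + (12 * k : ℤ) * cf φ ℓ (m+1) (k-1) n2 n5 n6 n8 (n9-1) n12
    + (576 * (n2+1) : ℤ) * cf φ ℓ m k (n2+1) n5 n6 n8 n9 (n12-1)
    + (4 * (n5+1) : ℤ) * cf φ ℓ m k (n2-3) (n5+1) n6 n8 (n9-1) n12
    + (-8 * n5 + 64 * (n8-1) - 40 * n9 + 96 * n12 + 16 * ℓ + 32 : ℤ)
      * cf φ ℓ m k (n2-1) n5 n6 (n8-1) n9 n12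
    - (72 * (n5+1) : ℤ) * cf φ ℓ m k n2 (n5+1) (n6-1) n8 (n9-1) n12
    + (96 * (n6+1) : ℤ) * cf φ ℓ m k (n2-2) n5 (n6+1) n8 n9 (n12-1)
    - (28 * (n6+1) : ℤ) * cf φ ℓ m k (n2-1) (n5-1) (n6+1) n8 (n9-1) n12
    + (128 * (n6+1) : ℤ) * cf φ ℓ m k n2 n5 (n6+1) (n8-2) n9 n12
    + (2 * (n8+1) : ℤ) * cf φ ℓ m k (n2-2) (n5-1) n6 (n8+1) (n9-1) n12
    + (-20 * n8 - 20 * n9 + 48 * n12 + 6 : ℤ) * cf φ ℓ m k n2 (n5-2) n6 n8 n9 n12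
    + (288 * (n8+1) : ℤ) * cf φ ℓ m k n2 n5 (n6-1) (n8+1) n9 (n12-1)
    - (108 * (n8+1) : ℤ) * cf φ ℓ m k n2 n5 n6 (n8+1) (n9-2) n12
    + (4 * n9 : ℤ) * cf φ ℓ m k (n2-2) n5 (n6-1) n8 n9 n12
    + (144 * (n9+1) : ℤ) * cf φ ℓ m k (n2-1) (n5-1) n6 n8 (n9+1) (n12-1)
    - (24 * (n9+1) : ℤ) * cf φ ℓ m k n2 (n5-1) (n6-1) (n8-1) (n9+1) n12
    + (2 * (n12+1) : ℤ) * cf φ ℓ m k (n2-2) n5 n6 n8 (n9-2) (n12+1)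
    - (88 * (n12+1) : ℤ) * cf φ ℓ m k n2 (n5-1) n6 (n8-1) (n9-1) (n12+1)
    + (64 * (n12+1) : ℤ) * cf φ ℓ m k n2 n5 (n6-1) (n8-2) n9 (n12+1)
    + (8 * m : ℤ) * cf φ ℓ (m-1) (k+1) (n2-1) n5 n6 n8 (n9-1) n12
    - (72 * k * (k-1) : ℤ) * cf φ ℓ m (k-2) n2 n5 n6 n8 n9 (n12-1)
    - (2 * ℓ : ℤ) * cf φ (ℓ-1) (m+1) k (n2-2) n5 n6 n8 (n9-1) n12
    + (20 * ℓ : ℤ) * cf φ (ℓ-1) (m+1) k n2 (n5-1) n6 (n8-1) n9 n12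
    + (8 * m * k : ℤ) * cf φ ℓ (m-1) (k-1) n2 (n5-1) n6 (n8-1) n9 n12
    - (4 * m * k : ℤ) * cf φ ℓ (m-1) (k-1) (n2-2) n5 n6 n8 (n9-1) n12
    - (48 * ℓ : ℤ) * cf φ (ℓ-1) m (k+1) (n2-1) n5 n6 n8 n9 (n12-1)
    + (20 * ℓ : ℤ) * cf φ (ℓ-1) m (k+1) n2 (n5-1) n6 n8 (n9-1) n12
    - (16 * ℓ : ℤ) * cf φ (ℓ-1) m (k+1) n2 n5 (n6-1) (n8-1) n9 n12
    - (96 * m * (m-1) : ℤ) * cf φ ℓ (m-2) k (n2-1) n5 n6 n8 n9 (n12-1)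
    + (8 * m * (m-1) : ℤ) * cf φ ℓ (m-2) k n2 (n5-1) n6 n8 (n9-1) n12
    - (32 * ℓ * k : ℤ) * cf φ (ℓ-1) m (k-1) n2 n5 n6 (n8-2) n9 n12
    - (96 * ℓ * m : ℤ) * cf φ (ℓ-1) (m-1) k n2 (n5-1) n6 n8 n9 (n12-1)
    + (40 * ℓ * m : ℤ) * cf φ (ℓ-1) (m-1) k n2 n5 n6 (n8-1) (n9-1) n12
    - (1 * ℓ * (ℓ-1) : ℤ) * cf φ (ℓ-2) m k (n2-3) (n5-1) n6 n8 (n9-1) n12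
    - (24 * ℓ * (ℓ-1) : ℤ) * cf φ (ℓ-2) m k (n2-2) n5 n6 (n8-2) n9 n12
    + (10 * ℓ * (ℓ-1) : ℤ) * cf φ (ℓ-2) m k (n2-1) (n5-2) n6 (n8-1) n9 n12
    - (72 * ℓ * (ℓ-1) : ℤ) * cf φ (ℓ-2) m k (n2-1) n5 (n6-1) n8 n9 (n12-1)
    + (28 * ℓ * (ℓ-1) : ℤ) * cf φ (ℓ-2) m k (n2-1) n5 n6 n8 (n9-2) n12
    + (10 * ℓ * (ℓ-1) : ℤ) * cf φ (ℓ-2) m k n2 (n5-1) (n6-1) n8 (n9-1) n12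
    - (8 * ℓ * (ℓ-1) : ℤ) * cf φ (ℓ-2) m k n2 n5 (n6-2) (n8-1) n9 n12
    - (216 * ℓ * (ℓ-1) : ℤ) * cf φ (ℓ-2) m k n2 n5 n6 (n8-1) n9 (n12-1) := by
  simp only [heatOp, opL, opH, matV, matAlpha, matBeta, matGamma, logDerivDisc, alpha10, beta10,
    gamma10, Fin.sum_univ_six, Fin.sum_univ_three, Matrix.trace_fin_three, Matrix.of_apply,
    Matrix.cons_val, Fin.isValue, map_zero, zero_mul, smul_zero, add_zero, zero_add, map_one,
    one_mul, LinearMap.sub_apply, LinearMap.add_apply, LinearMap.smul_apply, Module.End.mul_apply,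
    mulPoly_apply, zero_smul, one_smul, add_smul, sub_smul, neg_smul, neg_mul, mul_smul, smul_assoc,
    cf_add, cf_sub, cf_neg, cf_rat_smul, cf_ofNat_smul, cf_zero, cf_X, cf_X_pow,
    cf_dMu, cf_dU_dU φ _ _ _ _ _ _ hℓ hm hk,
    cf_mulU_dU φ _ _ _ _ _ _ hℓ hm hk, cf_mulU_mulU, Nat.cast_ofNat, sub_add_cancel, kOf]
  push_cast
  ring_nf

end

/-! ### Series with given Hurwitz coefficients -/

theorem coeffNat_eq_cf (φ : Series) (e : Fin 3 →₀ ℕ) (n : Fin 6 →₀ ℕ) :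
    cf φ (e 0) (e 1) (e 2) (n 0) (n 1) (n 2) (n 3) (n 4) (n 5) = coeffNat φ e n := by
  have h1 : natPart ![(e 0 : ℤ), e 1, e 2] = e := by
    ext i
    fin_cases i <;> rfl
  have h2 : natPart ![(n 0 : ℤ), n 1, n 2, n 3, n 4, n 5] = n := by
    ext i
    fin_cases i <;> rfl
  rw [cf, coeffInt, if_pos, h1, h2]
  constructor <;> intro i <;> fin_cases i <;> exact Int.natCast_nonneg _

theorem series_ext {φ ψ : Series} (h : ∀ ℓ m k n2 n5 n6 n8 n9 n12 : ℤ,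
    0 ≤ ℓ → 0 ≤ m → 0 ≤ k → 0 ≤ n2 → 0 ≤ n5 → 0 ≤ n6 → 0 ≤ n8 → 0 ≤ n9 → 0 ≤ n12 →
    cf φ ℓ m k n2 n5 n6 n8 n9 n12 = cf ψ ℓ m k n2 n5 n6 n8 n9 n12) : φ = ψ := by
  ext e : 1
  apply MvPolynomial.ext
  intro n
  have := h (e 0) (e 1) (e 2) (n 0) (n 1) (n 2) (n 3) (n 4) (n 5) (by simp) (by simp) (by simp)
    (by simp) (by simp) (by simp) (by simp) (by simp) (by simp)
  rw [coeffNat_eq_cf, coeffNat_eq_cf, coeffNat, coeffNat] at this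
  exact mul_left_cancel₀ (Nat.cast_ne_zero.2 (Finset.prod_ne_zero_iff.2 fun i _ =>
    Nat.factorial_ne_zero _)) this

theorem cf_of_neg (φ : Series) {ℓ m k n2 n5 n6 n8 n9 n12 : ℤ}
    (h : ¬ (0 ≤ ℓ ∧ 0 ≤ m ∧ 0 ≤ k ∧ 0 ≤ n2 ∧ 0 ≤ n5 ∧ 0 ≤ n6 ∧ 0 ≤ n8 ∧ 0 ≤ n9 ∧ 0 ≤ n12)) :
    cf φ ℓ m k n2 n5 n6 n8 n9 n12 = 0 := by
  refine if_neg fun ⟨hz, hw⟩ => h ?_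
  exact ⟨hz 0, hz 1, hz 2, hw 0, hw 1, hw 2, hw 3, hw 4, hw 5⟩

theorem cf_eq_zero_of_nonneg {φ : Series} {ℓ m k n2 n5 n6 n8 n9 n12 : ℤ}
    (h : 0 ≤ ℓ → 0 ≤ m → 0 ≤ k → 0 ≤ n2 → 0 ≤ n5 → 0 ≤ n6 → 0 ≤ n8 → 0 ≤ n9 → 0 ≤ n12 →
      cf φ ℓ m k n2 n5 n6 n8 n9 n12 = 0) : cf φ ℓ m k n2 n5 n6 n8 n9 n12 = 0 := by
  by_contra h0
  refine h0 (cf_of_neg φ fun H => h0 ?_)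
  obtain ⟨h1, h2, h3, h4, h5, h6, h7, h8, h9⟩ := H
  exact h h1 h2 h3 h4 h5 h6 h7 h8 h9

theorem cf_hurwitzSeries {b : HCoeff} (hb : Supported b) (ℓ m k n2 n5 n6 n8 n9 n12 : ℤ) :
    cf (hurwitzSeries b) ℓ m k n2 n5 n6 n8 n9 n12
      = if k = kOf ℓ m n2 n5 n6 n8 n9 n12 then b ℓ m n2 n5 n6 n8 n9 n12 else 0 := by
  by_cases h : 0 ≤ ℓ ∧ 0 ≤ m ∧ 0 ≤ k ∧ 0 ≤ n2 ∧ 0 ≤ n5 ∧ 0 ≤ n6 ∧ 0 ≤ n8 ∧ 0 ≤ n9 ∧ 0 ≤ n12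
  · obtain ⟨h1, h2, h3, h4, h5, h6, h7, h8, h9⟩ := h
    lift ℓ to ℕ using h1
    lift m to ℕ using h2
    lift k to ℕ using h3
    lift n2 to ℕ using h4
    lift n5 to ℕ using h5
    lift n6 to ℕ using h6
    lift n8 to ℕ using h7
    lift n9 to ℕ using h8
    lift n12 to ℕ using h9
    have h := coeffNat_eq_cf (hurwitzSeries b) (Finsupp.equivFunOnFinite.symm ![ℓ, m, k])
      (Finsupp.equivFunOnFinite.symm ![n2, n5, n6, n8, n9, n12])
    rw [coeffNat, coeff_hurwitzSeries] at h
    simp only [Finsupp.equivFunOnFinite_symm_apply_apply, Matrix.cons_val, Fin.prod_univ_three] at h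
    rw [h, mul_ite, mul_zero]
    refine if_congr Iff.rfl ?_ rfl
    push_cast
    field_simp
  · rw [cf_of_neg _ h]
    split_ifs with hk
    · rw [hb]
      intro H
      apply h
      obtain ⟨h1, h2, h4, h5, h6, h7, h8, h9, h3⟩ := H
      exact ⟨h1, h2, hk ▸ h3, h4, h5, h6, h7, h8, h9⟩
    · rfl

theorem cf_hurwitzSeries_of_eq {b : HCoeff} (hb : Supported b) {ℓ m k n2 n5 n6 n8 n9 n12 : ℤ}
    (h : k = kOf ℓ m n2 n5 n6 n8 n9 n12) :
    cf (hurwitzSeries b) ℓ m k n2 n5 n6 n8 n9 n12 = b ℓ m n2 n5 n6 n8 n9 n12 := by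
  rw [cf_hurwitzSeries hb, if_pos h]

theorem cf_hurwitzSeries_of_ne {b : HCoeff} (hb : Supported b) {ℓ m k n2 n5 n6 n8 n9 n12 : ℤ}
    (h : k ≠ kOf ℓ m n2 n5 n6 n8 n9 n12) :
    cf (hurwitzSeries b) ℓ m k n2 n5 n6 n8 n9 n12 = 0 := by
  rw [cf_hurwitzSeries hb, if_neg h]

/-- The equation `(L_0 - H_0) φ = 0` forces the exponent of `u_1` to be the one that homogeneity
prescribes. -/
theorem heatOp_zero_eq_zero_iff (φ : Series) :
    heatOp 0 φ = 0 ↔ ∃ b, Supported b ∧ φ = hurwitzSeries b := by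
  constructor
  · intro h
    have hb : Supported fun ℓ m n2 n5 n6 n8 n9 n12 =>
        cf φ ℓ m (kOf ℓ m n2 n5 n6 n8 n9 n12) n2 n5 n6 n8 n9 n12 := by
      intro ℓ m n2 n5 n6 n8 n9 n12 H
      refine cf_of_neg _ fun H' => H ?_
      obtain ⟨h1, h2, h3, h4, h5, h6, h7, h8, h9⟩ := H'
      exact ⟨h1, h2, h4, h5, h6, h7, h8, h9, h3⟩
    refine ⟨_, hb, series_ext ?_⟩
    intro ℓ m k n2 n5 n6 n8 n9 n12 hℓ hm hk _ _ _ _ _ _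
    have h0 := cf_heatOp_zero φ n2 n5 n6 n8 n9 n12 hℓ hm hk
    rw [h, cf_zero, eq_comm, mul_eq_zero, Int.cast_eq_zero, sub_eq_zero] at h0
    rw [cf_hurwitzSeries hb]
    split_ifs with hk'
    · rw [hk']
    · exact h0.resolve_left (Ne.symm hk')
  · rintro ⟨b, hb, rfl⟩
    refine series_ext ?_
    intro ℓ m k n2 n5 n6 n8 n9 n12 hℓ hm hk _ _ _ _ _ _
    rw [cf_heatOp_zero _ _ _ _ _ _ _ hℓ hm hk, cf_zero, cf_hurwitzSeries hb, mul_ite, mul_zero]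
    split_ifs with hk'
    · rw [hk', sub_self, Int.cast_zero, zero_mul]
    · rfl

/-! ### The recurrences -/

section

variable {b : HCoeff} {ℓ m k : ℤ} (n2 n5 n6 n8 n9 n12 : ℤ)

theorem cf_heatOp_3_hurwitzSeries (hb : Supported b) (hℓ : 0 ≤ ℓ) (hm : 0 ≤ m) (hk : 0 ≤ k) :
    24 * cf (heatOp 1 (hurwitzSeries b)) ℓ m k n2 n5 n6 n8 n9 n12
      = if k = kOf ℓ m n2 n5 n6 n8 n9 n12 - 3 then
      -24 * b ℓ (m+1) n2 n5 n6 n8 n9 n12 - 48 * m * b (ℓ+1) (m-1) n2 n5 n6 n8 n9 n12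
        + rhs3 b ℓ m n2 n5 n6 n8 n9 n12 else 0 := by
  rw [cf_heatOp_3 _ _ _ _ _ _ _ hℓ hm hk]
  split_ifs with h
  · subst h
    simp (disch := (unfold kOf; omega)) only [cf_hurwitzSeries_of_eq hb]
    unfold rhs3 low3
    push_cast
    ring
  · unfold kOf at h
    simp (disch := (unfold kOf; omega)) only [cf_hurwitzSeries_of_ne hb, mul_zero, add_zero,
      sub_zero, neg_zero, sub_self]

theorem cf_heatOp_4_hurwitzSeries (hb : Supported b) (hℓ : 0 ≤ ℓ) (hm : 0 ≤ m) (hk : 0 ≤ k) :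
    24 * cf (heatOp 2 (hurwitzSeries b)) ℓ m k n2 n5 n6 n8 n9 n12
      = if k = kOf ℓ m n2 n5 n6 n8 n9 n12 - 4 then
      -12 * b ℓ (m+2) n2 n5 n6 n8 n9 n12
        - 24 * (kOf ℓ m n2 n5 n6 n8 n9 n12 - 4) * b (ℓ+1) m n2 n5 n6 n8 n9 n12
        - rhs4 b ℓ m n2 n5 n6 n8 n9 n12 else 0 := by
  rw [cf_heatOp_4 _ _ _ _ _ _ _ hℓ hm hk]
  split_ifs with h
  · subst h
    simp (disch := (unfold kOf; omega)) only [cf_hurwitzSeries_of_eq hb]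
    unfold rhs4 low4
    push_cast
    ring
  · unfold kOf at h
    simp (disch := (unfold kOf; omega)) only [cf_hurwitzSeries_of_ne hb, mul_zero, add_zero,
      sub_zero, neg_zero, sub_self]

theorem cf_heatOp_6_hurwitzSeries (hb : Supported b) (hℓ : 0 ≤ ℓ) (hm : 0 ≤ m) (hk : 0 ≤ k) :
    48 * cf (heatOp 3 (hurwitzSeries b)) ℓ m k n2 n5 n6 n8 n9 n12
      = if k = kOf ℓ m n2 n5 n6 n8 n9 n12 - 6 then
      -48 * b (ℓ+1) m n2 n5 n6 n8 n9 n12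
        + rhs6 b ℓ m n2 n5 n6 n8 n9 n12 else 0 := by
  rw [cf_heatOp_6 _ _ _ _ _ _ _ hℓ hm hk]
  split_ifs with h
  · subst h
    simp (disch := (unfold kOf; omega)) only [cf_hurwitzSeries_of_eq hb]
    unfold rhs6
    push_cast
    ring
  · unfold kOf at h
    simp (disch := (unfold kOf; omega)) only [cf_hurwitzSeries_of_ne hb, mul_zero, add_zero,
      sub_zero, neg_zero, sub_self]

theorem cf_heatOp_7_hurwitzSeries (hb : Supported b) (hℓ : 0 ≤ ℓ) (hm : 0 ≤ m) (hk : 0 ≤ k) :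
    48 * cf (heatOp 4 (hurwitzSeries b)) ℓ m k n2 n5 n6 n8 n9 n12
      = if k = kOf ℓ m n2 n5 n6 n8 n9 n12 - 7 then
      -48 * b (ℓ+1) (m+1) n2 n5 n6 n8 n9 n12
        + rhs7 b ℓ m n2 n5 n6 n8 n9 n12 else 0 := by
  rw [cf_heatOp_7 _ _ _ _ _ _ _ hℓ hm hk]
  split_ifs with h
  · subst h
    simp (disch := (unfold kOf; omega)) only [cf_hurwitzSeries_of_eq hb]
    unfold rhs7
    push_cast
    ring
  · unfold kOf at h
    simp (disch := (unfold kOf; omega)) only [cf_hurwitzSeries_of_ne hb, mul_zero, add_zero,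
      sub_zero, neg_zero, sub_self]

theorem cf_heatOp_10_hurwitzSeries (hb : Supported b) (hℓ : 0 ≤ ℓ) (hm : 0 ≤ m) (hk : 0 ≤ k) :
    48 * cf (heatOp 5 (hurwitzSeries b)) ℓ m k n2 n5 n6 n8 n9 n12
      = if k = kOf ℓ m n2 n5 n6 n8 n9 n12 - 10 then
      -24 * b (ℓ+2) m n2 n5 n6 n8 n9 n12
        + rhs10 b ℓ m n2 n5 n6 n8 n9 n12 else 0 := by
  rw [cf_heatOp_10 _ _ _ _ _ _ _ hℓ hm hk]
  split_ifs with h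
  · subst h
    simp (disch := (unfold kOf; omega)) only [cf_hurwitzSeries_of_eq hb]
    unfold rhs10
    push_cast
    ring
  · unfold kOf at h
    simp (disch := (unfold kOf; omega)) only [cf_hurwitzSeries_of_ne hb, mul_zero, add_zero,
      sub_zero, neg_zero, sub_self]

end

/-- A series with coefficients `r / a` in the degrees prescribed by homogeneity, shifted by `j`, is
zero if and only if the numbers `r` are. -/
theorem eq_zero_iff_of_cf {ψ : Series} {r : HCoeff} {a : ℚ} {j : ℤ} (ha : a ≠ 0)
    (h : ∀ ℓ m k n2 n5 n6 n8 n9 n12 : ℤ, 0 ≤ ℓ → 0 ≤ m → 0 ≤ k →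
      a * cf ψ ℓ m k n2 n5 n6 n8 n9 n12
        = if k = kOf ℓ m n2 n5 n6 n8 n9 n12 - j then r ℓ m n2 n5 n6 n8 n9 n12 else 0) :
    ψ = 0 ↔ ∀ ℓ m n2 n5 n6 n8 n9 n12 : ℤ, InRange j ℓ m n2 n5 n6 n8 n9 n12 →
      r ℓ m n2 n5 n6 n8 n9 n12 = 0 := by
  constructor
  · rintro rfl ℓ m n2 n5 n6 n8 n9 n12 ⟨h1, h2, h3, h4, h5, h6, h7, h8, h9⟩
    have := h ℓ m _ n2 n5 n6 n8 n9 n12 h1 h2 (sub_nonneg.2 h9)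
    rwa [cf_zero, mul_zero, if_pos rfl, eq_comm] at this
  · intro H
    refine series_ext fun ℓ m k n2 n5 n6 n8 n9 n12 hℓ hm hk h3 h4 h5 h6 h7 h8 => ?_
    rw [cf_zero]
    refine (mul_eq_zero.1 ?_).resolve_left ha
    rw [h ℓ m k n2 n5 n6 n8 n9 n12 hℓ hm hk]
    split_ifs with hk'
    · exact H ℓ m n2 n5 n6 n8 n9 n12 ⟨hℓ, hm, h3, h4, h5, h6, h7, h8, by omega⟩
    · rfl

theorem homogeneous_of_cf {ψ : Series} {r : HCoeff} {a : ℚ} {j : ℤ} (ha : a ≠ 0)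
    (h : ∀ ℓ m k n2 n5 n6 n8 n9 n12 : ℤ, 0 ≤ ℓ → 0 ≤ m → 0 ≤ k →
      a * cf ψ ℓ m k n2 n5 n6 n8 n9 n12
        = if k = kOf ℓ m n2 n5 n6 n8 n9 n12 - j then r ℓ m n2 n5 n6 n8 n9 n12 else 0)
    {ℓ m k n2 n5 n6 n8 n9 n12 : ℤ} (h0 : cf ψ ℓ m k n2 n5 n6 n8 n9 n12 ≠ 0) :
    k = kOf ℓ m n2 n5 n6 n8 n9 n12 - j := by
  by_contra hk
  refine h0 (cf_eq_zero_of_nonneg fun h1 h2 h3 _ _ _ _ _ _ => (mul_eq_zero.1 ?_).resolve_left ha)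
  rw [h ℓ m k n2 n5 n6 n8 n9 n12 h1 h2 h3, if_neg hk]

theorem heatOp_3_hurwitzSeries {b : HCoeff} (hb : Supported b) :
    heatOp 1 (hurwitzSeries b) = 0 ↔ R3 b := by
  rw [eq_zero_iff_of_cf (by norm_num) fun ℓ m k n2 n5 n6 n8 n9 n12 h1 h2 h3 =>
    cf_heatOp_3_hurwitzSeries n2 n5 n6 n8 n9 n12 hb h1 h2 h3]
  constructor <;> intro H ℓ m n2 n5 n6 n8 n9 n12 hr <;> linarith [H ℓ m n2 n5 n6 n8 n9 n12 hr]

theorem heatOp_4_hurwitzSeries {b : HCoeff} (hb : Supported b) :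
    heatOp 2 (hurwitzSeries b) = 0 ↔ R4 b := by
  rw [eq_zero_iff_of_cf (by norm_num) fun ℓ m k n2 n5 n6 n8 n9 n12 h1 h2 h3 =>
    cf_heatOp_4_hurwitzSeries n2 n5 n6 n8 n9 n12 hb h1 h2 h3]
  constructor <;> intro H ℓ m n2 n5 n6 n8 n9 n12 hr <;> linarith [H ℓ m n2 n5 n6 n8 n9 n12 hr]

theorem heatOp_6_hurwitzSeries {b : HCoeff} (hb : Supported b) :
    heatOp 3 (hurwitzSeries b) = 0 ↔ R6 b := by
  rw [eq_zero_iff_of_cf (by norm_num) fun ℓ m k n2 n5 n6 n8 n9 n12 h1 h2 h3 =>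
    cf_heatOp_6_hurwitzSeries n2 n5 n6 n8 n9 n12 hb h1 h2 h3]
  constructor <;> intro H ℓ m n2 n5 n6 n8 n9 n12 hr <;> linarith [H ℓ m n2 n5 n6 n8 n9 n12 hr]

theorem heatOp_7_hurwitzSeries {b : HCoeff} (hb : Supported b) :
    heatOp 4 (hurwitzSeries b) = 0 ↔ R7 b := by
  rw [eq_zero_iff_of_cf (by norm_num) fun ℓ m k n2 n5 n6 n8 n9 n12 h1 h2 h3 =>
    cf_heatOp_7_hurwitzSeries n2 n5 n6 n8 n9 n12 hb h1 h2 h3]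
  constructor <;> intro H ℓ m n2 n5 n6 n8 n9 n12 hr <;> linarith [H ℓ m n2 n5 n6 n8 n9 n12 hr]

theorem heatOp_10_hurwitzSeries {b : HCoeff} (hb : Supported b) :
    heatOp 5 (hurwitzSeries b) = 0 ↔ R10 b := by
  rw [eq_zero_iff_of_cf (by norm_num) fun ℓ m k n2 n5 n6 n8 n9 n12 h1 h2 h3 =>
    cf_heatOp_10_hurwitzSeries n2 n5 n6 n8 n9 n12 hb h1 h2 h3]
  constructor <;> intro H ℓ m n2 n5 n6 n8 n9 n12 hr <;> linarith [H ℓ m n2 n5 n6 n8 n9 n12 hr]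

/-! ### Elimination between the first two recurrences -/

/-- The value `b(ℓ + 1, m - 2, n)` is eliminated between `R_3` at `(ℓ, m - 1, n)` and `R_4` at
`(ℓ, m - 2, n)`. -/
theorem S34_of_R3_R4 {b : HCoeff} (h3 : R3 b) (h4 : R4 b) : S34 b := by
  intro ℓ m n2 n5 n6 n8 n9 n12 ⟨hℓ, hm, a2, a5, a6, a8, a9, a12, hk⟩ hm0
  have e3 : (kOf ℓ m n2 n5 n6 n8 n9 n12 : ℚ) * (24 * b ℓ m n2 n5 n6 n8 n9 n12
      + 48 * (m - 1) * b (ℓ + 1) (m - 2) n2 n5 n6 n8 n9 n12)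
      = kOf ℓ m n2 n5 n6 n8 n9 n12 * rhs3 b ℓ (m - 1) n2 n5 n6 n8 n9 n12 := by
    -- For `k = 0` the recurrence is not available, but it is multiplied by `k`.
    rcases hk.eq_or_lt with h0 | h0
    · simp [← h0]
    · have := h3 ℓ (m - 1) n2 n5 n6 n8 n9 n12
        ⟨hℓ, by omega, a2, a5, a6, a8, a9, a12, by unfold kOf at *; omega⟩
      rw [← this, sub_add_cancel, sub_sub, one_add_one_eq_two]
      push_cast
      ring
  have e4 : ((m : ℚ) - 1) * (-12 * b ℓ m n2 n5 n6 n8 n9 n12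
      - 24 * kOf ℓ m n2 n5 n6 n8 n9 n12 * b (ℓ + 1) (m - 2) n2 n5 n6 n8 n9 n12)
      = (m - 1) * rhs4 b ℓ (m - 2) n2 n5 n6 n8 n9 n12 := by
    -- For `m = 1` the recurrence is not available, but it is multiplied by `m - 1`.
    rcases eq_or_ne m 1 with rfl | h1
    · simp
    · have := h4 ℓ (m - 2) n2 n5 n6 n8 n9 n12
        ⟨hℓ, by omega, a2, a5, a6, a8, a9, a12, by unfold kOf at *; omega⟩
      rw [← this, sub_add_cancel]
      unfold kOf
      push_cast
      ring
  unfold rhsS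
  linear_combination e3 / 24 + e4 / 12

/-- The value `b(ℓ - 1, m + 2, n)` is eliminated between `R_3` at `(ℓ - 1, m + 1, n)` and `R_4` at
`(ℓ - 1, m, n)`. -/
theorem T34_of_R3_R4 {b : HCoeff} (h3 : R3 b) (h4 : R4 b) : T34 b := by
  intro ℓ m n2 n5 n6 n8 n9 n12 ⟨hℓ, hm, a2, a5, a6, a8, a9, a12, hk⟩ hℓ0
  have e3 := h3 (ℓ - 1) (m + 1) n2 n5 n6 n8 n9 n12
    ⟨by omega, by omega, a2, a5, a6, a8, a9, a12, by unfold kOf at *; omega⟩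
  have e4 := h4 (ℓ - 1) m n2 n5 n6 n8 n9 n12
    ⟨by omega, hm, a2, a5, a6, a8, a9, a12, by unfold kOf at *; omega⟩
  unfold rhsT
  rw [← e3, ← e4]
  simp only [sub_add_cancel, add_sub_cancel_right, add_assoc, one_add_one_eq_two]
  unfold kOf
  push_cast
  ring

/-- The relation `T_{3,4}` at `(1, 0, n_2 + 1, …)` determines `b(0, 0, n_2, …)`: it occurs in the
term of `r_4(0, 0, n_2 + 1, …)` of highest weight. -/
theorem eq_rhsT0_iff {b : HCoeff} {n2 n5 n6 n8 n9 n12 : ℤ} :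
    b 0 0 n2 n5 n6 n8 n9 n12 = rhsT0 b n2 n5 n6 n8 n9 n12 ↔
      kOf 1 0 (n2 + 1) n5 n6 n8 n9 n12 * b 1 0 (n2 + 1) n5 n6 n8 n9 n12
        = rhsT b 1 0 (n2 + 1) n5 n6 n8 n9 n12 := by
  unfold rhsT0 rhsT rhs3 rhs4 kOf
  simp only [sub_self, zero_add, add_sub_cancel_right, one_add_one_eq_two]
  push_cast
  constructor <;> intro h
  · linear_combination h / 6
  · linear_combination 6 * h

/-! ### The recursion scheme -/

/-- Each line of the scheme is one of the recurrences `R_j`, or it is a consequence of `S_{3,4}` or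
`T_{3,4}`. -/
theorem scheme_of_recurrences {b : HCoeff} (hb : Supported b) (h3 : R3 b) (h4 : R4 b) (h6 : R6 b)
    (h7 : R7 b) (h10 : R10 b) : Scheme (b 1 0 0 0 0 0 0 0) b := by
  intro ℓ m n2 n5 n6 n8 n9 n12
  unfold schemeRhs
  dsimp only
  split_ifs with g0 g1 g2 g3 g4 g5 g6
  · obtain ⟨rfl, rfl, rfl, rfl, rfl, rfl, rfl, rfl⟩ := g1
    rfl
  rotate_right
  · exact hb _ _ _ _ _ _ _ _ g0
  all_goals
    obtain ⟨hℓ, hm, a2, a5, a6, a8, a9, a12, hk⟩ := g0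
  · rw [← h10 (ℓ - 2) m n2 n5 n6 n8 n9 n12
      ⟨by omega, hm, a2, a5, a6, a8, a9, a12, by unfold kOf at *; omega⟩, sub_add_cancel]
    ring
  · rw [← h7 (ℓ - 1) (m - 1) n2 n5 n6 n8 n9 n12
      ⟨by omega, by omega, a2, a5, a6, a8, a9, a12, by unfold kOf at *; omega⟩, sub_add_cancel,
      sub_add_cancel]
    ring
  · rw [← h6 (ℓ - 1) m n2 n5 n6 n8 n9 n12
      ⟨by omega, hm, a2, a5, a6, a8, a9, a12, by unfold kOf at *; omega⟩, sub_add_cancel]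
    ring
  · rw [← S34_of_R3_R4 h3 h4 ℓ m n2 n5 n6 n8 n9 n12 ⟨hℓ, hm, a2, a5, a6, a8, a9, a12, hk⟩ g5.1,
      mul_div_cancel_left₀]
    have : kOf ℓ m n2 n5 n6 n8 n9 n12 - m + 1 ≠ 0 := by omega
    exact_mod_cast this
  · obtain rfl : ℓ = 0 := by unfold kOf at *; omega
    subst g6
    rw [eq_rhsT0_iff, ← T34_of_R3_R4 h3 h4 1 0 (n2 + 1) n5 n6 n8 n9 n12
      ⟨by omega, hm, by omega, a5, a6, a8, a9, a12, by unfold kOf at *; omega⟩ one_ne_zero]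
    simp
  · obtain rfl : ℓ = 0 := by unfold kOf at *; omega
    rw [← h3 0 (m - 1) n2 n5 n6 n8 n9 n12
      ⟨hℓ, by omega, a2, a5, a6, a8, a9, a12, by unfold kOf at *; omega⟩, sub_add_cancel,
      sub_sub, one_add_one_eq_two, zero_add]
    push_cast
    ring

/-- A weight for the indices which decreases along the recursion scheme: ten times the weight of the
monomial in the `μ_j`, corrected so that at equal weight `b(0, 0, ·)` may refer to `b(0, 2, ·)` and
`b(0, m, ·)` to `b(1, m - 2, ·)`, and `b(0, 0, ·)` to `b(1, 0, ·)` of weight higher by two. -/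
def rank (ℓ m n2 n5 n6 n8 n9 n12 : ℤ) : ℤ :=
  10 * (2 * n2 + 5 * n5 + 6 * n6 + 8 * n8 + 9 * n9 + 12 * n12) + 5 - 5 * min m 1 - 30 * min ℓ 1

set_option maxHeartbeats 1000000 in
/-- `schemeRhs` at some indices depends only on the values of the family at indices of smaller
rank. -/
theorem schemeRhs_congr (c : ℚ) {b b' : HCoeff} {ℓ m n2 n5 n6 n8 n9 n12 : ℤ}
    (H : ∀ ℓ' m' n2' n5' n6' n8' n9' n12',
      (InRange 0 ℓ' m' n2' n5' n6' n8' n9' n12' →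
        rank ℓ' m' n2' n5' n6' n8' n9' n12' < rank ℓ m n2 n5 n6 n8 n9 n12) →
      b ℓ' m' n2' n5' n6' n8' n9' n12' = b' ℓ' m' n2' n5' n6' n8' n9' n12') :
    schemeRhs c b ℓ m n2 n5 n6 n8 n9 n12 = schemeRhs c b' ℓ m n2 n5 n6 n8 n9 n12 := by
  unfold schemeRhs
  dsimp only
  split_ifs with g0 g1 g2 g3 g4 g5 g6
  · rfl
  rotate_right
  · rfl
  all_goals
    obtain ⟨hℓ, hm, a2, a5, a6, a8, a9, a12, hk⟩ := g0
    unfold InRange rank kOf at H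
    unfold kOf at *
  · unfold rhs10
    simp (disch := omega) only [H]
  · unfold rhs7
    simp (disch := omega) only [H]
  · unfold rhs6
    simp (disch := omega) only [H]
  · unfold rhsS rhs3 rhs4 low3 low4
    simp (disch := omega) only [H]
  · obtain rfl : ℓ = 0 := by omega
    unfold rhsT0 low3 low4
    simp (disch := omega) only [H]
  · obtain rfl : ℓ = 0 := by omega
    unfold rhs3 low3
    simp (disch := omega) only [H]

theorem supported_schemeRhs (c : ℚ) (b : HCoeff) : Supported (schemeRhs c b) := by
  intro ℓ m n2 n5 n6 n8 n9 n12 h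
  unfold schemeRhs
  exact if_pos h

theorem supported_of_scheme {c : ℚ} {b : HCoeff} (h : Scheme c b) : Supported b := by
  have : b = schemeRhs c b := by
    funext ℓ m n2 n5 n6 n8 n9 n12
    exact h ℓ m n2 n5 n6 n8 n9 n12
  rw [this]
  exact supported_schemeRhs c b

/-- The iterates of the right hand side of the scheme, starting from the zero family, approximate
the solution of the scheme; they are coefficient families. -/
theorem supported_iterate (c : ℚ) (N : ℕ) : Supported ((schemeRhs c)^[N] 0) := by
  cases N with
  | zero => exact fun _ _ _ _ _ _ _ _ _ => rfl
  | succ N =>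
    rw [Function.iterate_succ_apply']
    exact supported_schemeRhs c _

theorem rank_ge {ℓ m n2 n5 n6 n8 n9 n12 : ℤ} (h : InRange 0 ℓ m n2 n5 n6 n8 n9 n12) :
    -30 ≤ rank ℓ m n2 n5 n6 n8 n9 n12 := by
  obtain ⟨hℓ, hm, a2, a5, a6, a8, a9, a12, hk⟩ := h
  unfold rank
  omega

/-- The approximations to the solution of the scheme become stationary at each index. -/
theorem iterate_schemeRhs_eq (c : ℚ) (N : ℕ) : ∀ M ≥ N, ∀ ℓ m n2 n5 n6 n8 n9 n12 : ℤ,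
    (InRange 0 ℓ m n2 n5 n6 n8 n9 n12 → rank ℓ m n2 n5 n6 n8 n9 n12 + 30 < N) →
    (schemeRhs c)^[M] 0 ℓ m n2 n5 n6 n8 n9 n12 = (schemeRhs c)^[N] 0 ℓ m n2 n5 n6 n8 n9 n12 := by
  induction N with
  | zero =>
    intro M _ ℓ m n2 n5 n6 n8 n9 n12 h
    by_cases hr : InRange 0 ℓ m n2 n5 n6 n8 n9 n12
    · have := rank_ge hr
      have := h hr
      omega
    · rw [supported_iterate c M _ _ _ _ _ _ _ _ hr, supported_iterate c 0 _ _ _ _ _ _ _ _ hr]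
  | succ N ih =>
    intro M hM ℓ m n2 n5 n6 n8 n9 n12 h
    obtain ⟨M, rfl⟩ : ∃ M', M = M' + 1 := ⟨M - 1, by omega⟩
    by_cases hr : InRange 0 ℓ m n2 n5 n6 n8 n9 n12
    · rw [Function.iterate_succ_apply', Function.iterate_succ_apply']
      refine schemeRhs_congr c fun ℓ' m' n2' n5' n6' n8' n9' n12' H => ?_
      refine ih M (by omega) _ _ _ _ _ _ _ _ fun H' => ?_
      have := H H'
      have := h hr
      push_cast at this
      omega
    · rw [supported_iterate c _ _ _ _ _ _ _ _ _ hr, supported_iterate c _ _ _ _ _ _ _ _ _ hr]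

/-- Two solutions of the scheme agree, by induction on the rank. -/
theorem scheme_unique {c : ℚ} {b b' : HCoeff} (h : Scheme c b) (h' : Scheme c b') : b = b' := by
  have key : ∀ N : ℕ, ∀ ℓ m n2 n5 n6 n8 n9 n12 : ℤ,
      (InRange 0 ℓ m n2 n5 n6 n8 n9 n12 → rank ℓ m n2 n5 n6 n8 n9 n12 + 30 < N) →
      b ℓ m n2 n5 n6 n8 n9 n12 = b' ℓ m n2 n5 n6 n8 n9 n12 := by
    intro N
    induction N with
    | zero =>
      intro ℓ m n2 n5 n6 n8 n9 n12 H
      by_cases hr : InRange 0 ℓ m n2 n5 n6 n8 n9 n12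
      · have := rank_ge hr
        have := H hr
        omega
      · rw [supported_of_scheme h _ _ _ _ _ _ _ _ hr, supported_of_scheme h' _ _ _ _ _ _ _ _ hr]
    | succ N ih =>
      intro ℓ m n2 n5 n6 n8 n9 n12 H
      by_cases hr : InRange 0 ℓ m n2 n5 n6 n8 n9 n12
      · rw [h, h']
        refine schemeRhs_congr c fun ℓ' m' n2' n5' n6' n8' n9' n12' H1 => ?_
        refine ih _ _ _ _ _ _ _ _ fun H' => ?_
        have := H1 H'
        have := H hr
        push_cast at this
        omega
      · rw [supported_of_scheme h _ _ _ _ _ _ _ _ hr, supported_of_scheme h' _ _ _ _ _ _ _ _ hr]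
  funext ℓ m n2 n5 n6 n8 n9 n12
  refine key (rank ℓ m n2 n5 n6 n8 n9 n12 + 31).toNat _ _ _ _ _ _ _ _ fun hr => ?_
  have := rank_ge hr
  omega

/-- The value of the solution at some indices is that of an approximation whose number of steps
exceeds the rank, shifted by its lower bound `-30`. -/
theorem exists_scheme (c : ℚ) : ∃ b, Scheme c b := by
  refine ⟨fun ℓ m n2 n5 n6 n8 n9 n12 =>
    (schemeRhs c)^[(rank ℓ m n2 n5 n6 n8 n9 n12 + 31).toNat] 0 ℓ m n2 n5 n6 n8 n9 n12, ?_⟩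
  intro ℓ m n2 n5 n6 n8 n9 n12
  by_cases hr : InRange 0 ℓ m n2 n5 n6 n8 n9 n12
  · have hp := rank_ge hr
    obtain ⟨N, hN⟩ : ∃ N : ℕ, (rank ℓ m n2 n5 n6 n8 n9 n12 + 31).toNat = N + 1 :=
      ⟨(rank ℓ m n2 n5 n6 n8 n9 n12 + 31).toNat - 1, by omega⟩
    dsimp only
    rw [hN, Function.iterate_succ_apply']
    refine schemeRhs_congr c fun ℓ' m' n2' n5' n6' n8' n9' n12' H => ?_
    by_cases hr' : InRange 0 ℓ' m' n2' n5' n6' n8' n9' n12'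
    · have := rank_ge hr'
      have := H hr'
      refine iterate_schemeRhs_eq c _ N (by omega) _ _ _ _ _ _ _ _ fun _ => ?_
      omega
    · rw [supported_iterate c _ _ _ _ _ _ _ _ _ hr', supported_iterate c _ _ _ _ _ _ _ _ _ hr']
  · dsimp only
    rw [supported_iterate c _ _ _ _ _ _ _ _ _ hr, supported_schemeRhs c _ _ _ _ _ _ _ _ _ hr]

theorem existsUnique_scheme (c : ℚ) : ∃! b, Scheme c b := by
  obtain ⟨b, hb⟩ := exists_scheme c
  exact ⟨b, hb, fun b' hb' => scheme_unique hb' hb⟩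

/-! ### The equations between the defects -/

/-- The equations between the defects `d j = (L_j - H_j) φ` of a series `φ` that come from the
structure equations, if the defects with subscripts `0` and `10` vanish, and the one with subscript
`7` is divisible by `u_5`. -/
structure DefectSystem (d : Fin 6 → Series) : Prop where
  d0_eq : d 0 = 0
  d10_eq : d 5 = 0
  comm : ∀ i j, 0 < i → i < j →
    heatOp i (d j) - heatOp j (d i) = ∑ l, structureConst i j l • d l
  d7_zero : ∀ ℓ m k n2 n5 n6 n8 n9 n12, ℓ ≤ 0 → cf (d 4) ℓ m k n2 n5 n6 n8 n9 n12 = 0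

/-- The defects vanish to the order `v` in the weight of the `μ_j`; for the parts of degree `0` in
`u_5` of those with subscripts `3` and `4` the order is lower by `3`. -/
structure VanishBelow (d : Fin 6 → Series) (v : ℤ) : Prop where
  d3_zero : ∀ ℓ m k n2 n5 n6 n8 n9 n12,
    2 * n2 + 5 * n5 + 6 * n6 + 8 * n8 + 9 * n9 + 12 * n12 < v - 3 →
    cf (d 1) ℓ m k n2 n5 n6 n8 n9 n12 = 0
  d3_one : ∀ ℓ m k n2 n5 n6 n8 n9 n12,
    1 ≤ ℓ →
    2 * n2 + 5 * n5 + 6 * n6 + 8 * n8 + 9 * n9 + 12 * n12 < v →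
    cf (d 1) ℓ m k n2 n5 n6 n8 n9 n12 = 0
  d4_zero : ∀ ℓ m k n2 n5 n6 n8 n9 n12,
    2 * n2 + 5 * n5 + 6 * n6 + 8 * n8 + 9 * n9 + 12 * n12 < v - 3 →
    cf (d 2) ℓ m k n2 n5 n6 n8 n9 n12 = 0
  d4_one : ∀ ℓ m k n2 n5 n6 n8 n9 n12,
    1 ≤ ℓ →
    2 * n2 + 5 * n5 + 6 * n6 + 8 * n8 + 9 * n9 + 12 * n12 < v →
    cf (d 2) ℓ m k n2 n5 n6 n8 n9 n12 = 0
  d6_low : ∀ ℓ m k n2 n5 n6 n8 n9 n12,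
    2 * n2 + 5 * n5 + 6 * n6 + 8 * n8 + 9 * n9 + 12 * n12 < v →
    cf (d 3) ℓ m k n2 n5 n6 n8 n9 n12 = 0
  d7_low : ∀ ℓ m k n2 n5 n6 n8 n9 n12,
    2 * n2 + 5 * n5 + 6 * n6 + 8 * n8 + 9 * n9 + 12 * n12 < v →
    cf (d 4) ℓ m k n2 n5 n6 n8 n9 n12 = 0

section Defects

variable {d : Fin 6 → Series} {v : ℤ}

set_option maxHeartbeats 1000000 in
/-- The operator with subscript `10` is `-∂²/∂u_5²/2` up to terms that raise the weight by `8` or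
more, so its structure equations give the parts of degree at least `2` in `u_5`. -/
theorem DefectSystem.two (S : DefectSystem d) (V : VanishBelow d v)
    {ℓ : ℤ} (m k n2 n5 n6 n8 n9 n12 : ℤ) (hℓ : 2 ≤ ℓ)
    (hw : 2 * n2 + 5 * n5 + 6 * n6 + 8 * n8 + 9 * n9 + 12 * n12 ≤ v + 4) :
    cf (d 1) ℓ m k n2 n5 n6 n8 n9 n12 = 0 ∧ cf (d 2) ℓ m k n2 n5 n6 n8 n9 n12 = 0 ∧
    cf (d 3) ℓ m k n2 n5 n6 n8 n9 n12 = 0 ∧ cf (d 4) ℓ m k n2 n5 n6 n8 n9 n12 = 0 := by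
  by_cases hneg : 0 ≤ m ∧ 0 ≤ k
  · obtain ⟨hm, hk⟩ := hneg
    have h (i : Fin 6) (hi : 0 < i) (hi' : i < 5) :=
      congrArg (fun φ => cf φ (ℓ - 2) m k n2 n5 n6 n8 n9 n12) (S.comm i 5 hi hi')
    have h1 := h 1 (by decide) (by decide)
    have h2 := h 2 (by decide) (by decide)
    have h3 := h 3 (by decide) (by decide)
    have h4 := h 4 (by decide) (by decide)
    have g (i : Fin 6) := cf_heatOp_10 (d i) (ℓ := ℓ - 2) n2 n5 n6 n8 n9 n12 (by omega) hm hk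
    have g1 := g 1
    have g2 := g 2
    have g3 := g 3
    have g4 := g 4
    -- The equation for the commutator with the operator of subscript `10` only contains
    -- `∂²/∂u_5²` of a defect and values of defects below the order `v`.
    clear h g
    simp only [structureConst, Fin.sum_univ_six, Matrix.cons_val, S.d0_eq, S.d10_eq, map_zero,
      smul_zero] at h1 h2 h3 h4
    simp (disch := omega) only [cf_sub, cf_add, cf_neg, cf_rat_smul, cf_ofNat_smul, cf_zero, cf_X,
        cf_X_pow, sub_smul, add_smul, neg_smul, one_smul, zero_smul, neg_mul, mul_smul, smul_assoc,
        Nat.cast_ofNat, V.d3_zero, V.d3_one, V.d4_zero, V.d4_one, V.d6_low, V.d7_low, mul_zero,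
        add_zero, zero_add, sub_zero, zero_sub, neg_zero, zero_mul, Int.cast_zero, Int.cast_one,
        Int.cast_mul, Int.cast_ofNat, sub_add_cancel]
        at h1 h2 h3 h4 g1 g2 g3 g4
    refine ⟨?_, ?_, ?_, ?_⟩
    · linear_combination g1 / 24 + 2 * h1
    · linear_combination g2 / 24 + 2 * h2
    · linear_combination g3 / 24 + 2 * h3
    · linear_combination g4 / 24 + 2 * h4
  · have hneg' : ∀ φ, cf φ ℓ m k n2 n5 n6 n8 n9 n12 = 0 := fun φ =>
      cf_of_neg φ fun H => hneg ⟨H.2.1, H.2.2.1⟩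
    exact ⟨hneg' _, hneg' _, hneg' _, hneg' _⟩

/-- The leading terms of the structure equations of the operators with subscripts `3, 4, 6, 7`, in
degree `0` or `1` in `u_5`, at given exponents. The subscripts of the operators and the degree are
recorded in the names. -/
structure LeadingRelations (d : Fin 6 → Series) (m k n2 n5 n6 n8 n9 n12 : ℤ) : Prop where
  rel37_0 : -2 * m * cf (d 4) 1 (m - 1) k n2 n5 n6 n8 n9 n12
      + cf (d 1) 1 (m + 1) k n2 n5 n6 n8 n9 n12
      + 1 / 6 * cf (d 1) 0 m (k + 2) n2 (n5 - 1) n6 n8 n9 n12 = 0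
  rel47_0 : -k * cf (d 4) 1 m (k - 1) n2 n5 n6 n8 n9 n12 + cf (d 2) 1 (m + 1) k n2 n5 n6 n8 n9 n12
      + 1 / 6 * cf (d 2) 0 m (k + 2) n2 (n5 - 1) n6 n8 n9 n12 = 0
  rel67_0 : -cf (d 4) 1 m (k + 1) n2 n5 n6 n8 n9 n12 + cf (d 3) 1 (m + 1) k n2 n5 n6 n8 n9 n12 = 0
  rel34_1 : -cf (d 2) 1 (m + 1) (k + 1) n2 n5 n6 n8 n9 n12
      + 1 / 2 * k * cf (d 2) 1 (m + 1) (k - 1) (n2 - 1) n5 n6 n8 n9 n12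
      + 1 / 2 * cf (d 1) 1 (m + 2) k n2 n5 n6 n8 n9 n12
      + 1 / 6 * cf (d 1) 1 m (k + 2) (n2 - 1) n5 n6 n8 n9 n12 = cf (d 4) 1 m k n2 n5 n6 n8 n9 n12
  rel36_1 : -cf (d 3) 1 (m + 1) (k + 1) n2 n5 n6 n8 n9 n12
      + 1 / 2 * k * cf (d 3) 1 (m + 1) (k - 1) (n2 - 1) n5 n6 n8 n9 n12
      = -1 / 2 * cf (d 4) 1 m k (n2 - 1) n5 n6 n8 n9 n12
  rel46_1 : -1 / 2 * cf (d 3) 1 (m + 2) k n2 n5 n6 n8 n9 n12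
      - 1 / 6 * cf (d 3) 1 m (k + 2) (n2 - 1) n5 n6 n8 n9 n12 = 0
  rel37_1 : -cf (d 4) 1 (m + 1) (k + 1) n2 n5 n6 n8 n9 n12
      + 1 / 2 * k * cf (d 4) 1 (m + 1) (k - 1) (n2 - 1) n5 n6 n8 n9 n12 = 0

set_option maxHeartbeats 2000000 in
/-- At weights up to `v + 2` all other terms of the structure equations in `LeadingRelations`
vanish. -/
theorem DefectSystem.leading (S : DefectSystem d) (V : VanishBelow d v) {m k : ℤ}
    (n2 n5 n6 n8 n9 n12 : ℤ) (hm : 0 ≤ m) (hk : 0 ≤ k)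
    (hw : 2 * n2 + 5 * n5 + 6 * n6 + 8 * n8 + 9 * n9 + 12 * n12 ≤ v + 2) :
    LeadingRelations d m k n2 n5 n6 n8 n9 n12 := by
  have h2 (ℓ m k n2 n5 n6 n8 n9 n12 : ℤ) (hℓ : 2 ≤ ℓ)
      (hw : 2 * n2 + 5 * n5 + 6 * n6 + 8 * n8 + 9 * n9 + 12 * n12 ≤ v + 4) :=
    S.two V m k n2 n5 n6 n8 n9 n12 hℓ hw
  have e (ℓ : ℤ) (i j : Fin 6) (hi : 0 < i) (hij : i < j) :=
    congrArg (fun φ => cf φ ℓ m k n2 n5 n6 n8 n9 n12) (S.comm i j hi hij)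
  -- `e` are the coefficients of the structure equations, `p` those of the operators on the defects.
  have e37_0 := e 0 1 4 (by decide) (by decide)
  have p3_7_0 := cf_heatOp_3 (d 4) (ℓ := 0) n2 n5 n6 n8 n9 n12 (by norm_num) hm hk
  have p7_3_0 := cf_heatOp_7 (d 1) (ℓ := 0) n2 n5 n6 n8 n9 n12 (by norm_num) hm hk
  have e47_0 := e 0 2 4 (by decide) (by decide)
  have p4_7_0 := cf_heatOp_4 (d 4) (ℓ := 0) n2 n5 n6 n8 n9 n12 (by norm_num) hm hk
  have p7_4_0 := cf_heatOp_7 (d 2) (ℓ := 0) n2 n5 n6 n8 n9 n12 (by norm_num) hm hk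
  have e67_0 := e 0 3 4 (by decide) (by decide)
  have p6_7_0 := cf_heatOp_6 (d 4) (ℓ := 0) n2 n5 n6 n8 n9 n12 (by norm_num) hm hk
  have p7_6_0 := cf_heatOp_7 (d 3) (ℓ := 0) n2 n5 n6 n8 n9 n12 (by norm_num) hm hk
  have e34_1 := e 1 1 2 (by decide) (by decide)
  have p3_4_1 := cf_heatOp_3 (d 2) (ℓ := 1) n2 n5 n6 n8 n9 n12 (by norm_num) hm hk
  have p4_3_1 := cf_heatOp_4 (d 1) (ℓ := 1) n2 n5 n6 n8 n9 n12 (by norm_num) hm hk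
  have e36_1 := e 1 1 3 (by decide) (by decide)
  have p3_6_1 := cf_heatOp_3 (d 3) (ℓ := 1) n2 n5 n6 n8 n9 n12 (by norm_num) hm hk
  have p6_3_1 := cf_heatOp_6 (d 1) (ℓ := 1) n2 n5 n6 n8 n9 n12 (by norm_num) hm hk
  have e46_1 := e 1 2 3 (by decide) (by decide)
  have p4_6_1 := cf_heatOp_4 (d 3) (ℓ := 1) n2 n5 n6 n8 n9 n12 (by norm_num) hm hk
  have p6_4_1 := cf_heatOp_6 (d 2) (ℓ := 1) n2 n5 n6 n8 n9 n12 (by norm_num) hm hk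
  have e37_1 := e 1 1 4 (by decide) (by decide)
  have p3_7_1 := cf_heatOp_3 (d 4) (ℓ := 1) n2 n5 n6 n8 n9 n12 (by norm_num) hm hk
  have p7_3_1 := cf_heatOp_7 (d 1) (ℓ := 1) n2 n5 n6 n8 n9 n12 (by norm_num) hm hk
  clear e
  simp only [structureConst, Fin.sum_univ_six, Matrix.cons_val, S.d0_eq, S.d10_eq, map_zero,
    smul_zero] at e37_0 e47_0 e67_0 e34_1 e36_1 e46_1 e37_1
  simp (disch := omega) only [cf_sub, cf_add, cf_neg, cf_rat_smul, cf_ofNat_smul, cf_zero, cf_X,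
      cf_X_pow, sub_smul, add_smul, neg_smul, one_smul, zero_smul, neg_mul, mul_smul, smul_assoc,
      Nat.cast_ofNat, V.d3_zero, V.d3_one, V.d4_zero, V.d4_one, V.d6_low, V.d7_low, h2, S.d7_zero,
      mul_zero, add_zero, zero_add, sub_zero, zero_sub, neg_zero, zero_mul, Int.cast_zero,
      Int.cast_one, Int.cast_mul, Int.cast_ofNat, one_add_one_eq_two]
      at e37_0 e47_0 e67_0 e34_1 e36_1 e46_1 e37_1 p3_7_0 p7_3_0 p4_7_0 p7_4_0 p6_7_0 p7_6_0 p3_4_1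
        p4_3_1 p3_6_1 p6_3_1 p4_6_1 p6_4_1 p3_7_1 p7_3_1
  refine ⟨?_, ?_, ?_, ?_, ?_, ?_, ?_⟩
  · linear_combination e37_0 - p3_7_0 / 24 + p7_3_0 / 48
  · linear_combination e47_0 - p4_7_0 / 24 + p7_4_0 / 48
  · linear_combination e67_0 - p6_7_0 / 48 + p7_6_0 / 48
  · linear_combination e34_1 - p3_4_1 / 24 + p4_3_1 / 24
  · linear_combination e36_1 - p3_6_1 / 24 + p6_3_1 / 48
  · linear_combination e46_1 - p4_6_1 / 24 + p6_4_1 / 48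
  · linear_combination e37_1 - p3_7_1 / 24 + p7_3_1 / 48

/-- Leading terms of further structure equations, in the same notation as `LeadingRelations`. -/
structure LowRelations (d : Fin 6 → Series) (m k n2 n5 n6 n8 n9 n12 : ℤ) : Prop where
  rel47_1 : -1 / 2 * cf (d 4) 1 (m + 2) k n2 n5 n6 n8 n9 n12 = 0
  rel36_0 : -cf (d 3) 0 (m + 1) (k + 1) n2 n5 n6 n8 n9 n12
      - 2 * m * cf (d 3) 1 (m - 1) k n2 n5 n6 n8 n9 n12
      + cf (d 1) 1 m (k + 1) n2 n5 n6 n8 n9 n12 = 0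
  rel46_0 : -1 / 2 * cf (d 3) 0 (m + 2) k n2 n5 n6 n8 n9 n12
      - k * cf (d 3) 1 m (k - 1) n2 n5 n6 n8 n9 n12
      + cf (d 2) 1 m (k + 1) n2 n5 n6 n8 n9 n12 = 0

set_option maxHeartbeats 2000000 in
/-- At weights up to `v` all other terms of the structure equations in `LowRelations` vanish. -/
theorem DefectSystem.low (S : DefectSystem d) (V : VanishBelow d v) {m k : ℤ}
    (n2 n5 n6 n8 n9 n12 : ℤ) (hm : 0 ≤ m) (hk : 0 ≤ k)
    (hw : 2 * n2 + 5 * n5 + 6 * n6 + 8 * n8 + 9 * n9 + 12 * n12 ≤ v) :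
    LowRelations d m k n2 n5 n6 n8 n9 n12 := by
  have h2 (ℓ m k n2 n5 n6 n8 n9 n12 : ℤ) (hℓ : 2 ≤ ℓ)
      (hw : 2 * n2 + 5 * n5 + 6 * n6 + 8 * n8 + 9 * n9 + 12 * n12 ≤ v + 4) :=
    S.two V m k n2 n5 n6 n8 n9 n12 hℓ hw
  have e (ℓ : ℤ) (i j : Fin 6) (hi : 0 < i) (hij : i < j) :=
    congrArg (fun φ => cf φ ℓ m k n2 n5 n6 n8 n9 n12) (S.comm i j hi hij)
  have e47_1 := e 1 2 4 (by decide) (by decide)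
  have p4_7_1 := cf_heatOp_4 (d 4) (ℓ := 1) n2 n5 n6 n8 n9 n12 (by norm_num) hm hk
  have p7_4_1 := cf_heatOp_7 (d 2) (ℓ := 1) n2 n5 n6 n8 n9 n12 (by norm_num) hm hk
  have e36_0 := e 0 1 3 (by decide) (by decide)
  have p3_6_0 := cf_heatOp_3 (d 3) (ℓ := 0) n2 n5 n6 n8 n9 n12 (by norm_num) hm hk
  have p6_3_0 := cf_heatOp_6 (d 1) (ℓ := 0) n2 n5 n6 n8 n9 n12 (by norm_num) hm hk
  have e46_0 := e 0 2 3 (by decide) (by decide)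
  have p4_6_0 := cf_heatOp_4 (d 3) (ℓ := 0) n2 n5 n6 n8 n9 n12 (by norm_num) hm hk
  have p6_4_0 := cf_heatOp_6 (d 2) (ℓ := 0) n2 n5 n6 n8 n9 n12 (by norm_num) hm hk
  clear e
  simp only [structureConst, Fin.sum_univ_six, Matrix.cons_val, S.d0_eq, S.d10_eq, map_zero,
    smul_zero] at e47_1 e36_0 e46_0
  simp (disch := omega) only [cf_sub, cf_add, cf_neg, cf_rat_smul, cf_ofNat_smul, cf_zero, cf_X,
      cf_X_pow, sub_smul, add_smul, neg_smul, one_smul, zero_smul, neg_mul, mul_smul, smul_assoc,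
      Nat.cast_ofNat, V.d3_zero, V.d3_one, V.d4_zero, V.d4_one, V.d6_low, V.d7_low, h2, S.d7_zero,
      mul_zero, add_zero, zero_add, sub_zero, zero_sub, neg_zero, zero_mul, Int.cast_zero,
      Int.cast_one, Int.cast_mul, Int.cast_ofNat, one_add_one_eq_two]
      at e47_1 e36_0 e46_0 p4_7_1 p7_4_1 p3_6_0 p6_3_0 p4_6_0 p6_4_0
  refine ⟨?_, ?_, ?_⟩
  · linear_combination e47_1 - p4_7_1 / 24 + p7_4_1 / 48
  · linear_combination e36_0 - p3_6_0 / 24 + p6_3_0 / 48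
  · linear_combination e46_0 - p4_6_0 / 24 + p6_4_0 / 48

set_option maxHeartbeats 2000000 in
/-- The leading terms of the structure equation of the operators with subscripts `3` and `4`, in
degree `0` in `u_5`. -/
theorem DefectSystem.lowest (S : DefectSystem d) (V : VanishBelow d v) {m k : ℤ}
    (n2 n5 n6 n8 n9 n12 : ℤ) (hm : 0 ≤ m) (hk : 0 ≤ k)
    (hw : 2 * n2 + 5 * n5 + 6 * n6 + 8 * n8 + 9 * n9 + 12 * n12 ≤ v - 3) :
    -cf (d 2) 0 (m + 1) (k + 1) n2 n5 n6 n8 n9 n12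
      + 1 / 2 * cf (d 1) 0 (m + 2) k n2 n5 n6 n8 n9 n12 = 0 := by
  have h2 (ℓ m k n2 n5 n6 n8 n9 n12 : ℤ) (hℓ : 2 ≤ ℓ)
      (hw : 2 * n2 + 5 * n5 + 6 * n6 + 8 * n8 + 9 * n9 + 12 * n12 ≤ v + 4) :=
    S.two V m k n2 n5 n6 n8 n9 n12 hℓ hw
  have e (ℓ : ℤ) (i j : Fin 6) (hi : 0 < i) (hij : i < j) :=
    congrArg (fun φ => cf φ ℓ m k n2 n5 n6 n8 n9 n12) (S.comm i j hi hij)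
  have e34_0 := e 0 1 2 (by decide) (by decide)
  have p3_4_0 := cf_heatOp_3 (d 2) (ℓ := 0) n2 n5 n6 n8 n9 n12 (by norm_num) hm hk
  have p4_3_0 := cf_heatOp_4 (d 1) (ℓ := 0) n2 n5 n6 n8 n9 n12 (by norm_num) hm hk
  clear e
  simp only [structureConst, Fin.sum_univ_six, Matrix.cons_val, S.d0_eq, S.d10_eq, map_zero,
    smul_zero] at e34_0
  simp (disch := omega) only [cf_sub, cf_add, cf_neg, cf_rat_smul, cf_ofNat_smul, cf_zero, cf_X,
      cf_X_pow, sub_smul, add_smul, neg_smul, one_smul, zero_smul, neg_mul, mul_smul, smul_assoc,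
      Nat.cast_ofNat, V.d3_zero, V.d3_one, V.d4_zero, V.d4_one, V.d6_low, V.d7_low, h2, S.d7_zero,
      mul_zero, add_zero, zero_add, sub_zero, zero_sub, neg_zero, zero_mul, Int.cast_zero,
      Int.cast_one, Int.cast_mul, Int.cast_ofNat, one_add_one_eq_two]
      at e34_0 p3_4_0 p4_3_0
  linear_combination e34_0 - p3_4_0 / 24 + p4_3_0 / 24

/-! ### Vanishing of the defects -/

/-- The conditions on the defects that hold when the family of coefficients is computed by the
recursion scheme: homogeneity, the relations that express the lines of the scheme for `ℓ ≤ 1` and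
are not contained in `DefectSystem`, and the vanishing of the twelve coefficients that the structure
equations leave undetermined. -/
structure Normalized (d : Fin 6 → Series) : Prop where
  hom_d3 : ∀ ℓ m k n2 n5 n6 n8 n9 n12, cf (d 1) ℓ m k n2 n5 n6 n8 n9 n12 ≠ 0 →
    k = kOf ℓ m n2 n5 n6 n8 n9 n12 - 3
  hom_d4 : ∀ ℓ m k n2 n5 n6 n8 n9 n12, cf (d 2) ℓ m k n2 n5 n6 n8 n9 n12 ≠ 0 →
    k = kOf ℓ m n2 n5 n6 n8 n9 n12 - 4
  hom_d6 : ∀ ℓ m k n2 n5 n6 n8 n9 n12, cf (d 3) ℓ m k n2 n5 n6 n8 n9 n12 ≠ 0 →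
    k = kOf ℓ m n2 n5 n6 n8 n9 n12 - 6
  hom_d7 : ∀ ℓ m k n2 n5 n6 n8 n9 n12, cf (d 4) ℓ m k n2 n5 n6 n8 n9 n12 ≠ 0 →
    k = kOf ℓ m n2 n5 n6 n8 n9 n12 - 7
  d6_zero : ∀ k n2 n5 n6 n8 n9 n12, cf (d 3) 0 0 k n2 n5 n6 n8 n9 n12 = 0
  rel_S : ∀ m k n2 n5 n6 n8 n9 n12 : ℤ, 0 ≤ m → -1 ≤ k → k + 1 ≠ m →
    (k + 1) * cf (d 1) 0 m k n2 n5 n6 n8 n9 n12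
    = 2 * m * cf (d 2) 0 (m - 1) (k + 1) n2 n5 n6 n8 n9 n12
  rel_last : ∀ m k n2 n5 n6 n8 n9 n12 : ℤ, k + 1 = m → cf (d 1) 0 m k n2 n5 n6 n8 n9 n12 = 0
  rel_T : ∀ k n2 n5 n6 n8 n9 n12 : ℤ, 0 ≤ k → 1 ≤ n2 →
    cf (d 1) 0 1 k n2 n5 n6 n8 n9 n12 = 2 * cf (d 2) 0 0 (k + 1) n2 n5 n6 n8 n9 n12
  d4_W0 : cf (d 2) 0 0 1 0 0 0 0 0 0 = 0
  d4_W4 : cf (d 2) 1 0 0 2 0 0 0 0 0 = 0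
  d4_W5 : cf (d 2) 1 0 1 0 1 0 0 0 0 = 0
  d3_W4 : cf (d 1) 1 0 1 2 0 0 0 0 0 = 0
  d3_W5 : cf (d 1) 1 0 2 0 1 0 0 0 0 = 0
  d3_W6 : cf (d 1) 1 0 3 3 0 0 0 0 0 = 0
  d3_W6' : cf (d 1) 1 0 3 0 0 1 0 0 0 = 0
  d6_W6 : cf (d 3) 1 0 0 3 0 0 0 0 0 = 0
  d6_W6' : cf (d 3) 1 0 0 0 0 1 0 0 0 = 0
  d6_W7 : cf (d 3) 1 0 1 1 1 0 0 0 0 = 0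
  d7_W9 : cf (d 4) 1 1 0 2 1 0 0 0 0 = 0
  d7_W9' : cf (d 4) 1 1 0 0 0 0 0 1 0 = 0

/-- The relation `rel_S` and the structure equation `DefectSystem.lowest` express `cf (d 1) 0 (m +
1) (k - 1)` as two multiples of `cf (d 2) 0 m k`, which are different unless `k = m + 1`. -/
theorem d4_zero_of_pos (S : DefectSystem d) (N : Normalized d)
    (V : VanishBelow d v) {m k n2 n5 n6 n8 n9 n12 : ℤ}
    (hw : 2 * n2 + 5 * n5 + 6 * n6 + 8 * n8 + 9 * n9 + 12 * n12 = v - 3) (hm : 1 ≤ m ∨ k = 0) :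
    cf (d 2) 0 m k n2 n5 n6 n8 n9 n12 = 0 := by
  refine cf_eq_zero_of_nonneg fun _ hm0 hk _ _ _ _ _ _ => ?_
  rcases eq_or_ne k 0 with rfl | hk0
  · -- At `k = -1` the left hand side of `rel_S` has the factor `k + 1 = 0`.
    have h := N.rel_S (m + 1) (-1) n2 n5 n6 n8 n9 n12 (by omega) le_rfl (by omega)
    simp only [add_sub_cancel_right, neg_add_cancel] at h
    have hm' : (2 * ((m + 1 : ℤ) : ℚ)) ≠ 0 := by
      have : m + 1 ≠ 0 := by omega
      exact mul_ne_zero two_ne_zero (by exact_mod_cast this)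
    refine (mul_eq_zero.1 ?_).resolve_left hm'
    rw [← h]
    simp
  · have h := S.lowest V (m := m - 1) (k := k - 1) n2 n5 n6 n8 n9 n12 (by omega) (by omega) hw.le
    rcases eq_or_ne k (m + 1) with h1 | h1
    · have h2 := N.rel_last (m + 1) (k - 1) n2 n5 n6 n8 n9 n12 (by omega)
      rw [show m + 1 = m - 1 + 2 by ring] at h2
      rw [h2] at h
      simpa using h
    · have h2 := N.rel_S (m + 1) (k - 1) n2 n5 n6 n8 n9 n12 (by omega) (by omega)
        (by omega)
      have h3 : ((k : ℚ) - (m + 1)) ≠ 0 := by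
        have : k - (m + 1) ≠ 0 := by omega
        exact_mod_cast this
      refine (mul_eq_zero.1 ?_).resolve_left h3
      simp only [sub_add_cancel, add_sub_cancel_right] at h h2
      rw [show m - 1 + 2 = m + 1 by ring] at h
      push_cast at h2
      linear_combination h2 / 2 - k * h

/-- In degree `0` in `u_2` as well, `rel_T` settles the case `n2 > 0`. For `n2 = 0` the structure
equations at the exponent `n5 + 1` are used, as they contain the coefficient in question divided by
`6`. -/
theorem d4_zero_vanish (S : DefectSystem d) (N : Normalized d)
    (V : VanishBelow d v) {k n2 n5 n6 n8 n9 n12 : ℤ}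
    (hw : 2 * n2 + 5 * n5 + 6 * n6 + 8 * n8 + 9 * n9 + 12 * n12 = v - 3) :
    cf (d 2) 0 0 k n2 n5 n6 n8 n9 n12 = 0 := by
  refine cf_eq_zero_of_nonneg fun _ _ hk a2 a5 a6 a8 a9 a12 => ?_
  by_contra hD
  have hhom := N.hom_d4 _ _ _ _ _ _ _ _ _ hD
  unfold kOf at hhom
  have hk0 : k ≠ 0 := fun h => hD (d4_zero_of_pos S N V hw (Or.inr h))
  have hk1 : k ≠ 1 := by
    rintro rfl
    obtain ⟨rfl, rfl, rfl, rfl, rfl, rfl⟩ :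
      n2 = 0 ∧ n5 = 0 ∧ n6 = 0 ∧ n8 = 0 ∧ n9 = 0 ∧ n12 = 0 := by omega
    exact hD N.d4_W0
  have hS := N.rel_S 1 (k - 1) n2 n5 n6 n8 n9 n12 (by omega) (by omega) (by omega)
  simp only [sub_add_cancel, sub_self] at hS
  push_cast at hS
  have hk' : (k : ℚ) - 1 ≠ 0 := by
    have : k - 1 ≠ 0 := by omega
    exact_mod_cast this
  rcases lt_or_ge 0 n2 with h2 | h2
  · have hT := N.rel_T (k - 1) n2 n5 n6 n8 n9 n12 (by omega) h2
    rw [sub_add_cancel] at hT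
    refine hD ((mul_eq_zero.1 ?_).resolve_left hk')
    linear_combination hS / 2 - k / 2 * hT
  · obtain rfl : n2 = 0 := by omega
    have hk6 : 6 ≤ k := by
      by_contra hlt
      have h5 : n5 = 0 := by omega
      have h6 : n6 = 0 := by omega
      have h8 : n8 = 0 := by omega
      have h9 : n9 = 0 := by omega
      have h12 : n12 = 0 := by omega
      omega
    have r34 := (S.leading V (m := 0) (k := k - 3) 0 (n5 + 1) n6 n8 n9 n12 le_rfl (by omega)
      (by omega)).rel34_1
    have r47 := (S.leading V (m := 0) (k := k - 2) 0 (n5 + 1) n6 n8 n9 n12 le_rfl (by omega)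
      (by omega)).rel47_0
    have r37 := (S.leading V (m := 1) (k := k - 3) 0 (n5 + 1) n6 n8 n9 n12 (by omega) (by omega)
      (by omega)).rel37_0
    have r67 := (S.leading V (m := 0) (k := k - 4) 0 (n5 + 1) n6 n8 n9 n12 le_rfl (by omega)
      (by omega)).rel67_0
    have r36 := (S.leading V (m := 0) (k := k - 5) 0 (n5 + 1) n6 n8 n9 n12 le_rfl (by omega)
      (by omega)).rel36_1
    have hneg : ∀ (φ : Series) (ℓ m k n5 n6 n8 n9 n12 : ℤ), cf φ ℓ m k (0 - 1) n5 n6 n8 n9 n12 = 0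
      :=
      fun φ ℓ m k n5 n6 n8 n9 n12 => cf_of_neg φ fun H => by omega
    simp only [hneg, mul_zero, add_zero] at r34 r36
    refine hD ((mul_eq_zero.1 ?_).resolve_left hk')
    push_cast at r37 r47
    linear_combination (norm := ring_nf) 6 * k * r34 + 6 * k * r47 - 3 * k * r37
      - 6 * k * (k - 2) * (r67 + r36) + hS / 2

/-- By `rel_S`, from the vanishing of `d 2` in degree `0` in `u_5`. -/
theorem d3_zero_vanish (S : DefectSystem d) (N : Normalized d)
    (V : VanishBelow d v) {m k n2 n5 n6 n8 n9 n12 : ℤ}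
    (hw : 2 * n2 + 5 * n5 + 6 * n6 + 8 * n8 + 9 * n9 + 12 * n12 = v - 3) :
    cf (d 1) 0 m k n2 n5 n6 n8 n9 n12 = 0 := by
  refine cf_eq_zero_of_nonneg fun _ hm hk _ _ _ _ _ _ => ?_
  rcases eq_or_ne (k + 1) m with h | h
  · exact N.rel_last _ _ _ _ _ _ _ _ h
  · have hS := N.rel_S m k n2 n5 n6 n8 n9 n12 hm (by omega) h
    have hD : 2 * (m : ℚ) * cf (d 2) 0 (m - 1) (k + 1) n2 n5 n6 n8 n9 n12 = 0 := by
      rcases lt_trichotomy m 1 with h1 | rfl | h1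
      · obtain rfl : m = 0 := by omega
        simp
      · rw [sub_self, d4_zero_vanish S N V hw, mul_zero]
      · rw [d4_zero_of_pos S N V hw (Or.inl (by omega)), mul_zero]
    rw [hD] at hS
    have hk' : (k : ℚ) + 1 ≠ 0 := by
      have : k + 1 ≠ 0 := by omega
      exact_mod_cast this
    exact (mul_eq_zero.1 hS).resolve_left hk'

/-- The parts of `d 1` and `d 2` of degree `0` in `u_5` vanish to one order more. -/
theorem d3_d4_vanish (S : DefectSystem d) (N : Normalized d)
    (V : VanishBelow d v) {ℓ m k n2 n5 n6 n8 n9 n12 : ℤ}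
    (hw : 2 * n2 + 5 * n5 + 6 * n6 + 8 * n8 + 9 * n9 + 12 * n12 ≤ v - 3) :
    cf (d 1) ℓ m k n2 n5 n6 n8 n9 n12 = 0 ∧ cf (d 2) ℓ m k n2 n5 n6 n8 n9 n12 = 0 := by
  rcases lt_trichotomy ℓ 0 with h | rfl | h
  · exact ⟨cf_of_neg _ fun H => by omega, cf_of_neg _ fun H => by omega⟩
  · rcases hw.lt_or_eq with hw | hw
    · exact ⟨V.d3_zero _ _ _ _ _ _ _ _ _ hw, V.d4_zero _ _ _ _ _ _ _ _ _ hw⟩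
    · refine ⟨d3_zero_vanish S N V hw, cf_eq_zero_of_nonneg fun _ hm _ _ _ _ _ _ _ => ?_⟩
      rcases eq_or_ne m 0 with rfl | hm0
      · exact d4_zero_vanish S N V hw
      · exact d4_zero_of_pos S N V hw (Or.inl (by omega))
  · exact ⟨V.d3_one _ _ _ _ _ _ _ _ _ h (by omega), V.d4_one _ _ _ _ _ _ _ _ _ h (by omega)⟩

/-- The linear part of `d 4` in `u_5` is annihilated by `∂²/∂u_2²`, and by homogeneity and
`(m - k - 1) cf (d 4) 1 m k = 0` it is a multiple of `u_5 u_2`, which has weight `9`. -/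
theorem d7_vanish (S : DefectSystem d) (N : Normalized d)
    (V : VanishBelow d v) {ℓ m k n2 n5 n6 n8 n9 n12 : ℤ}
    (hw : 2 * n2 + 5 * n5 + 6 * n6 + 8 * n8 + 9 * n9 + 12 * n12 ≤ v) :
    cf (d 4) ℓ m k n2 n5 n6 n8 n9 n12 = 0 := by
  refine cf_eq_zero_of_nonneg fun _ hm hk a2 a5 a6 a8 a9 a12 => ?_
  rcases hw.lt_or_eq with hw | hw
  · exact V.d7_low _ _ _ _ _ _ _ _ _ hw
  rcases lt_trichotomy ℓ 1 with h | rfl | h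
  · exact S.d7_zero _ _ _ _ _ _ _ _ _ (by omega)
  · rcases le_or_gt 2 m with h2 | h2
    · have h := (S.low V (m := m - 2) n2 n5 n6 n8 n9 n12 (by omega) hk hw.le).rel47_1
      rw [sub_add_cancel] at h
      linarith
    · -- Homogeneity leaves two exponents, `μ_2² μ_5` and `μ_9`, which `Normalized` covers.
      by_contra hG
      have r34 := (S.leading V n2 n5 n6 n8 n9 n12 hm hk (by omega)).rel34_1
      have r47 := (S.leading V (k := k + 1) n2 n5 n6 n8 n9 n12 hm (by omega) (by omega)).rel47_0
      have r37 := (S.leading V (m := m + 1) n2 n5 n6 n8 n9 n12 (by omega) hk (by omega)).rel37_0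
      rw [V.d4_one 1 _ _ (n2 - 1) _ _ _ _ _ le_rfl (by omega),
        V.d3_one 1 _ _ (n2 - 1) _ _ _ _ _ le_rfl (by omega)] at r34
      rw [V.d4_zero 0 _ _ _ (n5 - 1) _ _ _ _ (by omega)] at r47
      rw [V.d3_zero 0 _ _ _ (n5 - 1) _ _ _ _ (by omega)] at r37
      push_cast at r37 r47
      have h0 : ((m : ℚ) - k - 1) * cf (d 4) 1 m k n2 n5 n6 n8 n9 n12 = 0 := by
        linear_combination (norm := ring_nf) r34 + r47 - r37 / 2
      have h1 : m - k - 1 = 0 := by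
        have := (mul_eq_zero.1 h0).resolve_right hG
        exact_mod_cast this
      have hhom := N.hom_d7 _ _ _ _ _ _ _ _ _ hG
      unfold kOf at hhom
      obtain rfl : m = 1 := by omega
      obtain rfl : k = 0 := by omega
      obtain rfl : n12 = 0 := by omega
      rcases le_or_gt n9 0 with h9 | h9
      · obtain rfl : n9 = 0 := by omega
        obtain rfl : n5 = 1 := by omega
        obtain rfl : n6 = 0 := by omega
        obtain rfl : n8 = 0 := by omega
        obtain rfl : n2 = 2 := by omega
        exact hG N.d7_W9
      · obtain rfl : n9 = 1 := by omega
        obtain rfl : n5 = 0 := by omega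
        obtain rfl : n6 = 0 := by omega
        obtain rfl : n8 = 0 := by omega
        obtain rfl : n2 = 0 := by omega
        exact hG N.d7_W9'
  · exact (S.two V _ _ _ _ _ _ _ _ h (by omega)).2.2.2

/-- The linear part of `d 3` in `u_5` is free of `u_2`, and the structure equations at the exponent
`n2 + 1` show that its degree in `u_1` is at most `1`. -/
theorem d6_one_vanish (S : DefectSystem d) (N : Normalized d)
    (V : VanishBelow d v) {m k n2 n5 n6 n8 n9 n12 : ℤ}
    (hw : 2 * n2 + 5 * n5 + 6 * n6 + 8 * n8 + 9 * n9 + 12 * n12 = v) :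
    cf (d 3) 1 m k n2 n5 n6 n8 n9 n12 = 0 := by
  refine cf_eq_zero_of_nonneg fun _ hm hk a2 a5 a6 a8 a9 a12 => ?_
  rcases eq_or_ne m 0 with rfl | hm0
  · rcases le_or_gt 2 k with hk2 | hk2
    · have r46 := (S.leading V (m := 0) (k := k - 2) (n2 + 1) n5 n6 n8 n9 n12 le_rfl (by omega)
        (by omega)).rel46_1
      have r67 := (S.leading V (m := 1) (k := k - 2) (n2 + 1) n5 n6 n8 n9 n12 (by omega) (by omega)
        (by omega)).rel67_0
      have r37 := (S.leading V (m := 0) (k := k - 2) (n2 + 1) n5 n6 n8 n9 n12 le_rfl (by omega)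
        (by omega)).rel37_1
      rw [d7_vanish S N V (n2 := n2 + 1 - 1) (by omega)] at r37
      linear_combination (norm := ring_nf) -6 * r46 - 3 * r67 + 3 * r37
    · -- Homogeneity leaves the exponents of `μ_2³`, `μ_2 μ_5` and `μ_6`, which `Normalized` covers.
      by_contra hE
      have hhom := N.hom_d6 _ _ _ _ _ _ _ _ _ hE
      unfold kOf at hhom
      have h12 : n12 = 0 := by omega
      have h9 : n9 = 0 := by omega
      have h8 : n8 = 0 := by omega
      subst h8 h9 h12
      rcases le_or_gt n6 0 with h6 | h6
      · obtain rfl : n6 = 0 := by omega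
        rcases le_or_gt n5 0 with h5 | h5
        · obtain rfl : n5 = 0 := by omega
          obtain rfl : k = 0 := by omega
          obtain rfl : n2 = 3 := by omega
          exact hE N.d6_W6
        · obtain rfl : n5 = 1 := by omega
          obtain rfl : n2 = 1 := by omega
          obtain rfl : k = 1 := by omega
          exact hE N.d6_W7
      · obtain rfl : n6 = 1 := by omega
        obtain rfl : n5 = 0 := by omega
        obtain rfl : n2 = 0 := by omega
        obtain rfl : k = 0 := by omega
        exact hE N.d6_W6'
  · have r67 := (S.leading V (m := m - 1) n2 n5 n6 n8 n9 n12 (by omega) hk (by omega)).rel67_0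
    rw [d7_vanish S N V hw.le, sub_add_cancel] at r67
    linarith

/-- The linear part of `d 2` in `u_5` is free of `u_2`. -/
theorem d4_one_of_pos (S : DefectSystem d) (N : Normalized d)
    (V : VanishBelow d v) {m k n2 n5 n6 n8 n9 n12 : ℤ} (hm : m ≠ 0)
    (hw : 2 * n2 + 5 * n5 + 6 * n6 + 8 * n8 + 9 * n9 + 12 * n12 = v) :
    cf (d 2) 1 m k n2 n5 n6 n8 n9 n12 = 0 := by
  refine cf_eq_zero_of_nonneg fun _ _ hk _ _ _ _ _ _ => ?_
  have r47 := (S.leading V (m := m - 1) n2 n5 n6 n8 n9 n12 (by omega) hk (by omega)).rel47_0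
  rw [V.d4_zero 0 _ _ _ (n5 - 1) _ _ _ _ (by omega), d7_vanish S N V hw.le, sub_add_cancel] at r47
  linarith

/-- The linear part of `d 1` in `u_5` is free of `u_2`, and the structure equations at the exponent
`n2 + 1` show that its degree in `u_1` is at most `3`. -/
theorem d3_one_vanish (S : DefectSystem d) (N : Normalized d)
    (V : VanishBelow d v) {m k n2 n5 n6 n8 n9 n12 : ℤ}
    (hw : 2 * n2 + 5 * n5 + 6 * n6 + 8 * n8 + 9 * n9 + 12 * n12 = v) :
    cf (d 1) 1 m k n2 n5 n6 n8 n9 n12 = 0 := by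
  refine cf_eq_zero_of_nonneg fun _ hm hk a2 a5 a6 a8 a9 a12 => ?_
  rcases eq_or_ne m 0 with rfl | hm0
  · rcases le_or_gt 4 k with hk4 | hk4
    · have r34 := (S.leading V (m := 0) (k := k - 2) (n2 + 1) n5 n6 n8 n9 n12 le_rfl (by omega)
        (by omega)).rel34_1
      have r47 := (S.leading V (m := 0) (k := k - 1) (n2 + 1) n5 n6 n8 n9 n12 le_rfl (by omega)
        (by omega)).rel47_0
      have r37 := (S.leading V (m := 1) (k := k - 2) (n2 + 1) n5 n6 n8 n9 n12 (by omega) (by omega)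
        (by omega)).rel37_0
      have r67 := (S.leading V (m := 0) (k := k - 3) (n2 + 1) n5 n6 n8 n9 n12 le_rfl (by omega)
        (by omega)).rel67_0
      have r36 := (S.leading V (m := 0) (k := k - 4) (n2 + 1) n5 n6 n8 n9 n12 le_rfl (by omega)
        (by omega)).rel36_1
      rw [d4_one_of_pos S N V (n2 := n2 + 1 - 1) (by omega) (by omega)] at r34
      rw [(d3_d4_vanish S N V (n5 := n5 - 1) (by omega)).2] at r47
      rw [(d3_d4_vanish S N V (n5 := n5 - 1) (by omega)).1] at r37
      rw [d6_one_vanish S N V (n2 := n2 + 1 - 1) (by omega),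
        d7_vanish S N V (n2 := n2 + 1 - 1) (by omega)] at r36
      push_cast at r47 r37
      linear_combination (norm := ring_nf) 6 * r34 + 6 * r47 - 3 * r37
        - 6 * (k - 1) * (r67 + r36)
    · -- Homogeneity leaves the exponents of `μ_2²`, `μ_2³`, `μ_5` and `μ_6`.
      by_contra h0
      have hhom := N.hom_d3 _ _ _ _ _ _ _ _ _ h0
      unfold kOf at hhom
      have h12 : n12 = 0 := by omega
      have h9 : n9 = 0 := by omega
      have h8 : n8 = 0 := by omega
      subst h8 h9 h12
      rcases le_or_gt n6 0 with h6 | h6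
      · obtain rfl : n6 = 0 := by omega
        rcases le_or_gt n5 0 with h5 | h5
        · obtain rfl : n5 = 0 := by omega
          rcases le_or_gt n2 2 with h2 | h2
          · obtain rfl : n2 = 2 := by omega
            obtain rfl : k = 1 := by omega
            exact h0 N.d3_W4
          · obtain rfl : n2 = 3 := by omega
            obtain rfl : k = 3 := by omega
            exact h0 N.d3_W6
        · obtain rfl : n5 = 1 := by omega
          obtain rfl : n2 = 0 := by omega
          obtain rfl : k = 2 := by omega
          exact h0 N.d3_W5
      · obtain rfl : n6 = 1 := by omega
        obtain rfl : n5 = 0 := by omega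
        obtain rfl : n2 = 0 := by omega
        obtain rfl : k = 3 := by omega
        exact h0 N.d3_W6'
  · have r37 := (S.leading V (m := m - 1) n2 n5 n6 n8 n9 n12 (by omega) hk (by omega)).rel37_0
    rw [V.d3_zero 0 _ _ _ (n5 - 1) _ _ _ _ (by omega), d7_vanish S N V hw.le, sub_add_cancel] at r37
    linarith

theorem d6_zero_of_pos (S : DefectSystem d) (N : Normalized d)
    (V : VanishBelow d v) {m k n2 n5 n6 n8 n9 n12 : ℤ} (hm : m ≠ 0) (hk : k ≠ 0)
    (hw : 2 * n2 + 5 * n5 + 6 * n6 + 8 * n8 + 9 * n9 + 12 * n12 = v) :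
    cf (d 3) 0 m k n2 n5 n6 n8 n9 n12 = 0 := by
  refine cf_eq_zero_of_nonneg fun _ _ _ _ _ _ _ _ _ => ?_
  have r36 := (S.low V (m := m - 1) (k := k - 1) n2 n5 n6 n8 n9 n12 (by omega) (by omega)
      hw.le).rel36_0
  rw [d6_one_vanish S N V hw, d3_one_vanish S N V hw, sub_add_cancel, sub_add_cancel] at r36
  linarith

/-- The degree in `u_1` of the linear part of `d 2` in `u_5` is at most `1`, by the structure
equation of the operators with subscripts `4` and `6`. -/
theorem d4_one_vanish (S : DefectSystem d) (N : Normalized d)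
    (V : VanishBelow d v) {m k n2 n5 n6 n8 n9 n12 : ℤ}
    (hw : 2 * n2 + 5 * n5 + 6 * n6 + 8 * n8 + 9 * n9 + 12 * n12 = v) :
    cf (d 2) 1 m k n2 n5 n6 n8 n9 n12 = 0 := by
  refine cf_eq_zero_of_nonneg fun _ hm hk a2 a5 a6 a8 a9 a12 => ?_
  rcases eq_or_ne m 0 with rfl | hm0
  · rcases le_or_gt 2 k with hk2 | hk2
    · have r46 := (S.low V (m := 0) (k := k - 1) n2 n5 n6 n8 n9 n12 le_rfl (by omega) hw.le).rel46_0
      rw [d6_one_vanish S N V hw, d6_zero_of_pos S N V (by omega) (by omega) hw, sub_add_cancel]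
        at r46
      linarith
    · -- Homogeneity leaves the exponents of `μ_2²` and `μ_5`.
      by_contra hD
      have hhom := N.hom_d4 _ _ _ _ _ _ _ _ _ hD
      unfold kOf at hhom
      have h12 : n12 = 0 := by omega
      have h9 : n9 = 0 := by omega
      have h8 : n8 = 0 := by omega
      have h6 : n6 = 0 := by omega
      subst h6 h8 h9 h12
      rcases le_or_gt n5 0 with h5 | h5
      · obtain rfl : n5 = 0 := by omega
        obtain rfl : n2 = 2 := by omega
        obtain rfl : k = 0 := by omega
        exact hD N.d4_W4
      · obtain rfl : n5 = 1 := by omega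
        obtain rfl : n2 = 0 := by omega
        obtain rfl : k = 1 := by omega
        exact hD N.d4_W5
  · exact d4_one_of_pos S N V hm0 hw

theorem d6_vanish (S : DefectSystem d) (N : Normalized d)
    (V : VanishBelow d v) {ℓ m k n2 n5 n6 n8 n9 n12 : ℤ}
    (hw : 2 * n2 + 5 * n5 + 6 * n6 + 8 * n8 + 9 * n9 + 12 * n12 ≤ v) :
    cf (d 3) ℓ m k n2 n5 n6 n8 n9 n12 = 0 := by
  refine cf_eq_zero_of_nonneg fun hℓ hm hk a2 a5 a6 a8 a9 a12 => ?_
  rcases hw.lt_or_eq with hw | hw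
  · exact V.d6_low _ _ _ _ _ _ _ _ _ hw
  rcases lt_trichotomy ℓ 1 with h | rfl | h
  · obtain rfl : ℓ = 0 := by omega
    rcases le_or_gt 2 m with h2 | h2
    · have r46 := (S.low V (m := m - 2) n2 n5 n6 n8 n9 n12 (by omega) hk hw.le).rel46_0
      rw [d6_one_vanish S N V hw, d4_one_vanish S N V hw, sub_add_cancel] at r46
      linarith
    · rcases eq_or_ne m 0 with rfl | hm0
      · exact N.d6_zero _ _ _ _ _ _ _
      · obtain rfl : m = 1 := by omega
        rcases eq_or_ne k 0 with rfl | hk0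
        · -- By homogeneity the weight would have to be `3`, which no monomial has.
          by_contra hE
          have hhom := N.hom_d6 _ _ _ _ _ _ _ _ _ hE
          unfold kOf at hhom
          have h5 : n5 = 0 := by omega
          omega
        · exact d6_zero_of_pos S N V one_ne_zero hk0 hw
  · exact d6_one_vanish S N V hw
  · exact (S.two V _ _ _ _ _ _ _ _ h (by omega)).2.2.1

/-- If the defects vanish below the order `v`, then so they do below `v + 1`. -/
theorem VanishBelow.step (S : DefectSystem d) (N : Normalized d)
    (V : VanishBelow d v) : VanishBelow d (v + 1) where
  d3_zero _ _ _ _ _ _ _ _ _ hw := (d3_d4_vanish S N V (by omega)).1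
  d4_zero _ _ _ _ _ _ _ _ _ hw := (d3_d4_vanish S N V (by omega)).2
  d3_one ℓ _ _ n2 n5 n6 n8 n9 n12 hℓ hw := by
    rcases hℓ.eq_or_lt with rfl | hℓ
    · rcases (Int.le_of_lt_add_one hw).eq_or_lt with h | h
      · exact d3_one_vanish S N V h
      · exact V.d3_one _ _ _ _ _ _ _ _ _ le_rfl h
    · exact (S.two V _ _ _ _ _ _ _ _ hℓ (by omega)).1
  d4_one ℓ _ _ n2 n5 n6 n8 n9 n12 hℓ hw := by
    rcases hℓ.eq_or_lt with rfl | hℓ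
    · rcases (Int.le_of_lt_add_one hw).eq_or_lt with h | h
      · exact d4_one_vanish S N V h
      · exact V.d4_one _ _ _ _ _ _ _ _ _ le_rfl h
    · exact (S.two V _ _ _ _ _ _ _ _ hℓ (by omega)).2.1
  d6_low _ _ _ _ _ _ _ _ _ hw := d6_vanish S N V (by omega)
  d7_low _ _ _ _ _ _ _ _ _ hw := d7_vanish S N V (by omega)

theorem vanishBelow (S : DefectSystem d) (N : Normalized d) (v : ℕ) :
    VanishBelow d v := by
  induction v with
  | zero =>
    constructor <;> intros <;>
    · refine cf_of_neg _ fun H => ?_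
      push_cast at *
      omega
  | succ v ih => exact_mod_cast ih.step S N

/-- The weights are unbounded, so vanishing to all orders is vanishing. -/
theorem defects_eq_zero (S : DefectSystem d) (N : Normalized d) :
    d 1 = 0 ∧ d 2 = 0 ∧ d 3 = 0 ∧ d 4 = 0 := by
  have key : ∀ ℓ m k n2 n5 n6 n8 n9 n12 : ℤ,
      cf (d 1) ℓ m k n2 n5 n6 n8 n9 n12 = 0 ∧ cf (d 2) ℓ m k n2 n5 n6 n8 n9 n12 = 0 ∧
      cf (d 3) ℓ m k n2 n5 n6 n8 n9 n12 = 0 ∧ cf (d 4) ℓ m k n2 n5 n6 n8 n9 n12 = 0 := by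
    intro ℓ m k n2 n5 n6 n8 n9 n12
    have V := vanishBelow S N
      (2 * n2 + 5 * n5 + 6 * n6 + 8 * n8 + 9 * n9 + 12 * n12 + 4).toNat
    refine ⟨V.d3_zero _ _ _ _ _ _ _ _ _ ?_, V.d4_zero _ _ _ _ _ _ _ _ _ ?_,
      V.d6_low _ _ _ _ _ _ _ _ _ ?_, V.d7_low _ _ _ _ _ _ _ _ _ ?_⟩ <;> omega
  refine ⟨series_ext ?_, series_ext ?_, series_ext ?_, series_ext ?_⟩ <;>
    intro ℓ m k n2 n5 n6 n8 n9 n12 <;> intros <;> rw [cf_zero] <;>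
    obtain ⟨h1, h2, h3, h4⟩ := key ℓ m k n2 n5 n6 n8 n9 n12 <;> assumption

end Defects

/-! ### The defects of the family computed by the scheme -/

set_option maxHeartbeats 2000000 in
/-- The recurrences hold at the indices of low weight at which the structure equations do not imply
them. -/
theorem Scheme.low_defects {c : ℚ} {b : HCoeff} (h : Scheme c b) :
    cf (heatOp 2 (hurwitzSeries b)) 0 0 1 0 0 0 0 0 0 = 0 ∧
    cf (heatOp 2 (hurwitzSeries b)) 1 0 0 2 0 0 0 0 0 = 0 ∧
    cf (heatOp 2 (hurwitzSeries b)) 1 0 1 0 1 0 0 0 0 = 0 ∧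
    cf (heatOp 1 (hurwitzSeries b)) 1 0 1 2 0 0 0 0 0 = 0 ∧
    cf (heatOp 1 (hurwitzSeries b)) 1 0 2 0 1 0 0 0 0 = 0 ∧
    cf (heatOp 1 (hurwitzSeries b)) 1 0 3 3 0 0 0 0 0 = 0 ∧
    cf (heatOp 1 (hurwitzSeries b)) 1 0 3 0 0 1 0 0 0 = 0 ∧
    cf (heatOp 3 (hurwitzSeries b)) 1 0 0 3 0 0 0 0 0 = 0 ∧
    cf (heatOp 3 (hurwitzSeries b)) 1 0 0 0 0 1 0 0 0 = 0 ∧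
    cf (heatOp 3 (hurwitzSeries b)) 1 0 1 1 1 0 0 0 0 = 0 ∧
    cf (heatOp 4 (hurwitzSeries b)) 1 1 0 2 1 0 0 0 0 = 0 ∧
    cf (heatOp 4 (hurwitzSeries b)) 1 1 0 0 0 0 0 1 0 = 0 := by
  have hb : ∀ ℓ m n2 n5 n6 n8 n9 n12, ¬ InRange 0 ℓ m n2 n5 n6 n8 n9 n12 →
    b ℓ m n2 n5 n6 n8 n9 n12 = 0 := supported_of_scheme h
  -- The values of the family that occur in the twelve coefficients, from the scheme.
  have e0 : b 1 0 0 0 0 0 0 0 = c := by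
    rw [h]
    norm_num [schemeRhs, kOf, InRange, hb]
  have e1 : b 0 2 0 0 0 0 0 0 = -2 * c := by
    rw [h]
    norm_num [schemeRhs, rhs3, low3, kOf, InRange, hb, e0]
  have e2 : b 1 0 1 0 0 0 0 0 = 0 := by
    rw [h]
    norm_num [schemeRhs, rhs6, kOf, InRange, hb]
  have e3 : b 1 2 2 0 0 0 0 0 = 0 := by
    rw [h]
    norm_num [schemeRhs, rhs7, kOf, InRange, hb]
  have e4 : b 0 1 0 0 0 0 0 0 = 0 := by
    rw [h]
    norm_num [schemeRhs, rhsS, rhs3, rhs4, low3, low4, kOf, InRange, hb]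
  have e5 : b 1 2 0 1 0 0 0 0 = 0 := by
    rw [h]
    norm_num [schemeRhs, rhs7, kOf, InRange, hb, e4]
  have e6 : b 2 0 0 1 0 0 0 0 = 0 := by
    rw [h]
    norm_num [schemeRhs, rhs10, kOf, InRange, hb]
  have e7 : b 1 1 1 0 0 0 0 0 = 0 := by
    rw [h]
    norm_num [schemeRhs, rhs7, kOf, InRange, hb]
  have e8 : b 1 1 2 0 0 0 0 0 = 0 := by
    rw [h]
    norm_num [schemeRhs, rhs7, kOf, InRange, hb]
  have e9 : b 0 0 0 0 0 0 0 0 = 6 * c := by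
    rw [h]
    norm_num [schemeRhs, rhsT0, low3, low4, kOf, InRange, hb, e1, e2]
    ring
  have e10 : b 1 1 0 1 0 0 0 0 = -c := by
    rw [h]
    norm_num [schemeRhs, rhs7, kOf, InRange, hb, e9]
    ring
  have e11 : b 1 1 3 0 0 0 0 0 = 0 := by
    rw [h]
    norm_num [schemeRhs, rhs7, kOf, InRange, hb]
  have e12 : b 1 1 0 0 1 0 0 0 = 0 := by
    rw [h]
    norm_num [schemeRhs, rhs7, kOf, InRange, hb, e4]
  have e13 : b 2 0 3 0 0 0 0 0 = 0 := by
    rw [h]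
    norm_num [schemeRhs, rhs10, kOf, InRange, hb]
  have e14 : b 2 0 0 0 1 0 0 0 = 0 := by
    rw [h]
    norm_num [schemeRhs, rhs10, kOf, InRange, hb]
  have e15 : b 2 0 1 1 0 0 0 0 = 0 := by
    rw [h]
    norm_num [schemeRhs, rhs10, kOf, InRange, hb]
  have e16 : b 2 2 2 1 0 0 0 0 = 0 := by
    rw [h]
    norm_num [schemeRhs, rhs10, kOf, InRange, hb]
  have e17 : b 2 2 0 0 0 0 1 0 = 0 := by
    rw [h]
    norm_num [schemeRhs, rhs10, kOf, InRange, hb]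
  refine ⟨?_, ?_, ?_, ?_, ?_, ?_, ?_, ?_, ?_, ?_, ?_, ?_⟩
  · have h0 := cf_heatOp_4_hurwitzSeries (ℓ := 0) (m := 0) (k := 1) 0 0 0 0 0 0 hb (by norm_num)
      (by norm_num) (by norm_num)
    norm_num [rhs4, low4, kOf, InRange, hb, e0, e1] at h0
    linarith
  · have h0 := cf_heatOp_4_hurwitzSeries (ℓ := 1) (m := 0) (k := 0) 2 0 0 0 0 0 hb (by norm_num)
      (by norm_num) (by norm_num)
    norm_num [rhs4, low4, kOf, InRange, hb, e2, e3] at h0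
    linarith
  · have h0 := cf_heatOp_4_hurwitzSeries (ℓ := 1) (m := 0) (k := 1) 0 1 0 0 0 0 hb (by norm_num)
      (by norm_num) (by norm_num)
    norm_num [rhs4, low4, kOf, InRange, hb, e5, e6] at h0
    linarith
  · have h0 := cf_heatOp_3_hurwitzSeries (ℓ := 1) (m := 0) (k := 1) 2 0 0 0 0 0 hb (by norm_num)
      (by norm_num) (by norm_num)
    norm_num [rhs3, low3, kOf, InRange, hb, e7, e8] at h0
    linarith
  · have h0 := cf_heatOp_3_hurwitzSeries (ℓ := 1) (m := 0) (k := 2) 0 1 0 0 0 0 hb (by norm_num)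
      (by norm_num) (by norm_num)
    norm_num [rhs3, low3, kOf, InRange, hb, e0, e2, e10] at h0
    linarith
  · have h0 := cf_heatOp_3_hurwitzSeries (ℓ := 1) (m := 0) (k := 3) 3 0 0 0 0 0 hb (by norm_num)
      (by norm_num) (by norm_num)
    norm_num [rhs3, low3, kOf, InRange, hb, e4, e8, e11] at h0
    linarith
  · have h0 := cf_heatOp_3_hurwitzSeries (ℓ := 1) (m := 0) (k := 3) 0 0 1 0 0 0 hb (by norm_num)
      (by norm_num) (by norm_num)
    norm_num [rhs3, low3, kOf, InRange, hb, e4, e12] at h0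
    linarith
  · have h0 := cf_heatOp_6_hurwitzSeries (ℓ := 1) (m := 0) (k := 0) 3 0 0 0 0 0 hb (by norm_num)
      (by norm_num) (by norm_num)
    norm_num [rhs6, kOf, InRange, hb, e13] at h0
    linarith
  · have h0 := cf_heatOp_6_hurwitzSeries (ℓ := 1) (m := 0) (k := 0) 0 0 1 0 0 0 hb (by norm_num)
      (by norm_num) (by norm_num)
    norm_num [rhs6, kOf, InRange, hb, e14] at h0
    linarith
  · have h0 := cf_heatOp_6_hurwitzSeries (ℓ := 1) (m := 0) (k := 1) 1 1 0 0 0 0 hb (by norm_num)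
      (by norm_num) (by norm_num)
    norm_num [rhs6, kOf, InRange, hb, e7, e15] at h0
    linarith
  · have h0 := cf_heatOp_7_hurwitzSeries (ℓ := 1) (m := 1) (k := 0) 2 1 0 0 0 0 hb (by norm_num)
      (by norm_num) (by norm_num)
    norm_num [rhs7, kOf, InRange, hb, e8, e16] at h0
    linarith
  · have h0 := cf_heatOp_7_hurwitzSeries (ℓ := 1) (m := 1) (k := 0) 0 0 0 0 1 0 hb (by norm_num)
      (by norm_num) (by norm_num)
    norm_num [rhs7, kOf, InRange, hb, e7, e17] at h0
    linarith

theorem scheme_R10 {c : ℚ} {b : HCoeff} (h : Scheme c b) : R10 b := by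
  intro ℓ m n2 n5 n6 n8 n9 n12 ⟨hℓ, hm, a2, a5, a6, a8, a9, a12, hk⟩
  have hr : InRange 0 (ℓ + 2) m n2 n5 n6 n8 n9 n12 :=
    ⟨by omega, hm, a2, a5, a6, a8, a9, a12, by unfold kOf at *; omega⟩
  rw [h (ℓ + 2)]
  unfold schemeRhs
  rw [if_neg (not_not.2 hr), if_neg (by omega), if_pos (by omega), add_sub_cancel_right]
  ring

theorem homogeneous_heatOp_3 {b : HCoeff} (hb : Supported b) {ℓ m k n2 n5 n6 n8 n9 n12 : ℤ}
    (h : cf (heatOp 1 (hurwitzSeries b)) ℓ m k n2 n5 n6 n8 n9 n12 ≠ 0) :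
    k = kOf ℓ m n2 n5 n6 n8 n9 n12 - 3 :=
  homogeneous_of_cf (by norm_num) (fun _ _ _ _ _ _ _ _ _ h1 h2 h3 =>
    cf_heatOp_3_hurwitzSeries _ _ _ _ _ _ hb h1 h2 h3) h

theorem homogeneous_heatOp_4 {b : HCoeff} (hb : Supported b) {ℓ m k n2 n5 n6 n8 n9 n12 : ℤ}
    (h : cf (heatOp 2 (hurwitzSeries b)) ℓ m k n2 n5 n6 n8 n9 n12 ≠ 0) :
    k = kOf ℓ m n2 n5 n6 n8 n9 n12 - 4 :=
  homogeneous_of_cf (by norm_num) (fun _ _ _ _ _ _ _ _ _ h1 h2 h3 =>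
    cf_heatOp_4_hurwitzSeries _ _ _ _ _ _ hb h1 h2 h3) h

theorem homogeneous_heatOp_6 {b : HCoeff} (hb : Supported b) {ℓ m k n2 n5 n6 n8 n9 n12 : ℤ}
    (h : cf (heatOp 3 (hurwitzSeries b)) ℓ m k n2 n5 n6 n8 n9 n12 ≠ 0) :
    k = kOf ℓ m n2 n5 n6 n8 n9 n12 - 6 :=
  homogeneous_of_cf (by norm_num) (fun _ _ _ _ _ _ _ _ _ h1 h2 h3 =>
    cf_heatOp_6_hurwitzSeries _ _ _ _ _ _ hb h1 h2 h3) h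

theorem homogeneous_heatOp_7 {b : HCoeff} (hb : Supported b) {ℓ m k n2 n5 n6 n8 n9 n12 : ℤ}
    (h : cf (heatOp 4 (hurwitzSeries b)) ℓ m k n2 n5 n6 n8 n9 n12 ≠ 0) :
    k = kOf ℓ m n2 n5 n6 n8 n9 n12 - 7 :=
  homogeneous_of_cf (by norm_num) (fun _ _ _ _ _ _ _ _ _ h1 h2 h3 =>
    cf_heatOp_7_hurwitzSeries _ _ _ _ _ _ hb h1 h2 h3) h

/-- The line `r_7` of the scheme is the relation `R_7` at the indices with `ℓ = 0`, as the line
`r_10` only concerns `ℓ > 1`. -/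
theorem scheme_d7_zero {c : ℚ} {b : HCoeff} (h : Scheme c b) {ℓ : ℤ} (m k n2 n5 n6 n8 n9 n12 : ℤ)
    (hℓ : ℓ ≤ 0) : cf (heatOp 4 (hurwitzSeries b)) ℓ m k n2 n5 n6 n8 n9 n12 = 0 := by
  by_contra h0
  have hk := homogeneous_heatOp_7 (supported_of_scheme h) h0
  refine h0 (cf_eq_zero_of_nonneg fun h1 h2 h3 _ _ _ _ _ _ => ?_)
  obtain rfl : ℓ = 0 := by omega
  have h7 := cf_heatOp_7_hurwitzSeries n2 n5 n6 n8 n9 n12 (supported_of_scheme h) h1 h2 h3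
  have hr : InRange 0 1 (m + 1) n2 n5 n6 n8 n9 n12 := by
    unfold InRange kOf at *
    omega
  rw [if_pos hk, zero_add, h 1] at h7
  unfold schemeRhs at h7
  rw [if_neg (not_not.2 hr), if_neg (by omega), if_neg (by omega), if_pos (by omega), sub_self,
    add_sub_cancel_right] at h7
  linarith

/-- The line `r_6` of the scheme is the relation `R_6` at the indices with `ℓ = m = 0`. -/
theorem scheme_d6_zero {c : ℚ} {b : HCoeff} (h : Scheme c b) (k n2 n5 n6 n8 n9 n12 : ℤ) :
    cf (heatOp 3 (hurwitzSeries b)) 0 0 k n2 n5 n6 n8 n9 n12 = 0 := by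
  by_contra h0
  have hk := homogeneous_heatOp_6 (supported_of_scheme h) h0
  refine h0 (cf_eq_zero_of_nonneg fun h1 h2 h3 _ _ _ _ _ _ => ?_)
  have h6 := cf_heatOp_6_hurwitzSeries n2 n5 n6 n8 n9 n12 (supported_of_scheme h) h1 h2 h3
  have hr : InRange 0 1 0 n2 n5 n6 n8 n9 n12 := by
    unfold InRange kOf at *
    omega
  rw [if_pos hk, zero_add, h 1] at h6
  unfold schemeRhs at h6
  rw [if_neg (not_not.2 hr), if_neg (by unfold kOf at *; omega), if_neg (by omega),
    if_neg (by omega), if_pos (by unfold kOf at *; omega), sub_self] at h6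
  linarith

/-- The last line of the scheme is the relation `R_3` at the indices with `ℓ = 0` and `m = k + 1`,
for the exponent `k` of `u_1` in the defect. -/
theorem scheme_rel_last {c : ℚ} {b : HCoeff} (h : Scheme c b) (m k n2 n5 n6 n8 n9 n12 : ℤ)
    (hmk : k + 1 = m) : cf (heatOp 1 (hurwitzSeries b)) 0 m k n2 n5 n6 n8 n9 n12 = 0 := by
  by_contra h0
  have hk := homogeneous_heatOp_3 (supported_of_scheme h) h0
  refine h0 (cf_eq_zero_of_nonneg fun h1 h2 h3 _ _ _ _ _ _ => ?_)
  have h3 := cf_heatOp_3_hurwitzSeries n2 n5 n6 n8 n9 n12 (supported_of_scheme h) h1 h2 h3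
  have hr : InRange 0 0 (m + 1) n2 n5 n6 n8 n9 n12 := by
    unfold InRange kOf at *
    omega
  rw [if_pos hk, zero_add, h 0 (m + 1)] at h3
  unfold schemeRhs at h3
  rw [if_neg (not_not.2 hr), if_neg (by omega), if_neg (by omega),
    if_neg (by omega), if_neg (by omega), if_neg (by unfold kOf at *; omega), if_neg (by omega),
    add_sub_cancel_right, show m + 1 - 2 = m - 1 by ring] at h3
  push_cast at h3
  linarith

/-- The line of the scheme for `ℓ = 0`, `m ≠ k + 1` is the combination `S_{3,4}` of `R_3` and `R_4`.
-/
theorem scheme_rel_S {c : ℚ} {b : HCoeff} (h : Scheme c b) (m k n2 n5 n6 n8 n9 n12 : ℤ)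
    (hm : 0 ≤ m) (hk : -1 ≤ k) (hmk : k + 1 ≠ m) :
    (k + 1) * cf (heatOp 1 (hurwitzSeries b)) 0 m k n2 n5 n6 n8 n9 n12
      = 2 * m * cf (heatOp 2 (hurwitzSeries b)) 0 (m - 1) (k + 1) n2 n5 n6 n8 n9 n12 := by
  have hb := supported_of_scheme h
  by_cases hn : 0 ≤ n2 ∧ 0 ≤ n5 ∧ 0 ≤ n6 ∧ 0 ≤ n8 ∧ 0 ≤ n9 ∧ 0 ≤ n12
  swap
  · rw [cf_of_neg _ (by omega), cf_of_neg _ (by omega), mul_zero, mul_zero]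
  by_cases hkk : k = kOf 0 m n2 n5 n6 n8 n9 n12 - 3
  swap
  · have hA : cf (heatOp 1 (hurwitzSeries b)) 0 m k n2 n5 n6 n8 n9 n12 = 0 := by
      by_contra h0
      exact hkk (homogeneous_heatOp_3 hb h0)
    have hD : cf (heatOp 2 (hurwitzSeries b)) 0 (m - 1) (k + 1) n2 n5 n6 n8 n9 n12 = 0 := by
      by_contra h0
      have := homogeneous_heatOp_4 hb h0
      unfold kOf at *
      omega
    rw [hA, hD, mul_zero, mul_zero]
  have hA : (k + 1 : ℚ) * (24 * cf (heatOp 1 (hurwitzSeries b)) 0 m k n2 n5 n6 n8 n9 n12)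
      = (k + 1) * (-24 * b 0 (m + 1) n2 n5 n6 n8 n9 n12 - 48 * m * b 1 (m - 1) n2 n5 n6 n8 n9 n12
        + rhs3 b 0 m n2 n5 n6 n8 n9 n12) := by
    rcases hk.eq_or_lt with rfl | hk
    · simp
    · rw [cf_heatOp_3_hurwitzSeries n2 n5 n6 n8 n9 n12 hb le_rfl hm (by omega), if_pos hkk,
      zero_add]
  have hD : (m : ℚ) * (24 * cf (heatOp 2 (hurwitzSeries b)) 0 (m - 1) (k + 1) n2 n5 n6 n8 n9 n12)
      = m * (-12 * b 0 (m + 1) n2 n5 n6 n8 n9 n12 - 24 * (k + 1) * b 1 (m - 1) n2 n5 n6 n8 n9 n12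
        - rhs4 b 0 (m - 1) n2 n5 n6 n8 n9 n12) := by
    rcases hm.eq_or_lt with rfl | hm
    · simp
    · have hk' : k + 1 = kOf 0 (m - 1) n2 n5 n6 n8 n9 n12 - 4 := by
        unfold kOf at *
        omega
      have hk'' : (kOf 0 (m - 1) n2 n5 n6 n8 n9 n12 : ℚ) - 4 = k + 1 := by
        have := congrArg (Int.cast (R := ℚ)) hk'
        push_cast at this
        exact this.symm
      rw [cf_heatOp_4_hurwitzSeries n2 n5 n6 n8 n9 n12 hb le_rfl (by omega) (by omega), if_pos hk',
        zero_add, hk'', show m - 1 + 2 = m + 1 by ring]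
  have hK : kOf 0 (m + 1) n2 n5 n6 n8 n9 n12 = k + 1 := by
    unfold kOf at *
    omega
  have hr : InRange 0 0 (m + 1) n2 n5 n6 n8 n9 n12 := by
    unfold InRange
    omega
  have hs := h 0 (m + 1) n2 n5 n6 n8 n9 n12
  unfold schemeRhs at hs
  rw [if_neg (not_not.2 hr), if_neg (by omega), if_neg (by omega),
    if_neg (by omega), if_neg (by omega), if_pos (by omega), eq_div_iff] at hs
  · unfold rhsS at hs
    rw [hK, add_sub_cancel_right, show m + 1 - 2 = m - 1 by ring] at hs
    push_cast at hs
    linear_combination hA / 24 - hD / 12 - hs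
  · have : kOf 0 (m + 1) n2 n5 n6 n8 n9 n12 - (m + 1) + 1 ≠ 0 := by omega
    exact_mod_cast this

/-- The line of the scheme for `ℓ = m = 0` is the combination `T_{3,4}` of `R_3` and `R_4`. -/
theorem scheme_rel_T {c : ℚ} {b : HCoeff} (h : Scheme c b) (k n2 n5 n6 n8 n9 n12 : ℤ)
    (hk : 0 ≤ k) (h2 : 1 ≤ n2) : cf (heatOp 1 (hurwitzSeries b)) 0 1 k n2 n5 n6 n8 n9 n12
      = 2 * cf (heatOp 2 (hurwitzSeries b)) 0 0 (k + 1) n2 n5 n6 n8 n9 n12 := by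
  have hb := supported_of_scheme h
  by_cases hn : 0 ≤ n2 ∧ 0 ≤ n5 ∧ 0 ≤ n6 ∧ 0 ≤ n8 ∧ 0 ≤ n9 ∧ 0 ≤ n12
  swap
  · rw [cf_of_neg _ (by omega), cf_of_neg _ (by omega), mul_zero]
  have hA := cf_heatOp_3_hurwitzSeries (ℓ := 0) (m := 1) n2 n5 n6 n8 n9 n12 hb le_rfl zero_le_one hk
  have hD := cf_heatOp_4_hurwitzSeries (ℓ := 0) (m := 0) (k := k + 1) n2 n5 n6 n8 n9 n12 hb le_rfl
    le_rfl (by omega)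
  by_cases hkk : k = kOf 0 1 n2 n5 n6 n8 n9 n12 - 3
  swap
  · rw [if_neg hkk] at hA
    rw [if_neg (by unfold kOf at *; omega)] at hD
    linarith
  have hk' : k + 1 = kOf 0 0 n2 n5 n6 n8 n9 n12 - 4 := by
    unfold kOf at *
    omega
  rw [if_pos hkk] at hA
  rw [if_pos hk'] at hD
  have hr : InRange 0 0 0 (n2 - 1) n5 n6 n8 n9 n12 := by
    unfold InRange kOf
    omega
  have hs := h 0 0 (n2 - 1) n5 n6 n8 n9 n12
  unfold schemeRhs at hs
  rw [if_neg (not_not.2 hr), if_neg (by omega), if_neg (by omega),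
    if_neg (by omega), if_neg (by omega), if_neg (by omega), if_pos rfl, eq_rhsT0_iff,
    sub_add_cancel] at hs
  have e1 : (kOf 1 0 n2 n5 n6 n8 n9 n12 : ℚ) = k := by
    rw [hkk]
    unfold kOf
    push_cast
    ring
  have e2 : (kOf 0 0 n2 n5 n6 n8 n9 n12 : ℚ) - 4 = k + 1 := by
    have := congrArg (Int.cast (R := ℚ)) hk'
    push_cast at this
    exact this.symm
  rw [e1] at hs
  rw [e2] at hD
  unfold rhsT at hs
  simp only [zero_add, sub_self, one_add_one_eq_two, Int.cast_one] at hs hA hD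
  linear_combination hA / 24 - hD / 12 + 2 * hs

/-! ### The space of solutions -/

theorem scheme_defectSystem {c : ℚ} {b : HCoeff} (h : Scheme c b) :
    DefectSystem fun j => heatOp j (hurwitzSeries b) where
  d0_eq := (heatOp_zero_eq_zero_iff _).2 ⟨b, supported_of_scheme h, rfl⟩
  d10_eq := (heatOp_10_hurwitzSeries (supported_of_scheme h)).2 (scheme_R10 h)
  comm _ _ hi hij := heatOp_comm_of_lt hi hij _
  d7_zero _ m k n2 n5 n6 n8 n9 n12 hℓ := scheme_d7_zero h m k n2 n5 n6 n8 n9 n12 hℓ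

theorem scheme_normalized {c : ℚ} {b : HCoeff} (h : Scheme c b) :
    Normalized fun j => heatOp j (hurwitzSeries b) := by
  have hb := supported_of_scheme h
  obtain ⟨D0, D4, D5, A4, A5, A6, A6', E6, E6', E7, G9, G9'⟩ := h.low_defects
  exact ⟨fun _ _ _ _ _ _ _ _ _ => homogeneous_heatOp_3 hb,
    fun _ _ _ _ _ _ _ _ _ => homogeneous_heatOp_4 hb,
    fun _ _ _ _ _ _ _ _ _ => homogeneous_heatOp_6 hb,
    fun _ _ _ _ _ _ _ _ _ => homogeneous_heatOp_7 hb, scheme_d6_zero h, scheme_rel_S h,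
    scheme_rel_last h, scheme_rel_T h, D0, D4, D5, A4, A5, A6, A6', E6, E6', E7, G9, G9'⟩

theorem mem_solutionSpace_iff {φ : Series} : φ ∈ solutionSpace ↔ ∀ j, heatOp j φ = 0 := by
  simp only [solutionSpace, Submodule.mem_iInf, LinearMap.mem_ker]

/-- The family computed by the scheme gives a solution of the heat equations. -/
theorem hurwitzSeries_mem_of_scheme {c : ℚ} {b : HCoeff} (h : Scheme c b) :
    hurwitzSeries b ∈ solutionSpace := by
  have hb := supported_of_scheme h
  obtain ⟨h3, h4, h6, h7⟩ := defects_eq_zero (scheme_defectSystem h) (scheme_normalized h)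
  rw [mem_solutionSpace_iff]
  intro j
  fin_cases j
  · exact (heatOp_zero_eq_zero_iff _).2 ⟨b, hb, rfl⟩
  · exact h3
  · exact h4
  · exact h6
  · exact h7
  · exact (heatOp_10_hurwitzSeries hb).2 (scheme_R10 h)

theorem hurwitzSeries_mem_iff {b : HCoeff} (hb : Supported b) :
    hurwitzSeries b ∈ solutionSpace ↔ Scheme (b 1 0 0 0 0 0 0 0) b := by
  refine ⟨fun h => ?_, hurwitzSeries_mem_of_scheme⟩
  rw [mem_solutionSpace_iff] at h
  exact scheme_of_recurrences hb ((heatOp_3_hurwitzSeries hb).1 (h 1))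
    ((heatOp_4_hurwitzSeries hb).1 (h 2)) ((heatOp_6_hurwitzSeries hb).1 (h 3))
    ((heatOp_7_hurwitzSeries hb).1 (h 4)) ((heatOp_10_hurwitzSeries hb).1 (h 5))

theorem scheme_apply {c : ℚ} {b : HCoeff} (h : Scheme c b) : b 1 0 0 0 0 0 0 0 = c := by
  rw [h]
  norm_num [schemeRhs, InRange, kOf]

theorem exists_scheme_of_mem {φ : Series} (h : φ ∈ solutionSpace) :
    ∃ b, Supported b ∧ Scheme (b 1 0 0 0 0 0 0 0) b ∧ φ = hurwitzSeries b := by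
  obtain ⟨b, hb, rfl⟩ := (heatOp_zero_eq_zero_iff φ).1 (mem_solutionSpace_iff.1 h 0)
  exact ⟨b, hb, (hurwitzSeries_mem_iff hb).1 h, rfl⟩

/-- A solution is determined by its coefficient at `u_5`. -/
theorem solution_ext {φ ψ : Series} (hφ : φ ∈ solutionSpace) (hψ : ψ ∈ solutionSpace)
    (h : cf φ 1 0 0 0 0 0 0 0 0 = cf ψ 1 0 0 0 0 0 0 0 0) : φ = ψ := by
  obtain ⟨b, hb, hs, rfl⟩ := exists_scheme_of_mem hφ
  obtain ⟨b', hb', hs', rfl⟩ := exists_scheme_of_mem hψ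
  rw [cf_hurwitzSeries_of_eq hb (by norm_num [kOf]), cf_hurwitzSeries_of_eq hb' (by norm_num [kOf])]
    at h
  rw [h] at hs
  rw [scheme_unique hs hs']

theorem finrank_solutionSpace : Module.finrank ℚ solutionSpace = 1 := by
  obtain ⟨b, hb⟩ := exists_scheme 1
  have hmem := hurwitzSeries_mem_of_scheme hb
  have h1 : cf (hurwitzSeries b) 1 0 0 0 0 0 0 0 0 = 1 := by
    rw [cf_hurwitzSeries_of_eq (supported_of_scheme hb) (by norm_num [kOf]), scheme_apply hb]
  refine finrank_eq_one (⟨hurwitzSeries b, hmem⟩ : solutionSpace) (fun h => ?_) fun φ => ?_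
  · have h0 : hurwitzSeries b = 0 := congrArg Subtype.val h
    rw [h0, cf_zero] at h1
    exact zero_ne_one h1
  · refine ⟨cf φ.1 1 0 0 0 0 0 0 0 0, Subtype.ext ?_⟩
    refine solution_ext (solutionSpace.smul_mem _ hmem) φ.2 ?_
    rw [Submodule.coe_smul, cf_rat_smul, h1, mul_one]

end Curve34

theorem mainTheorem2 :
    Module.finrank ℚ Curve34.solutionSpace = 1 ∧
    (∀ φ : Curve34.Series, Curve34.heatOp 0 φ = 0 ↔
      ∃ b, Curve34.Supported b ∧ φ = Curve34.hurwitzSeries b) ∧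
    (∀ b, Curve34.Supported b →
      (Curve34.heatOp 1 (Curve34.hurwitzSeries b) = 0 ↔ Curve34.R3 b) ∧
      (Curve34.heatOp 2 (Curve34.hurwitzSeries b) = 0 ↔ Curve34.R4 b) ∧
      (Curve34.heatOp 3 (Curve34.hurwitzSeries b) = 0 ↔ Curve34.R6 b) ∧
      (Curve34.heatOp 4 (Curve34.hurwitzSeries b) = 0 ↔ Curve34.R7 b) ∧
      (Curve34.heatOp 5 (Curve34.hurwitzSeries b) = 0 ↔ Curve34.R10 b)) ∧
    (∀ b, Curve34.Supported b → Curve34.R3 b → Curve34.R4 b →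
      Curve34.S34 b ∧ Curve34.T34 b) ∧
    (∀ c : ℚ, ∃! b, Curve34.Scheme c b) ∧
    (∀ b, Curve34.Supported b →
      (Curve34.hurwitzSeries b ∈ Curve34.solutionSpace ↔
        Curve34.Scheme (b 1 0 0 0 0 0 0 0) b)) :=
  ⟨Curve34.finrank_solutionSpace, Curve34.heatOp_zero_eq_zero_iff,
    fun _ hb => ⟨Curve34.heatOp_3_hurwitzSeries hb, Curve34.heatOp_4_hurwitzSeries hb,
      Curve34.heatOp_6_hurwitzSeries hb, Curve34.heatOp_7_hurwitzSeries hb,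
      Curve34.heatOp_10_hurwitzSeries hb⟩,
    fun _ _ h3 h4 => ⟨Curve34.S34_of_R3_R4 h3 h4, Curve34.T34_of_R3_R4 h3 h4⟩,
    Curve34.existsUnique_scheme, fun _ hb => Curve34.hurwitzSeries_mem_iff hb⟩
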